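/- Fix $0<\alpha<1$. An interval partition is a set $\beta$ of disjoint nonempty open subintervals (blocks) of some interval $[0,L]$, $L\ge 0$, covering $[0,L]$ up to a Lebesgue-null set; write $\|\beta\|=L$ and $C_\beta=[0,L]\setminus\bigcup_{U\in\beta}U$. Let $\mathcal I_H$ be the set of interval partitions, and $\mathcal I_\alpha\subset\mathcal I_H$ the set of those $\beta$ for which the (finite) limit $$\mathscr D_\beta(t)=\Gamma(1-\alpha)\lim_{h\downarrow0}h^\alpha\,\#\{(a,b)\in\beta: b-a>h,\ b\le t\}$$ exists for every $t\in[0,\|\beta\|]$; put $\mathscr D_\beta(t)=\mathscr D_\beta(\|\beta\|)$ for $t>\|\beta\|$, $\mathscr D_\beta(\infty)=\mathscr D_\beta(\|\beta\|)$, and $\mathscr D_\beta(U)=\mathscr D_\beta(t)$ for $t\in U\in\beta$. A correspondence between $\beta,\gamma\in\mathcal I_H$ is a finite (possibly empty) sequence $(U_1,V_1),\dots,(U_n,V_n)\in\beta\times\gamma$ such that $(U_j)$ and $(V_j)$ are strictly increasing in the left-to-right order. Consider the quantities (i) $\sum_j|\mathrm{Leb}(U_j)-\mathrm{Leb}(V_j)|+\|\beta\|-\sum_j\mathrm{Leb}(U_j)$;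 (ii) $\sum_j|\mathrm{Leb}(U_j)-\mathrm{Leb}(V_j)|+\|\gamma\|-\sum_j\mathrm{Leb}(V_j)$; (iii) $\sup_j|\mathscr D_\beta(U_j)-\mathscr D_\gamma(V_j)|$; (iv) $|\mathscr D_\beta(\infty)-\mathscr D_\gamma(\infty)|$. Let $d_H'(\beta,\gamma)$, for $\beta,\gamma\in\mathcal I_H$, be the infimum over all correspondences of the maximum of (i)–(ii), let $d_\alpha(\beta,\gamma)$, for $\beta,\gamma\in\mathcal I_\alpha$, be the infimum over all correspondences of the maximum of (i)–(iv), and let $d_H(\beta,\gamma)$ be the Hausdorff distance between $C_\beta$ and $C_\gamma$; $d_H$ and $d_H'$ are metrics on $\mathcal I_H$. Let $\mathcal J$ be the set of pairs $(\eta,f)$ with $\eta\in\mathcal I_H$ and $f:[0,\infty]\to[0,\infty)$ increasing (in the weak sense), right-continuous, and constant on every $U\in\eta$ and on $[\|\eta\|,\infty]$; define $d_{\mathcal J}((\eta,f),(\beta,g))$ as $d_\alpha$, with $f,g$ in place of $\mathscr D_\eta,\mathscr D_\beta$. Theorem 2. (a) $d_\alpha$ is a metric on $\mathcal I_\alpha$.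 (b) $d_H$ and $d_H'$ induce the same subspace topology on $\mathcal I_\alpha$, and the topology generated by $d_\alpha$ is strictly stronger (finer) than it. (c) The Borel $\sigma$-algebra on $\mathcal I_\alpha$ generated by $d_\alpha$ equals the one generated by $d_H$, and the one generated by $d_H'$. (d) $(\mathcal I_\alpha,d_\alpha)$ is Lusin, i.e. homeomorphic to a Borel subset of a compact metric space. Moreover $d_{\mathcal J}$ is a metric on $\mathcal J$, $(\mathcal J,d_{\mathcal J})$ is complete and separable, and the map $\iota(\beta)=(\beta,\mathscr D_\beta(\,\cdot\,+))$ is well defined from $\mathcal I_\alpha$ to $\mathcal J$, where $\mathscr D_\beta(\,\cdot\,+)$ is the right-limit function $t\mapsto\lim_{s\downarrow t}\mathscr D_\beta(s)$ on $[0,\infty)$, with value $\mathscr D_\beta(\infty)$ at $\infty$; $\iota$ is an isometric embedding, and $\iota(\mathcal I_\alpha)$ is a dense Borel subset of $\mathcal J$. -/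

import Mathlib

open Set Filter Topology MeasureTheory
open scoped ENNReal NNReal

noncomputable section

/-- An interval partition: a set of disjoint nonempty open subintervals `(a, b)` of `[0, L]`,
each encoded by its pair of endpoints, covering `[0, L]` up to a Lebesgue-null set.
The number `L = length` is determined by the blocks, being the sum of their masses. -/
@[ext]
structure IntervalPartition where
  blocks : Set (ℝ × ℝ)
  length : ℝ
  length_nonneg : 0 ≤ length
  block_lt : ∀ U ∈ blocks, U.1 < U.2
  block_subset : ∀ U ∈ blocks, Ioo U.1 U.2 ⊆ Icc 0 length
  block_disjoint : blocks.PairwiseDisjoint fun U => Ioo U.1 U.2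
  block_cover : volume (Icc 0 length \ ⋃ U ∈ blocks, Ioo U.1 U.2) = 0

/-- The Lebesgue measure of the interval `(a, b)`. -/
def blockMass (U : ℝ × ℝ) : ℝ := U.2 - U.1

/-- A point of the interval `(a, b)`, used to evaluate on it functions that are constant there. -/
def blockPoint (U : ℝ × ℝ) : ℝ := (U.1 + U.2) / 2

namespace IntervalPartition

/-- The compact set `C_β = [0, L] \ ⋃ U`. -/
def compl (β : IntervalPartition) : Set ℝ :=
  Icc 0 β.length \ ⋃ U ∈ β.blocks, Ioo U.1 U.2

/-- The number of blocks `(a, b)` with `b - a > h` and `b ≤ t` (finite for every `h > 0`). -/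
def count (β : IntervalPartition) (h t : ℝ) : ℕ :=
  {U ∈ β.blocks | h < blockMass U ∧ U.2 ≤ t}.ncard

/-- The `α`-diversity property. -/
def HasDiversity (α : ℝ) (β : IntervalPartition) : Prop :=
  ∀ t ∈ Icc 0 β.length,
    ∃ D : ℝ, Tendsto (fun h : ℝ => h ^ α * (β.count h t : ℝ)) (𝓝[>] 0) (𝓝 D)

/-- The diversity of `β` up to `t`; for `t > L` it has the same value as for `t = L`. -/
def diversity (α : ℝ) (β : IntervalPartition) (t : ℝ) : ℝ :=
  Real.Gamma (1 - α) * limUnder (𝓝[>] 0) (fun h : ℝ => h ^ α * (β.count h t : ℝ))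

/-- A correspondence: a finite sequence (possibly empty) of pairs `(U_j, V_j)` of blocks,
both coordinates being strictly increasing in the left-to-right order. -/
structure Correspondence (β γ : IntervalPartition) where
  n : ℕ
  U : Fin n → ℝ × ℝ
  V : Fin n → ℝ × ℝ
  U_mem : ∀ j, U j ∈ β.blocks
  V_mem : ∀ j, V j ∈ γ.blocks
  U_left : ∀ i j, i < j → (U i).2 ≤ (U j).1
  V_left : ∀ i j, i < j → (V i).2 ≤ (V j).1

namespace Correspondence

variable {β γ : IntervalPartition}

/-- The Hausdorff distortion: the maximum of the quantities (i) and (ii). -/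
def distH (c : Correspondence β γ) : ℝ :=
  max ((∑ j, |blockMass (c.U j) - blockMass (c.V j)|) + β.length - ∑ j, blockMass (c.U j))
    ((∑ j, |blockMass (c.U j) - blockMass (c.V j)|) + γ.length - ∑ j, blockMass (c.V j))

/-- The distortion with respect to functions `φ`, `ψ` on the blocks and total values `p`, `q`:
the maximum of the quantities (i), (ii), `sup_j |φ(U_j) - ψ(V_j)|` and `|p - q|`. -/
def distortion (c : Correspondence β γ) (φ ψ : ℝ × ℝ → ℝ) (p q : ℝ) : ℝ :=
  max c.distH (max (⨆ j, |φ (c.U j) - ψ (c.V j)|) |p - q|)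

end Correspondence

/-- The Hausdorff metric `d_H` between the complements. -/
def dH (β γ : IntervalPartition) : ℝ := Metric.hausdorffDist β.compl γ.compl

/-- The metric `d_H'`. -/
def dH' (β γ : IntervalPartition) : ℝ := ⨅ c : Correspondence β γ, c.distH

end IntervalPartition

/-- The set `I_α` of interval partitions with `α`-diversity, as a type. -/
def DiversityPartition (α : ℝ) : Type := {β : IntervalPartition // β.HasDiversity α}

/-- The inclusion of `I_α` into `I_H`. -/
def DiversityPartition.val {α : ℝ} (β : DiversityPartition α) : IntervalPartition := Subtype.val β

/-- The `α`-distortion distance `d_α`. -/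
def dAlpha (α : ℝ) (β γ : DiversityPartition α) : ℝ :=
  ⨅ c : IntervalPartition.Correspondence β.val γ.val,
    c.distortion (fun U => β.val.diversity α (blockPoint U))
      (fun V => γ.val.diversity α (blockPoint V))
      (β.val.diversity α β.val.length) (γ.val.diversity α γ.val.length)

/-- The set `J` of pairs `(η, f)` of an interval partition `η` and an increasing right-continuous
function `f : [0, ∞] → [0, ∞)` that is constant on every block of `η` and on `[L, ∞]`. -/
@[ext]
structure DecoratedPartition where
  part : IntervalPartition
  f : ℝ≥0∞ → ℝ≥0
  f_mono : Monotone f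
  f_rightCont : ∀ t, ContinuousWithinAt f (Ici t) t
  f_block : ∀ U ∈ part.blocks, ∀ s ∈ Ioo U.1 U.2, ∀ t ∈ Ioo U.1 U.2,
    f (ENNReal.ofReal s) = f (ENNReal.ofReal t)
  f_tail : ∀ t, ENNReal.ofReal part.length ≤ t → f t = f ⊤

/-- The distance `d_J`. -/
def dJ (x y : DecoratedPartition) : ℝ :=
  ⨅ c : IntervalPartition.Correspondence x.part y.part,
    c.distortion (fun U => (x.f (ENNReal.ofReal (blockPoint U)) : ℝ))
      (fun V => (y.f (ENNReal.ofReal (blockPoint V)) : ℝ)) (x.f ⊤ : ℝ) (y.f ⊤ : ℝ)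

/-- The topology of a metric. -/
abbrev metricTopology {X : Type} (m : MetricSpace X) : TopologicalSpace X :=
  m.toPseudoMetricSpace.toUniformSpace.toTopologicalSpace

/-- A Lusin space: homeomorphic to a Borel subset of a compact metric space. -/
def IsLusinSpace (X : Type) [TopologicalSpace X] : Prop :=
  ∃ (K : Type) (_ : MetricSpace K) (_ : CompactSpace K) (e : X → K),
    IsEmbedding e ∧ MeasurableSet[borel K] (range e)

end

/-! All metrics except $d_H$ are pulled back from $d_{\mathcal J}$: $d_\alpha$ along $\iota$ and
$d_H'$ along the decoration by zero (`dJ_toDecorated`, `dJ_zeroDecoration`), so the metric axioms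
are proved once, on $\mathcal J$. The triangle inequality composes two matchings through the middle
blocks they share (`IsMatchingBound.trans`).

The link with $d_H$ works in both directions. A matching of small distortion contains every large
block and moves block endpoints by at most the distortion (`threshold`), whence $d_H\le 3d_{\mathcal
J}$ (`dH_le_dJ`). Conversely, if two complements are Hausdorff close, and the decorations are close
on finitely many blocks carrying almost all the mass and at $\infty$, then $d_{\mathcal J}$ is small
(`exists_isMatchingBound_of_close`). This two-sided comparison shows that $d_H$ and $d_H'$ have the
same topology, and reduces completeness and separability of $\mathcal J$ to those of the space of
nonempty compact sets. For completeness it remains to see that no mass is lost in a Hausdorff limit: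
finitely many blocks of one term of a $d_{\mathcal J}$-Cauchy sequence are matched with almost all
the mass of every later term (`volume_limit_le`).

The image of $\iota$ is cut out by countably many conditions on limits of block counts
(`range_toDecorated`), and these counts are Borel because large blocks persist under small
perturbations (`isOpen_exists_blocks`). Hence the image is Borel in a Polish space, and the
Lusin–Souslin theorem (continuous injective images of Borel sets are Borel) gives both the equality
of the Borel $\sigma$-algebras and the Lusin property.

Density and strictness rest on one construction: blocks with power-law masses, accumulating at a
single point, have any prescribed positive diversity and a total length as small as desired
(`exists_partition_with_diversity`). Such clusters at finitely many points imitate any increasing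
function; a shrinking sequence of partitions of diversity one tends to the empty partition for $d_H$
but not for $d_\alpha$. -/

namespace IntervalPartition

/-! ### Interval partitions and their complements -/

variable (β : IntervalPartition)

theorem block_bounds {U : ℝ × ℝ} (hU : U ∈ β.blocks) : 0 ≤ U.1 ∧ U.2 ≤ β.length := by
  have hlt := β.block_lt U hU
  have h : Icc U.1 U.2 ⊆ Icc 0 β.length := by
    rw [← closure_Ioo hlt.ne]
    exact closure_minimal (β.block_subset U hU) isClosed_Icc
  exact ⟨(h (left_mem_Icc.2 hlt.le)).1, (h (right_mem_Icc.2 hlt.le)).2⟩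

theorem block_separated {U V : ℝ × ℝ} (hU : U ∈ β.blocks) (hV : V ∈ β.blocks) (hne : U ≠ V) :
    U.2 ≤ V.1 ∨ V.2 ≤ U.1 := by
  have h := β.block_disjoint hU hV hne
  simp only [Function.onFun, Ioo_disjoint_Ioo] at h
  have h1 := β.block_lt U hU
  have h2 := β.block_lt V hV
  rcases min_le_iff.1 h with h | h <;> rcases le_max_iff.1 h with h | h
  · linarith
  · exact Or.inl h
  · exact Or.inr h
  · linarith

theorem block_eq_of_mem {U V : ℝ × ℝ} (hU : U ∈ β.blocks) (hV : V ∈ β.blocks) {t : ℝ}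
    (h1 : t ∈ Ioo U.1 U.2) (h2 : t ∈ Ioo V.1 V.2) : U = V := by
  by_contra hne
  rcases β.block_separated hU hV hne with h | h
  · linarith [h1.2, h2.1]
  · linarith [h1.1, h2.2]

theorem block_eq_of_left {U V : ℝ × ℝ} (hU : U ∈ β.blocks) (hV : V ∈ β.blocks)
    (h : U.1 = V.1) : U = V := by
  by_contra hne
  have h1 := β.block_lt U hU
  have h2 := β.block_lt V hV
  rcases β.block_separated hU hV hne with h | h <;> linarith

theorem blockPoint_mem {U : ℝ × ℝ} (hU : U ∈ β.blocks) : blockPoint U ∈ Ioo U.1 U.2 := by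
  have := β.block_lt U hU
  constructor <;> simp only [blockPoint] <;> linarith

theorem mem_compl_iff {t : ℝ} :
    t ∈ β.compl ↔ t ∈ Icc 0 β.length ∧ ∀ U ∈ β.blocks, t ∉ Ioo U.1 U.2 := by
  simp only [compl, Set.mem_sdiff, mem_iUnion, not_exists]

theorem notMem_block_of_mem_compl {t : ℝ} (ht : t ∈ β.compl) {U : ℝ × ℝ} (hU : U ∈ β.blocks) :
    t ≤ U.1 ∨ U.2 ≤ t := by
  have := (β.mem_compl_iff.1 ht).2 U hU
  by_contra! h
  exact this h

theorem mem_compl_or_mem_block {t : ℝ} (ht : t ∈ Icc 0 β.length) :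
    t ∈ β.compl ∨ ∃ U ∈ β.blocks, t ∈ Ioo U.1 U.2 := by
  by_cases h : ∃ U ∈ β.blocks, t ∈ Ioo U.1 U.2
  · exact Or.inr h
  · push Not at h
    exact Or.inl (β.mem_compl_iff.2 ⟨ht, h⟩)

theorem left_mem_compl {U : ℝ × ℝ} (hU : U ∈ β.blocks) : U.1 ∈ β.compl := by
  have hb := β.block_bounds hU
  have hlt := β.block_lt U hU
  refine β.mem_compl_iff.2 ⟨⟨hb.1, by linarith⟩, fun V hV ht => ?_⟩
  rcases eq_or_ne U V with rfl | hne
  · exact lt_irrefl _ ht.1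
  · rcases β.block_separated hU hV hne with h | h
    · linarith [ht.1]
    · linarith [ht.2]

theorem right_mem_compl {U : ℝ × ℝ} (hU : U ∈ β.blocks) : U.2 ∈ β.compl := by
  have hb := β.block_bounds hU
  have hlt := β.block_lt U hU
  refine β.mem_compl_iff.2 ⟨⟨by linarith, hb.2⟩, fun V hV ht => ?_⟩
  rcases eq_or_ne U V with rfl | hne
  · exact lt_irrefl _ ht.2
  · rcases β.block_separated hU hV hne with h | h
    · linarith [ht.1]
    · linarith [ht.2]

theorem zero_mem_compl : (0 : ℝ) ∈ β.compl :=
  β.mem_compl_iff.2 ⟨⟨le_rfl, β.length_nonneg⟩, fun U hU h => by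
    linarith [h.1, (β.block_bounds hU).1]⟩

theorem length_mem_compl : β.length ∈ β.compl :=
  β.mem_compl_iff.2 ⟨⟨β.length_nonneg, le_rfl⟩, fun U hU h => by
    linarith [h.2, (β.block_bounds hU).2]⟩

theorem compl_subset : β.compl ⊆ Icc 0 β.length := sdiff_subset

theorem isClosed_compl : IsClosed β.compl := by
  have : IsOpen (⋃ U ∈ β.blocks, Ioo U.1 U.2) := isOpen_biUnion fun _ _ => isOpen_Ioo
  exact isClosed_Icc.sdiff this

theorem isCompact_compl : IsCompact β.compl :=
  isCompact_Icc.of_isClosed_subset β.isClosed_compl β.compl_subset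

/-- The set `C_β` as a nonempty compact set. -/
def complCompacts : TopologicalSpace.NonemptyCompacts ℝ :=
  ⟨⟨β.compl, β.isCompact_compl⟩, ⟨0, β.zero_mem_compl⟩⟩

theorem dist_complCompacts (γ : IntervalPartition) :
    dist β.complCompacts γ.complCompacts = dH β γ := rfl

/-- The midpoint of a gap of $C_\beta$ lies in some block; the endpoints of the gap and of that
block all belong to $C_\beta$, so neither interval can contain an endpoint of the other and they
coincide. Hence $C_\beta$ determines $\beta$. -/
theorem mem_blocks_iff {U : ℝ × ℝ} :
    U ∈ β.blocks ↔ U.1 < U.2 ∧ U.1 ∈ β.compl ∧ U.2 ∈ β.compl ∧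
      ∀ t ∈ Ioo U.1 U.2, t ∉ β.compl := by
  constructor
  · intro hU
    exact ⟨β.block_lt U hU, β.left_mem_compl hU, β.right_mem_compl hU,
      fun t ht hC => (β.mem_compl_iff.1 hC).2 U hU ht⟩
  · rintro ⟨hlt, h1, h2, h3⟩
    have hmid : (U.1 + U.2) / 2 ∈ Ioo U.1 U.2 := ⟨by linarith, by linarith⟩
    have hm : (U.1 + U.2) / 2 ∈ Icc 0 β.length :=
      ⟨by linarith [(β.compl_subset h1).1, hmid.1], by linarith [(β.compl_subset h2).2, hmid.2]⟩
    rcases β.mem_compl_or_mem_block hm with h | ⟨V, hV, hVm⟩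
    · exact absurd h (h3 _ hmid)
    · have a1 := β.notMem_block_of_mem_compl h1 hV
      have a2 := β.notMem_block_of_mem_compl h2 hV
      have b1 : U.1 ≤ V.1 := by
        rcases a1 with a | a
        · exact a
        · linarith [hmid.1, hVm.2]
      have b2 : V.2 ≤ U.2 := by
        rcases a2 with a | a
        · linarith [hmid.2, hVm.1]
        · exact a
      have c1 : V.1 ≤ U.1 := by
        by_contra! hc
        exact h3 V.1 ⟨hc, by linarith [hVm.1, hmid.2]⟩ (β.left_mem_compl hV)
      have c2 : U.2 ≤ V.2 := by
        by_contra! hc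
        exact h3 V.2 ⟨by linarith [hVm.2, hmid.1], hc⟩ (β.right_mem_compl hV)
      have : U = V := Prod.ext (le_antisymm b1 c1) (le_antisymm c2 b2)
      rwa [this]

theorem compl_injective : Function.Injective compl := by
  intro β γ h
  have hl : β.length = γ.length := by
    apply le_antisymm
    · exact (γ.compl_subset (h ▸ β.length_mem_compl)).2
    · exact (β.compl_subset (h ▸ γ.length_mem_compl)).2
  have hb : β.blocks = γ.blocks := by
    ext U
    rw [mem_blocks_iff, mem_blocks_iff, h]
  exact IntervalPartition.ext hb hl

theorem complCompacts_injective : Function.Injective complCompacts := by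
  intro β γ h
  exact compl_injective (congrArg (fun K : TopologicalSpace.NonemptyCompacts ℝ => (K : Set ℝ)) h)

theorem blocks_countable : β.blocks.Countable := by
  apply Set.PairwiseDisjoint.countable_of_isOpen β.block_disjoint
  · exact fun _ _ => isOpen_Ioo
  · exact fun U hU => nonempty_Ioo.2 (β.block_lt U hU)

theorem blockMass_pos {U : ℝ × ℝ} (hU : U ∈ β.blocks) : 0 < blockMass U :=
  sub_pos.2 (β.block_lt U hU)

theorem sum_blockMass_le {S : Finset (ℝ × ℝ)} (hS : ∀ U ∈ S, U ∈ β.blocks) {x y : ℝ} (hxy : x ≤ y)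
    (h : ∀ U ∈ S, x ≤ U.1 ∧ U.2 ≤ y) : ∑ U ∈ S, blockMass U ≤ y - x := by
  have h1 : volume (⋃ U ∈ S, Ioo U.1 U.2) = ∑ U ∈ S, ENNReal.ofReal (blockMass U) := by
    rw [measure_biUnion_finset]
    · simp [blockMass]
    · exact fun U hU V hV hne => β.block_disjoint (hS U hU) (hS V hV) hne
    · exact fun _ _ => measurableSet_Ioo
  have h2 : volume (⋃ U ∈ S, Ioo U.1 U.2) ≤ ENNReal.ofReal (y - x) := by
    rw [← Real.volume_Icc]
    refine measure_mono (iUnion₂_subset fun U hU t ht => ?_)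
    exact ⟨(h U hU).1.trans ht.1.le, ht.2.le.trans (h U hU).2⟩
  rw [h1, ← ENNReal.ofReal_sum_of_nonneg fun U hU => (β.blockMass_pos (hS U hU)).le] at h2
  exact (ENNReal.ofReal_le_ofReal_iff (by linarith)).1 h2

theorem sum_blockMass_le_length {S : Finset (ℝ × ℝ)} (hS : ∀ U ∈ S, U ∈ β.blocks) :
    ∑ U ∈ S, blockMass U ≤ β.length := by
  simpa using β.sum_blockMass_le hS β.length_nonneg fun U hU => β.block_bounds (hS U hU)

/-- Since $C_\beta$ is null, the countably many block masses sum to the length, so finitely many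
blocks nearly exhaust it. -/
theorem exists_finset_sum_blockMass {ε : ℝ} (hε : 0 < ε) :
    ∃ S : Finset (ℝ × ℝ), (∀ U ∈ S, U ∈ β.blocks) ∧ β.length - ε < ∑ U ∈ S, blockMass U := by
  by_contra! hcon
  rcases lt_or_ge β.length ε with hL | hL
  · have := hcon ∅ (by simp)
    simp at this
    linarith
  have hc := β.blocks_countable
  have h1 : volume (⋃ U ∈ β.blocks, Ioo U.1 U.2)
      = ∑' U : β.blocks, ENNReal.ofReal (blockMass (U : ℝ × ℝ)) := by
    rw [measure_biUnion hc β.block_disjoint fun _ _ => measurableSet_Ioo]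
    simp [blockMass]
  have h2 : ENNReal.ofReal β.length ≤ volume (⋃ U ∈ β.blocks, Ioo U.1 U.2) := by
    calc ENNReal.ofReal β.length = volume (Icc 0 β.length) := by simp
      _ ≤ volume ((Icc 0 β.length \ ⋃ U ∈ β.blocks, Ioo U.1 U.2)
            ∪ ⋃ U ∈ β.blocks, Ioo U.1 U.2) := by
          apply measure_mono
          intro t ht
          by_cases h : t ∈ ⋃ U ∈ β.blocks, Ioo U.1 U.2
          · exact Or.inr h
          · exact Or.inl ⟨ht, h⟩
      _ ≤ _ := measure_union_le _ _
      _ = _ := by rw [β.block_cover, zero_add]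
  have h3 : ∑' U : β.blocks, ENNReal.ofReal (blockMass (U : ℝ × ℝ))
      ≤ ENNReal.ofReal (β.length - ε) := by
    rw [ENNReal.tsum_eq_iSup_sum]
    refine iSup_le fun s => ?_
    rw [← ENNReal.ofReal_sum_of_nonneg fun U _ => (β.blockMass_pos U.2).le]
    apply ENNReal.ofReal_le_ofReal
    have := hcon (s.map (Function.Embedding.subtype _)) fun U hU => by
      obtain ⟨V, -, rfl⟩ := Finset.mem_map.1 hU
      exact V.2
    simpa using this
  have h4 := (h2.trans_eq h1).trans h3
  rw [ENNReal.ofReal_le_ofReal_iff (by linarith)] at h4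
  linarith

theorem finite_large_blocks {h : ℝ} (hh : 0 < h) : {U ∈ β.blocks | h < blockMass U}.Finite := by
  obtain ⟨S, hS, hsum⟩ := β.exists_finset_sum_blockMass hh
  refine S.finite_toSet.subset fun U hU => ?_
  by_contra hUS
  have hUS' : U ∉ S := hUS
  have := β.sum_blockMass_le_length (S := insert U S) (by
    intro V hV
    rcases Finset.mem_insert.1 hV with rfl | hV
    · exact hU.1
    · exact hS V hV)
  rw [Finset.sum_insert hUS'] at this
  linarith [hU.2]

/-- An interval just to the right of `t` that missed all blocks would be a non-null subset of
$C_\beta$. This is why right-continuous functions are controlled by their block values. -/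
theorem exists_mem_block_right {t ε : ℝ} (h0 : 0 ≤ t) (ht : t < β.length) (hε : 0 < ε) :
    ∃ U ∈ β.blocks, ∃ s ∈ Ioo U.1 U.2, t < s ∧ s < t + ε := by
  by_contra! hcon
  have hsub : Ioo t (min (t + ε) β.length) ⊆ β.compl := by
    intro s hs
    have hs2 := lt_min_iff.1 hs.2
    refine β.mem_compl_iff.2 ⟨⟨by linarith [hs.1], hs2.2.le⟩, fun U hU hsU => ?_⟩
    linarith [hcon U hU s hsU hs.1]
  have h1 : volume (Ioo t (min (t + ε) β.length)) = 0 :=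
    measure_mono_null hsub β.block_cover
  rw [Real.volume_Ioo, ENNReal.ofReal_eq_zero] at h1
  have : t < min (t + ε) β.length := lt_min (by linarith) ht
  linarith

end IntervalPartition

/-! ### Correspondences as finite sets of pairs -/

/-- The value on the block `U` of the function decorating `x`. -/
noncomputable def DecoratedPartition.value (x : DecoratedPartition) (U : ℝ × ℝ) : ℝ :=
  x.f (ENNReal.ofReal (blockPoint U))

/-- A finite order-preserving matching of blocks of `β` with blocks of `γ`. -/
structure IsMatching (β γ : IntervalPartition) (T : Finset ((ℝ × ℝ) × (ℝ × ℝ))) : Prop where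
  left_mem : ∀ p ∈ T, p.1 ∈ β.blocks
  right_mem : ∀ p ∈ T, p.2 ∈ γ.blocks
  ordered : ∀ p ∈ T, ∀ q ∈ T, p ≠ q →
    (p.1.2 ≤ q.1.1 ∧ p.2.2 ≤ q.2.1) ∨ (q.1.2 ≤ p.1.1 ∧ q.2.2 ≤ p.2.1)

/-- A matching whose distortion is at most `ε`. -/
structure IsMatchingBound (x y : DecoratedPartition) (T : Finset ((ℝ × ℝ) × (ℝ × ℝ))) (ε : ℝ) :
    Prop where
  matching : IsMatching x.part y.part T
  mass_left : (∑ p ∈ T, |blockMass p.1 - blockMass p.2|) + x.part.length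
    - ∑ p ∈ T, blockMass p.1 ≤ ε
  mass_right : (∑ p ∈ T, |blockMass p.1 - blockMass p.2|) + y.part.length
    - ∑ p ∈ T, blockMass p.2 ≤ ε
  value : ∀ p ∈ T, |x.value p.1 - y.value p.2| ≤ ε
  top : |(x.f ⊤ : ℝ) - y.f ⊤| ≤ ε

namespace IsMatching

variable {β γ : IntervalPartition} {T : Finset ((ℝ × ℝ) × (ℝ × ℝ))}

theorem injOn_fst (h : IsMatching β γ T) : Set.InjOn Prod.fst (T : Set ((ℝ × ℝ) × (ℝ × ℝ))) := by
  intro p hp q hq hpq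
  by_contra hne
  have h1 := β.block_lt _ (h.left_mem p hp)
  have h2 := β.block_lt _ (h.left_mem q hq)
  rw [hpq] at h1
  rcases h.ordered p hp q hq hne with h | h <;> rw [hpq] at h <;> linarith [h.1]

theorem injOn_snd (h : IsMatching β γ T) : Set.InjOn Prod.snd (T : Set ((ℝ × ℝ) × (ℝ × ℝ))) := by
  intro p hp q hq hpq
  by_contra hne
  have h1 := γ.block_lt _ (h.right_mem p hp)
  have h2 := γ.block_lt _ (h.right_mem q hq)
  rw [hpq] at h1
  rcases h.ordered p hp q hq hne with h | h <;> rw [hpq] at h <;> linarith [h.2]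

/-- Sorting by the left endpoints of the left-hand blocks recovers the indexed sequence. Together
with the converse `exists_matching`, this lets matchings be composed and restricted as finite sets,
without indices. -/
theorem exists_correspondence (h : IsMatching β γ T) :
    ∃ c : IntervalPartition.Correspondence β γ, (∀ j, (c.U j, c.V j) ∈ T) ∧
      ∀ F : (ℝ × ℝ) × (ℝ × ℝ) → ℝ, ∑ j, F (c.U j, c.V j) = ∑ p ∈ T, F p := by
  classical
  set A := T.image fun p => p.1.1 with hA
  have hex : ∀ j : Fin A.card, ∃ p ∈ T, p.1.1 = A.orderEmbOfFin rfl j := fun j => by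
    have := A.orderEmbOfFin_mem rfl j
    simpa only [hA, Finset.mem_image] using this
  choose p hpT hp using hex
  have hlt : ∀ i j, i < j → (p i).1.2 ≤ (p j).1.1 ∧ (p i).2.2 ≤ (p j).2.1 := by
    intro i j hij
    have h1 : (p i).1.1 < (p j).1.1 := by
      rw [hp, hp]
      exact (A.orderEmbOfFin rfl).strictMono hij
    have hne : p i ≠ p j := fun e => by rw [e] at h1; exact lt_irrefl _ h1
    rcases h.ordered _ (hpT i) _ (hpT j) hne with h2 | h2
    · exact h2
    · have := β.block_lt _ (h.left_mem _ (hpT j))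
      linarith [h2.1]
  have hinj : Function.Injective p := by
    intro i j hij
    apply (A.orderEmbOfFin rfl).injective
    rw [← hp, ← hp, hij]
  refine ⟨⟨A.card, fun j => (p j).1, fun j => (p j).2, fun j => h.left_mem _ (hpT j),
    fun j => h.right_mem _ (hpT j), fun i j hij => (hlt i j hij).1,
    fun i j hij => (hlt i j hij).2⟩, hpT, fun F => ?_⟩
  refine Finset.sum_bij (fun j _ => p j) (fun j _ => hpT j) (fun i _ j _ hij => hinj hij)
    (fun q hq => ?_) (fun _ _ => rfl)
  have hqA : q.1.1 ∈ Set.range (A.orderEmbOfFin rfl) := by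
    rw [Finset.range_orderEmbOfFin]
    exact Finset.mem_coe.2 (Finset.mem_image_of_mem _ hq)
  obtain ⟨j, hj⟩ := hqA
  refine ⟨j, Finset.mem_univ _, h.injOn_fst (hpT j) hq ?_⟩
  exact β.block_eq_of_left (h.left_mem _ (hpT j)) (h.left_mem _ hq) (by rw [hp, hj])

end IsMatching

theorem IntervalPartition.Correspondence.exists_matching {β γ : IntervalPartition}
    (c : IntervalPartition.Correspondence β γ) :
    ∃ T, IsMatching β γ T ∧ (∀ p ∈ T, ∃ j, p = (c.U j, c.V j)) ∧
      ∀ F : (ℝ × ℝ) × (ℝ × ℝ) → ℝ, ∑ j, F (c.U j, c.V j) = ∑ p ∈ T, F p := by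
  classical
  have hinj : Function.Injective fun j => (c.U j, c.V j) := by
    intro i j hij
    by_contra hne
    have hU : c.U i = c.U j := (Prod.ext_iff.1 hij).1
    have h1 := β.block_lt _ (c.U_mem i)
    have h2 := β.block_lt _ (c.U_mem j)
    rcases lt_or_gt_of_ne hne with h | h
    · have := c.U_left _ _ h
      rw [hU] at this
      linarith
    · have := c.U_left _ _ h
      rw [hU] at this
      linarith
  refine ⟨Finset.univ.image fun j => (c.U j, c.V j), ⟨?_, ?_, ?_⟩, ?_, fun F => ?_⟩
  · intro p hp
    obtain ⟨j, -, rfl⟩ := Finset.mem_image.1 hp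
    exact c.U_mem j
  · intro p hp
    obtain ⟨j, -, rfl⟩ := Finset.mem_image.1 hp
    exact c.V_mem j
  · intro p hp q hq hne
    obtain ⟨i, -, rfl⟩ := Finset.mem_image.1 hp
    obtain ⟨j, -, rfl⟩ := Finset.mem_image.1 hq
    rcases lt_trichotomy i j with h | rfl | h
    · exact Or.inl ⟨c.U_left _ _ h, c.V_left _ _ h⟩
    · exact absurd rfl hne
    · exact Or.inr ⟨c.U_left _ _ h, c.V_left _ _ h⟩
  · intro p hp
    obtain ⟨j, -, rfl⟩ := Finset.mem_image.1 hp
    exact ⟨j, rfl⟩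
  · rw [Finset.sum_image fun i _ j _ hij => hinj hij]

/-! ### The pseudometric axioms for $d_{\mathcal J}$ -/

section distance

variable {x y z : DecoratedPartition} {T : Finset ((ℝ × ℝ) × (ℝ × ℝ))} {ε : ℝ}

instance (β γ : IntervalPartition) : Nonempty (IntervalPartition.Correspondence β γ) :=
  ⟨⟨0, Fin.elim0, Fin.elim0, fun j => j.elim0, fun j => j.elim0, fun j => j.elim0,
    fun j => j.elim0⟩⟩

theorem dJ_bddBelow (x y : DecoratedPartition) :
    BddBelow (range fun c : IntervalPartition.Correspondence x.part y.part =>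
      c.distortion x.value y.value (x.f ⊤) (y.f ⊤)) := by
  refine ⟨0, ?_⟩
  rintro _ ⟨c, rfl⟩
  exact (abs_nonneg _).trans ((le_max_right _ _).trans (le_max_right _ _))

theorem dJ_nonneg (x y : DecoratedPartition) : 0 ≤ dJ x y :=
  le_ciInf fun _ => (abs_nonneg _).trans ((le_max_right _ _).trans (le_max_right _ _))

theorem IsMatchingBound.eps_nonneg (h : IsMatchingBound x y T ε) : 0 ≤ ε :=
  (abs_nonneg _).trans h.top

theorem IsMatchingBound.dJ_le (h : IsMatchingBound x y T ε) : dJ x y ≤ ε := by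
  obtain ⟨c, hc, hsum⟩ := h.matching.exists_correspondence
  refine (ciInf_le (dJ_bddBelow x y) c).trans ?_
  have e1 := hsum fun p => |blockMass p.1 - blockMass p.2|
  have e2 := hsum fun p => blockMass p.1
  have e3 := hsum fun p => blockMass p.2
  simp only at e1 e2 e3
  refine max_le (max_le ?_ ?_) (max_le ?_ h.top)
  · rw [e1, e2]; exact h.mass_left
  · rw [e1, e3]; exact h.mass_right
  -- The supremum over the empty correspondence is `0`, so `0 ≤ ε` is needed here.
  · exact Real.iSup_le (fun j => h.value _ (hc j)) h.eps_nonneg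

theorem exists_isMatchingBound (h : dJ x y < ε) : ∃ T, IsMatchingBound x y T ε := by
  obtain ⟨c, hc⟩ := exists_lt_of_ciInf_lt h
  obtain ⟨T, hT, hTc, hsum⟩ := c.exists_matching
  have e1 := hsum fun p => |blockMass p.1 - blockMass p.2|
  have e2 := hsum fun p => blockMass p.1
  have e3 := hsum fun p => blockMass p.2
  simp only at e1 e2 e3
  obtain ⟨h1, h2⟩ := max_lt_iff.1 hc
  obtain ⟨h3, h4⟩ := max_lt_iff.1 h1
  obtain ⟨h5, h6⟩ := max_lt_iff.1 h2
  refine ⟨T, hT, ?_, ?_, fun p hp => ?_, h6.le⟩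
  · rw [← e1, ← e2]; exact h3.le
  · rw [← e1, ← e3]; exact h4.le
  · obtain ⟨j, rfl⟩ := hTc p hp
    exact (le_ciSup (f := fun j => |x.value (c.U j) - y.value (c.V j)|)
      (Set.finite_range _).bddAbove j).trans h5.le

theorem IsMatchingBound.symm (h : IsMatchingBound x y T ε) :
    IsMatchingBound y x (T.image Prod.swap) ε := by
  classical
  have hs : ∀ F : (ℝ × ℝ) × (ℝ × ℝ) → ℝ, ∑ p ∈ T.image Prod.swap, F p = ∑ p ∈ T, F p.swap :=
    fun F => Finset.sum_image fun i _ j _ hij => Prod.swap_injective hij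
  refine ⟨⟨?_, ?_, ?_⟩, ?_, ?_, ?_, ?_⟩
  · intro p hp
    obtain ⟨q, hq, rfl⟩ := Finset.mem_image.1 hp
    exact h.matching.right_mem q hq
  · intro p hp
    obtain ⟨q, hq, rfl⟩ := Finset.mem_image.1 hp
    exact h.matching.left_mem q hq
  · intro p hp p' hp' hne
    obtain ⟨q, hq, rfl⟩ := Finset.mem_image.1 hp
    obtain ⟨q', hq', rfl⟩ := Finset.mem_image.1 hp'
    rcases h.matching.ordered q hq q' hq' (fun e => hne (e ▸ rfl)) with h | h
    · exact Or.inl ⟨h.2, h.1⟩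
    · exact Or.inr ⟨h.2, h.1⟩
  · rw [hs, hs]
    simp only [Prod.fst_swap, Prod.snd_swap]
    simp_rw [abs_sub_comm (blockMass (Prod.snd _))]
    exact h.mass_right
  · rw [hs, hs]
    simp only [Prod.fst_swap, Prod.snd_swap]
    simp_rw [abs_sub_comm (blockMass (Prod.snd _))]
    exact h.mass_left
  · intro p hp
    obtain ⟨q, hq, rfl⟩ := Finset.mem_image.1 hp
    rw [abs_sub_comm]
    exact h.value q hq
  · rw [abs_sub_comm]
    exact h.top

theorem exists_isMatchingBound_self (x : DecoratedPartition) (hε : 0 < ε) :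
    ∃ T, IsMatchingBound x x T ε := by
  classical
  obtain ⟨S, hS, hsum⟩ := x.part.exists_finset_sum_blockMass hε
  have hs : ∀ F : (ℝ × ℝ) × (ℝ × ℝ) → ℝ,
      ∑ p ∈ S.image (fun U => (U, U)), F p = ∑ U ∈ S, F (U, U) :=
    fun F => Finset.sum_image fun i _ j _ hij => (Prod.ext_iff.1 hij).1
  refine ⟨S.image fun U => (U, U), ⟨?_, ?_, ?_⟩, ?_, ?_, ?_, ?_⟩
  · intro p hp
    obtain ⟨q, hq, rfl⟩ := Finset.mem_image.1 hp
    exact hS q hq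
  · intro p hp
    obtain ⟨q, hq, rfl⟩ := Finset.mem_image.1 hp
    exact hS q hq
  · intro p hp p' hp' hne
    obtain ⟨q, hq, rfl⟩ := Finset.mem_image.1 hp
    obtain ⟨q', hq', rfl⟩ := Finset.mem_image.1 hp'
    rcases x.part.block_separated (hS q hq) (hS q' hq') (fun e => hne (e ▸ rfl)) with h | h
    · exact Or.inl ⟨h, h⟩
    · exact Or.inr ⟨h, h⟩
  · rw [hs, hs]
    simp only [sub_self, abs_zero, Finset.sum_const_zero]
    linarith
  · rw [hs, hs]
    simp only [sub_self, abs_zero, Finset.sum_const_zero]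
    linarith
  · intro p hp
    obtain ⟨q, hq, rfl⟩ := Finset.mem_image.1 hp
    simpa using hε.le
  · simpa using hε.le

/-- The core of the triangle inequality. Dropping a pair of `A` that has no partner in `B` removes
the term $|u-v|$ and loses the matched mass $u\le|u-v|+v$, so the net cost is at most its middle
mass `v`. By `hM` these middle masses add up to no more than the middle mass left unmatched by `B`.
-/
theorem sum_compose_le {τ ι κ : Type*} [DecidableEq ι] [DecidableEq κ] {Q : Finset τ}
    {A : Finset ι} {B : Finset κ} {a : τ → ι} {b : τ → κ}
    (ha : ∀ q ∈ Q, a q ∈ A) (hb : ∀ q ∈ Q, b q ∈ B) (hai : Set.InjOn a Q) (hbi : Set.InjOn b Q)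
    {u v : ι → ℝ} {v' w : κ → ℝ} (hv : ∀ q ∈ Q, v (a q) = v' (b q)) {L M : ℝ}
    (hM : ∑ i ∈ A, v i + ∑ k ∈ B, v' k - ∑ q ∈ Q, v (a q) ≤ M) :
    ∑ q ∈ Q, |u (a q) - w (b q)| + L - ∑ q ∈ Q, u (a q)
      ≤ (∑ i ∈ A, |u i - v i| + L - ∑ i ∈ A, u i)
        + (∑ k ∈ B, |v' k - w k| + M - ∑ k ∈ B, v' k) := by
  have h1 : ∑ q ∈ Q, |u (a q) - w (b q)|
      ≤ ∑ q ∈ Q, |u (a q) - v (a q)| + ∑ q ∈ Q, |v' (b q) - w (b q)| := by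
    rw [← Finset.sum_add_distrib]
    refine Finset.sum_le_sum fun q hq => ?_
    rw [← hv q hq]
    exact abs_sub_le _ _ _
  have hA : ∀ F : ι → ℝ, (∀ i, 0 ≤ F i) → ∑ q ∈ Q, F (a q) ≤ ∑ i ∈ A, F i := fun F hF => by
    rw [← Finset.sum_image (f := F) hai]
    refine Finset.sum_le_sum_of_subset_of_nonneg ?_ fun i _ _ => hF i
    exact Finset.image_subset_iff.2 ha
  have hB : ∀ F : κ → ℝ, (∀ i, 0 ≤ F i) → ∑ q ∈ Q, F (b q) ≤ ∑ i ∈ B, F i := fun F hF => by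
    rw [← Finset.sum_image (f := F) hbi]
    refine Finset.sum_le_sum_of_subset_of_nonneg ?_ fun i _ _ => hF i
    exact Finset.image_subset_iff.2 hb
  have h2 := hB (fun k => |v' k - w k|) fun k => abs_nonneg _
  have h3 := hA (fun i => |u i - v i| + v i - u i) fun i => by linarith [le_abs_self (u i - v i)]
  simp only [Finset.sum_sub_distrib, Finset.sum_add_distrib] at h3
  linarith

theorem IsMatchingBound.trans {T' : Finset ((ℝ × ℝ) × (ℝ × ℝ))} {ε' : ℝ}
    (h : IsMatchingBound x y T ε) (h' : IsMatchingBound y z T' ε') :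
    ∃ T'', IsMatchingBound x z T'' (ε + ε') := by
  classical
  set Q := (T ×ˢ T').filter fun q => q.1.2 = q.2.1 with hQ
  have hQ1 : ∀ q ∈ Q, q.1 ∈ T := fun q hq => (Finset.mem_product.1 (Finset.mem_filter.1 hq).1).1
  have hQ2 : ∀ q ∈ Q, q.2 ∈ T' := fun q hq => (Finset.mem_product.1 (Finset.mem_filter.1 hq).1).2
  have hQ3 : ∀ q ∈ Q, q.1.2 = q.2.1 := fun q hq => (Finset.mem_filter.1 hq).2
  have hi1 : Set.InjOn Prod.fst (Q : Set (((ℝ × ℝ) × (ℝ × ℝ)) × ((ℝ × ℝ) × (ℝ × ℝ)))) := by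
    intro q hq r hr e
    refine Prod.ext e (h'.matching.injOn_fst (hQ2 q hq) (hQ2 r hr) ?_)
    rw [← hQ3 q hq, ← hQ3 r hr, e]
  have hi2 : Set.InjOn Prod.snd (Q : Set (((ℝ × ℝ) × (ℝ × ℝ)) × ((ℝ × ℝ) × (ℝ × ℝ)))) := by
    intro q hq r hr e
    refine Prod.ext (h.matching.injOn_snd (hQ1 q hq) (hQ1 r hr) ?_) e
    rw [hQ3 q hq, hQ3 r hr, e]
  have hsum : ∀ F : (ℝ × ℝ) × (ℝ × ℝ) → ℝ,
      ∑ p ∈ Q.image (fun q => (q.1.1, q.2.2)), F p = ∑ q ∈ Q, F (q.1.1, q.2.2) := fun F =>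
    Finset.sum_image fun q hq r hr e =>
      hi1 hq hr (h.matching.injOn_fst (hQ1 q hq) (hQ1 r hr) (Prod.ext_iff.1 e).1)
  -- Inclusion–exclusion: the left side is the total mass of the distinct blocks of `y` used by `T`
  -- or by `T'`.
  have hM : ∑ p ∈ T, blockMass p.2 + ∑ p ∈ T', blockMass p.1 - ∑ q ∈ Q, blockMass q.1.2
      ≤ y.part.length := by
    have e1 : ∑ q ∈ Q, blockMass q.1.2 = ∑ p ∈ Q.image Prod.fst, blockMass p.2 :=
      (Finset.sum_image (f := fun p : (ℝ × ℝ) × (ℝ × ℝ) => blockMass p.2) hi1).symm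
    have e2 := Finset.sum_sdiff (f := fun p : (ℝ × ℝ) × (ℝ × ℝ) => blockMass p.2)
      (s₁ := Q.image Prod.fst) (s₂ := T) (Finset.image_subset_iff.2 hQ1)
    have e3 : ∑ p ∈ T \ Q.image Prod.fst, blockMass p.2
        = ∑ V ∈ (T \ Q.image Prod.fst).image Prod.snd, blockMass V := by
      refine (Finset.sum_image (f := blockMass) fun p hp q hq e => ?_).symm
      exact h.matching.injOn_snd (Finset.mem_sdiff.1 hp).1 (Finset.mem_sdiff.1 hq).1 e
    have e4 : ∑ p ∈ T', blockMass p.1 = ∑ V ∈ T'.image Prod.fst, blockMass V :=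
      (Finset.sum_image (f := blockMass) h'.matching.injOn_fst).symm
    have hdis : Disjoint ((T \ Q.image Prod.fst).image Prod.snd) (T'.image Prod.fst) := by
      rw [Finset.disjoint_left]
      intro V hV hV'
      obtain ⟨p, hp, rfl⟩ := Finset.mem_image.1 hV
      obtain ⟨q, hq, e⟩ := Finset.mem_image.1 hV'
      obtain ⟨hp1, hp2⟩ := Finset.mem_sdiff.1 hp
      exact hp2 (Finset.mem_image.2 ⟨(p, q),
        Finset.mem_filter.2 ⟨Finset.mem_product.2 ⟨hp1, hq⟩, e.symm⟩, rfl⟩)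
    have e5 := y.part.sum_blockMass_le_length
      (S := (T \ Q.image Prod.fst).image Prod.snd ∪ T'.image Prod.fst) (by
        intro V hV
        rcases Finset.mem_union.1 hV with hV | hV
        · obtain ⟨p, hp, rfl⟩ := Finset.mem_image.1 hV
          exact h.matching.right_mem p (Finset.mem_sdiff.1 hp).1
        · obtain ⟨p, hp, rfl⟩ := Finset.mem_image.1 hV
          exact h'.matching.left_mem p hp)
    rw [Finset.sum_union hdis, ← e3, ← e4] at e5
    linarith
  have hv : ∀ q ∈ Q, blockMass q.1.2 = blockMass q.2.1 := fun q hq => by rw [hQ3 q hq]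
  refine ⟨Q.image fun q => (q.1.1, q.2.2), ⟨?_, ?_, ?_⟩, ?_, ?_, ?_, ?_⟩
  · intro p hp
    obtain ⟨q, hq, rfl⟩ := Finset.mem_image.1 hp
    exact h.matching.left_mem q.1 (hQ1 q hq)
  · intro p hp
    obtain ⟨q, hq, rfl⟩ := Finset.mem_image.1 hp
    exact h'.matching.right_mem q.2 (hQ2 q hq)
  · intro p hp p' hp' hne
    obtain ⟨q, hq, rfl⟩ := Finset.mem_image.1 hp
    obtain ⟨r, hr, rfl⟩ := Finset.mem_image.1 hp'
    have hne1 : q.1 ≠ r.1 := fun e => hne (by rw [hi1 hq hr e])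
    have hne2 : q.2 ≠ r.2 := fun e => hne (by rw [hi2 hq hr e])
    have l1 := y.part.block_lt _ (h.matching.right_mem _ (hQ1 q hq))
    have l2 := y.part.block_lt _ (h.matching.right_mem _ (hQ1 r hr))
    have o2 := h'.matching.ordered _ (hQ2 q hq) _ (hQ2 r hr) hne2
    rw [← hQ3 q hq, ← hQ3 r hr] at o2
    -- Both matchings order the same two middle blocks, so the mixed cases contradict the positive
    -- length of these blocks.
    rcases h.matching.ordered _ (hQ1 q hq) _ (hQ1 r hr) hne1 with o1 | o1 <;>
      rcases o2 with o2 | o2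
    · exact Or.inl ⟨o1.1, o2.2⟩
    · linarith [o1.2, o2.1]
    · linarith [o1.2, o2.1]
    · exact Or.inr ⟨o1.1, o2.2⟩
  · rw [hsum, hsum]
    refine (sum_compose_le (u := fun p => blockMass p.1) (v := fun p => blockMass p.2)
      (v' := fun p => blockMass p.1) (w := fun p => blockMass p.2)
      hQ1 hQ2 hi1 hi2 hv hM).trans (add_le_add h.mass_left h'.mass_left)
  · rw [hsum, hsum]
    have := sum_compose_le (u := fun p => blockMass p.2) (v := fun p => blockMass p.1)
      (v' := fun p => blockMass p.2) (w := fun p => blockMass p.1) (L := z.part.length)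
      (M := y.part.length)
      hQ2 hQ1 hi2 hi1 (fun q hq => (hv q hq).symm) (by
        rw [← Finset.sum_congr rfl hv]
        linarith)
    simp_rw [abs_sub_comm (blockMass (Prod.snd _))] at this
    linarith [h.mass_right, h'.mass_right]
  · intro p hp
    obtain ⟨q, hq, rfl⟩ := Finset.mem_image.1 hp
    have e1 := h.value _ (hQ1 q hq)
    have e2 := h'.value _ (hQ2 q hq)
    rw [← hQ3 q hq] at e2
    exact (abs_sub_le _ _ _).trans (add_le_add e1 e2)
  · exact (abs_sub_le _ _ _).trans (add_le_add h.top h'.top)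

theorem dJ_self (x : DecoratedPartition) : dJ x x = 0 := by
  refine le_antisymm (le_of_forall_pos_le_add fun ε hε => ?_) (dJ_nonneg x x)
  obtain ⟨T, hT⟩ := exists_isMatchingBound_self x hε
  simpa using hT.dJ_le

theorem dJ_comm (x y : DecoratedPartition) : dJ x y = dJ y x := by
  have key : ∀ x y, dJ x y ≤ dJ y x := fun x y =>
    le_of_forall_pos_le_add fun ε hε => by
      obtain ⟨T, hT⟩ := exists_isMatchingBound (lt_add_of_pos_right (dJ y x) hε)
      exact hT.symm.dJ_le
  exact le_antisymm (key x y) (key y x)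

theorem dJ_triangle (x y z : DecoratedPartition) : dJ x z ≤ dJ x y + dJ y z := by
  refine le_of_forall_pos_le_add fun ε hε => ?_
  obtain ⟨T, hT⟩ := exists_isMatchingBound (lt_add_of_pos_right (dJ x y) (half_pos hε))
  obtain ⟨T', hT'⟩ := exists_isMatchingBound (lt_add_of_pos_right (dJ y z) (half_pos hε))
  obtain ⟨T'', hT''⟩ := hT.trans hT'
  linarith [hT''.dJ_le]

end distance

/-! ### Comparison of $d_{\mathcal J}$ with the Hausdorff distance -/

namespace IntervalPartition

theorem exists_mem_compl_of_dH_lt {β γ : IntervalPartition} {δ s : ℝ} (h : dH β γ < δ)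
    (hs : s ∈ β.compl) : ∃ t ∈ γ.compl, |s - t| < δ :=
  Metric.exists_dist_lt_of_hausdorffDist_lt hs h
    (Metric.hausdorffEDist_ne_top_of_nonempty_of_bounded ⟨0, β.zero_mem_compl⟩
      ⟨0, γ.zero_mem_compl⟩ β.isCompact_compl.isBounded γ.isCompact_compl.isBounded)

theorem dH_comm (β γ : IntervalPartition) : dH β γ = dH γ β := Metric.hausdorffDist_comm

/-- Every point of $C_\beta$ is `δ`-close to $C_\gamma$, so none lies deep inside `U`, and `p` falls
in a block of `β`. That block cannot extend far beyond `U`, as $C_\beta$ has points `δ`-close to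
both endpoints of `U`. -/
theorem exists_block_of_dH_lt {β γ : IntervalPartition} {δ p : ℝ} (h : dH β γ < δ) {U : ℝ × ℝ}
    (hU : U ∈ γ.blocks) (h1 : U.1 + δ < p) (h2 : p < U.2 - δ) :
    ∃ V ∈ β.blocks, p ∈ Ioo V.1 V.2 ∧ |V.1 - U.1| ≤ δ ∧ |V.2 - U.2| ≤ δ := by
  have h' : dH γ β < δ := by rwa [dH_comm]
  have hfar : ∀ s ∈ β.compl, s < U.1 + δ ∨ U.2 - δ < s := by
    intro s hs
    obtain ⟨t, ht, hst⟩ := exists_mem_compl_of_dH_lt h hs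
    rw [abs_lt] at hst
    rcases γ.notMem_block_of_mem_compl ht hU with h | h
    · left; linarith
    · right; linarith
  obtain ⟨s, hs, hsU⟩ := exists_mem_compl_of_dH_lt h' (γ.left_mem_compl hU)
  obtain ⟨t, ht, htU⟩ := exists_mem_compl_of_dH_lt h' (γ.right_mem_compl hU)
  rw [abs_lt] at hsU htU
  have hs0 := β.compl_subset hs
  have ht0 := β.compl_subset ht
  have hp : p ∈ Icc 0 β.length := ⟨by linarith [hs0.1], by linarith [ht0.2]⟩
  rcases β.mem_compl_or_mem_block hp with hC | ⟨V, hV, hpV⟩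
  · rcases hfar p hC with h | h <;> linarith
  · refine ⟨V, hV, hpV, ?_, ?_⟩
    · have a1 : s ≤ V.1 := by
        rcases β.notMem_block_of_mem_compl hs hV with h | h
        · exact h
        · linarith [hpV.2]
      have a2 : V.1 < U.1 + δ := by
        rcases hfar _ (β.left_mem_compl hV) with h | h
        · exact h
        · linarith [hpV.1]
      rw [abs_le]
      constructor <;> linarith
    · have a1 : V.2 ≤ t := by
        rcases β.notMem_block_of_mem_compl ht hV with h | h
        · linarith [hpV.1]
        · exact h
      have a2 : U.2 - δ < V.2 := by
        rcases hfar _ (β.right_mem_compl hV) with h | h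
        · linarith [hpV.2]
        · exact h
      rw [abs_le]
      constructor <;> linarith

end IntervalPartition

section close

variable {x y z : DecoratedPartition} {T : Finset ((ℝ × ℝ) × (ℝ × ℝ))} {ε : ℝ}

/-- Mass balance at a pair of levels that cuts the matching consistently. The matched mass of `x`
left of `s` is at most `t` plus the sum of the mass differences, and right of `s` it is at most
$\|x\|-s$; but by quantity (i) the total matched mass is at least $\|x\|$ plus the mass differences
minus `ε`. Applied to endpoints of matched blocks and to the total lengths. -/
theorem IsMatchingBound.threshold (h : IsMatchingBound x y T ε) {s t : ℝ}
    (hs : s ∈ Icc 0 x.part.length) (ht : t ∈ Icc 0 y.part.length)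
    (hst : ∀ q ∈ T, (q.1.2 ≤ s ∧ q.2.2 ≤ t) ∨ (s ≤ q.1.1 ∧ t ≤ q.2.1)) : s - t ≤ ε := by
  classical
  set A := T.filter fun q => q.1.2 ≤ s ∧ q.2.2 ≤ t with hA
  set B := T.filter fun q => ¬ (q.1.2 ≤ s ∧ q.2.2 ≤ t) with hB
  have hAT : A ⊆ T := Finset.filter_subset _ _
  have hBT : B ⊆ T := Finset.filter_subset _ _
  have e1 : ∑ q ∈ A, blockMass q.2 ≤ t - 0 := by
    rw [← Finset.sum_image (f := blockMass) fun p hp q hq e =>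
      h.matching.injOn_snd (hAT hp) (hAT hq) e]
    refine y.part.sum_blockMass_le ?_ ht.1 ?_
    · intro V hV
      obtain ⟨q, hq, rfl⟩ := Finset.mem_image.1 hV
      exact h.matching.right_mem q (hAT hq)
    · intro V hV
      obtain ⟨q, hq, rfl⟩ := Finset.mem_image.1 hV
      exact ⟨(y.part.block_bounds (h.matching.right_mem q (hAT hq))).1,
        (Finset.mem_filter.1 hq).2.2⟩
  have e2 : ∑ q ∈ B, blockMass q.1 ≤ x.part.length - s := by
    rw [← Finset.sum_image (f := blockMass) fun p hp q hq e =>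
      h.matching.injOn_fst (hBT hp) (hBT hq) e]
    refine x.part.sum_blockMass_le ?_ hs.2 ?_
    · intro V hV
      obtain ⟨q, hq, rfl⟩ := Finset.mem_image.1 hV
      exact h.matching.left_mem q (hBT hq)
    · intro V hV
      obtain ⟨q, hq, rfl⟩ := Finset.mem_image.1 hV
      refine ⟨?_, (x.part.block_bounds (h.matching.left_mem q (hBT hq))).2⟩
      rcases hst q (hBT hq) with h | h
      · exact absurd h (Finset.mem_filter.1 hq).2
      · exact h.1
  have e3 : ∑ q ∈ A, blockMass q.1 + ∑ q ∈ B, blockMass q.1 = ∑ q ∈ T, blockMass q.1 :=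
    Finset.sum_filter_add_sum_filter_not _ _ _
  have e4 : ∑ q ∈ A, blockMass q.1
      ≤ ∑ q ∈ A, blockMass q.2 + ∑ q ∈ A, |blockMass q.1 - blockMass q.2| := by
    rw [← Finset.sum_add_distrib]
    exact Finset.sum_le_sum fun q _ => by linarith [le_abs_self (blockMass q.1 - blockMass q.2)]
  have e5 : ∑ q ∈ A, |blockMass q.1 - blockMass q.2|
      ≤ ∑ q ∈ T, |blockMass q.1 - blockMass q.2| :=
    Finset.sum_le_sum_of_subset_of_nonneg hAT fun _ _ _ => abs_nonneg _
  linarith [h.mass_left]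

theorem IsMatchingBound.left_sub_le (h : IsMatchingBound x y T ε)
    {p : (ℝ × ℝ) × (ℝ × ℝ)} (hp : p ∈ T) :
    p.1.1 - p.2.1 ≤ ε ∧ p.1.2 - p.2.2 ≤ ε := by
  have l1 := x.part.block_lt _ (h.matching.left_mem p hp)
  have l2 := y.part.block_lt _ (h.matching.right_mem p hp)
  have b1 := x.part.block_bounds (h.matching.left_mem p hp)
  have b2 := y.part.block_bounds (h.matching.right_mem p hp)
  constructor
  · refine h.threshold ⟨b1.1, by linarith⟩ ⟨b2.1, by linarith⟩ fun q hq => ?_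
    rcases eq_or_ne p q with rfl | hne
    · exact Or.inr ⟨le_rfl, le_rfl⟩
    · rcases h.matching.ordered p hp q hq hne with o | o
      · exact Or.inr ⟨by linarith [o.1], by linarith [o.2]⟩
      · exact Or.inl o
  · refine h.threshold ⟨by linarith, b1.2⟩ ⟨by linarith, b2.2⟩ fun q hq => ?_
    rcases eq_or_ne p q with rfl | hne
    · exact Or.inl ⟨le_rfl, le_rfl⟩
    · rcases h.matching.ordered p hp q hq hne with o | o
      · exact Or.inr o
      · exact Or.inl ⟨by linarith [o.1], by linarith [o.2]⟩

theorem IsMatchingBound.length_sub_le (h : IsMatchingBound x y T ε) :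
    x.part.length - y.part.length ≤ ε :=
  h.threshold ⟨x.part.length_nonneg, le_rfl⟩ ⟨y.part.length_nonneg, le_rfl⟩ fun q hq =>
    Or.inl ⟨(x.part.block_bounds (h.matching.left_mem q hq)).2,
      (y.part.block_bounds (h.matching.right_mem q hq)).2⟩

/-- An unmatched block of mass above `ε` would by itself exceed the mass that may be left out. The
endpoint bounds come from `threshold` in both directions. -/
theorem IsMatchingBound.exists_block (h : IsMatchingBound x y T ε) {U : ℝ × ℝ}
    (hU : U ∈ x.part.blocks) (hm : ε < blockMass U) :
    ∃ V ∈ y.part.blocks, |U.1 - V.1| ≤ ε ∧ |U.2 - V.2| ≤ ε ∧ |x.value U - y.value V| ≤ ε := by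
  classical
  have hmem : U ∈ T.image Prod.fst := by
    by_contra hU'
    have := x.part.sum_blockMass_le_length (S := insert U (T.image Prod.fst)) (by
      intro V hV
      rcases Finset.mem_insert.1 hV with rfl | hV
      · exact hU
      · obtain ⟨q, hq, rfl⟩ := Finset.mem_image.1 hV
        exact h.matching.left_mem q hq)
    rw [Finset.sum_insert hU', Finset.sum_image (f := blockMass) h.matching.injOn_fst] at this
    have h0 : 0 ≤ ∑ p ∈ T, |blockMass p.1 - blockMass p.2| :=
      Finset.sum_nonneg fun _ _ => abs_nonneg _
    linarith [h.mass_left]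
  obtain ⟨p, hp, rfl⟩ := Finset.mem_image.1 hmem
  have h1 := h.left_sub_le hp
  have h2 := h.symm.left_sub_le (p := p.swap) (Finset.mem_image_of_mem _ hp)
  simp only [Prod.fst_swap, Prod.snd_swap] at h2
  refine ⟨p.2, h.matching.right_mem p hp, ?_, ?_, h.value p hp⟩
  · rw [abs_le]; constructor <;> linarith
  · rw [abs_le]; constructor <;> linarith

/-- If both ends of the block of `y` around `t` were far away, this block would be matched with a
block of `x` whose endpoints are `ε`-close to its own, and which would therefore contain `t`. The
constant 3 is not sharp. -/
theorem IsMatchingBound.exists_mem_compl (h : IsMatchingBound x y T ε) {t : ℝ}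
    (ht : t ∈ x.part.compl) : ∃ s ∈ y.part.compl, |t - s| ≤ 3 * ε := by
  have hε := h.eps_nonneg
  have htI := x.part.compl_subset ht
  by_contra! hcon
  have hL : t ≤ y.part.length := by
    by_contra! hlt
    have := hcon _ y.part.length_mem_compl
    rw [abs_of_nonneg (by linarith)] at this
    linarith [h.length_sub_le, htI.2]
  rcases y.part.mem_compl_or_mem_block ⟨htI.1, hL⟩ with hC | ⟨V, hV, htV⟩
  · have := hcon t hC
    simp at this
    linarith
  · have h1 := hcon _ (y.part.left_mem_compl hV)
    have h2 := hcon _ (y.part.right_mem_compl hV)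
    rw [abs_of_pos (by linarith [htV.1])] at h1
    rw [abs_of_neg (by linarith [htV.2])] at h2
    obtain ⟨U, hU, a1, a2, -⟩ := h.symm.exists_block hV (by simp only [blockMass]; linarith)
    rw [abs_le] at a1 a2
    rcases x.part.notMem_block_of_mem_compl ht hU with h | h <;> linarith

/-- Makes the map to the complement Lipschitz; this serves separation of points, completeness and
the comparison of topologies. -/
theorem dH_le_dJ (x y : DecoratedPartition) :
    IntervalPartition.dH x.part y.part ≤ 3 * dJ x y := by
  refine le_of_forall_pos_le_add fun ε hε => ?_
  obtain ⟨T, hT⟩ := exists_isMatchingBound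
    (lt_add_of_pos_right (dJ x y) (by positivity : 0 < ε / 3))
  have h0 := hT.eps_nonneg
  have : 3 * dJ x y + ε = 3 * (dJ x y + ε / 3) := by ring
  rw [this]
  refine Metric.hausdorffDist_le_of_mem_dist (by linarith) (fun t ht => ?_) (fun t ht => ?_)
  · exact hT.exists_mem_compl ht
  · exact hT.symm.exists_mem_compl ht

theorem DecoratedPartition.value_eq (x : DecoratedPartition) {U : ℝ × ℝ} (hU : U ∈ x.part.blocks)
    {s : ℝ} (hs : s ∈ Ioo U.1 U.2) : (x.f (ENNReal.ofReal s) : ℝ) = x.value U := by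
  rw [value, x.f_block U hU s hs _ (x.part.blockPoint_mem hU)]

theorem DecoratedPartition.exists_value_lt (x : DecoratedPartition) {s c δ : ℝ} (h0 : 0 ≤ s)
    (hs : s < x.part.length) (hc : (x.f (ENNReal.ofReal s) : ℝ) < c) (hδ : 0 < δ) :
    ∃ U ∈ x.part.blocks, ∃ u ∈ Ioo U.1 U.2, s < u ∧ u < s + δ ∧ x.value U < c := by
  have hcont : ContinuousWithinAt (fun u : ℝ => (x.f (ENNReal.ofReal u) : ℝ)) (Ici s) s := by
    have h1 : ContinuousWithinAt x.f (Ici (ENNReal.ofReal s)) (ENNReal.ofReal s) :=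
      x.f_rightCont _
    have h2 : ContinuousWithinAt (fun u : ℝ => x.f (ENNReal.ofReal u)) (Ici s) s :=
      h1.comp ENNReal.continuous_ofReal.continuousWithinAt
        fun u hu => ENNReal.ofReal_le_ofReal hu
    exact NNReal.continuous_coe.continuousAt.comp_continuousWithinAt h2
  have hev := hcont.eventually (gt_mem_nhds hc)
  obtain ⟨u, hu, hsub⟩ := mem_nhdsGE_iff_exists_Ico_subset.1 hev
  have hu' : s < u := hu
  obtain ⟨U, hU, v, hv, hv1, hv2⟩ :=
    x.part.exists_mem_block_right h0 hs (lt_min hδ (sub_pos.2 hu'))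
  have hv3 : v < s + δ := by linarith [min_le_left δ (u - s)]
  have hv4 : v < u := by linarith [min_le_right δ (u - s)]
  refine ⟨U, hU, v, hv, hv1, hv3, ?_⟩
  rw [← x.value_eq hU hv]
  exact hsub ⟨hv1.le, hv4⟩

/-- If the two functions differed at `t`, right-continuity of the smaller one would give a block
meeting the right of `t` where its value is still below the larger function at `t`; the equal block
values and monotonicity exclude this. -/
theorem DecoratedPartition.ext_of_value (hp : x.part = y.part)
    (hv : ∀ U ∈ x.part.blocks, x.value U = y.value U) (ht : x.f ⊤ = y.f ⊤) : x = y := by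
  have key : ∀ x y : DecoratedPartition, x.part = y.part →
      (∀ U ∈ x.part.blocks, x.value U = y.value U) → x.f ⊤ = y.f ⊤ → ∀ t, x.f t ≤ y.f t := by
    intro x y hp hv htop t
    rcases le_or_gt (ENNReal.ofReal x.part.length) t with hL | hL
    · rw [x.f_tail t hL, y.f_tail t (hp ▸ hL), htop]
    · have hne : t ≠ ⊤ := hL.ne_top
      rw [← ENNReal.ofReal_toReal hne] at hL ⊢
      have hlt : t.toReal < x.part.length := (ENNReal.ofReal_lt_ofReal_iff_of_nonneg
        ENNReal.toReal_nonneg).1 hL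
      by_contra! hcon
      obtain ⟨U, hU, u, hu, hu1, -, hu2⟩ := y.exists_value_lt ENNReal.toReal_nonneg (hp ▸ hlt)
        (NNReal.coe_lt_coe.2 hcon) zero_lt_one
      rw [← hp] at hU
      rw [← hv U hU, ← x.value_eq hU hu] at hu2
      exact absurd (x.f_mono (ENNReal.ofReal_le_ofReal hu1.le)) (not_le.2 (NNReal.coe_lt_coe.1 hu2))
  refine DecoratedPartition.ext hp (funext fun t => le_antisymm (key x y hp hv ht t)
    (key y x hp.symm (fun U hU => (hv U (hp ▸ hU)).symm) ht.symm t))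

theorem eq_of_dJ_eq_zero (h : dJ x y = 0) : x = y := by
  have hp : x.part = y.part := by
    apply IntervalPartition.complCompacts_injective
    apply dist_le_zero.1
    have := dH_le_dJ x y
    rw [h, mul_zero] at this
    exact this
  have hmb : ∀ ε > 0, ∃ T, IsMatchingBound x y T ε := fun ε hε =>
    exists_isMatchingBound (h.trans_lt hε)
  refine DecoratedPartition.ext_of_value hp (fun U hU => ?_) ?_
  · have hpos := x.part.blockMass_pos hU
    refine sub_eq_zero.1 (abs_eq_zero.1 (le_antisymm
      (le_of_forall_pos_le_add fun ε hε => ?_) (abs_nonneg _)))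
    -- With endpoints displaced by at most a quarter of the mass, the matched block still contains
    -- the midpoint of `U`; the partitions being equal, it is `U` itself.
    obtain ⟨T, hT⟩ := hmb (min ε (blockMass U / 4)) (by positivity)
    have hle := min_le_right ε (blockMass U / 4)
    obtain ⟨V, hV, h1, h2, h3⟩ := hT.exists_block hU (by linarith)
    have : U = V := by
      refine y.part.block_eq_of_mem (hp ▸ hU) hV (x.part.blockPoint_mem hU) ?_
      rw [abs_le] at h1 h2
      simp only [blockMass] at hle hpos h1 h2
      constructor <;> simp only [blockPoint] <;> linarith
    rw [← this] at h3
    linarith [min_le_left ε (blockMass U / 4)]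
  · refine NNReal.coe_injective (sub_eq_zero.1 (abs_eq_zero.1 (le_antisymm
      (le_of_forall_pos_le_add fun ε hε => ?_) (abs_nonneg _))))
    obtain ⟨T, hT⟩ := hmb ε hε
    linarith [hT.top]

noncomputable instance : MetricSpace DecoratedPartition where
  dist := dJ
  dist_self := dJ_self
  dist_comm := dJ_comm
  dist_triangle := dJ_triangle
  eq_of_dist_eq_zero := eq_of_dJ_eq_zero

theorem DecoratedPartition.dist_def (x y : DecoratedPartition) : dist x y = dJ x y := rfl

/-- A partial converse to `dH_le_dJ`: match each of finitely many blocks of `y` of almost full mass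
with the block of `x` around the same point. The sample points `p` are left free so that midpoints
serve for convergence and rational points for separability. -/
theorem exists_isMatchingBound_of_close (y : DecoratedPartition) (hε : 0 < ε) {p : ℝ × ℝ → ℝ}
    (hp : ∀ U ∈ y.part.blocks, p U ∈ Ioo U.1 U.2) :
    ∃ S : Finset (ℝ × ℝ), (∀ U ∈ S, U ∈ y.part.blocks) ∧ ∃ δ > 0, ∀ x : DecoratedPartition,
      IntervalPartition.dH x.part y.part < δ →
      (∀ U ∈ S, |(x.f (ENNReal.ofReal (p U)) : ℝ) - y.f (ENNReal.ofReal (p U))| ≤ ε) →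
      |(x.f ⊤ : ℝ) - y.f ⊤| ≤ ε → ∃ T, IsMatchingBound x y T ε := by
  classical
  obtain ⟨S, hS, hsum⟩ := y.part.exists_finset_sum_blockMass (half_pos hε)
  refine ⟨S, hS, ?_⟩
  -- Each chosen mass changes by at most `2 * δ`, which enters (i) twice, once as a mass difference
  -- and once as lost matched mass; the last `δ` bounds the change of length.
  have hev : ∀ᶠ δ : ℝ in 𝓝[>] 0, (∀ U ∈ S, U.1 + δ < p U ∧ p U < U.2 - δ) ∧
      4 * S.card * δ + δ ≤ ε / 2 := by
    apply eventually_nhdsWithin_of_eventually_nhds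
    refine Filter.Eventually.and ((Finset.eventually_all S).2 fun U hU => ?_) ?_
    · have hU' := hp U (hS U hU)
      have c1 : Tendsto (fun δ : ℝ => U.1 + δ) (𝓝 0) (𝓝 (U.1 + 0)) :=
        Continuous.tendsto (by fun_prop) _
      have c2 : Tendsto (fun δ : ℝ => U.2 - δ) (𝓝 0) (𝓝 (U.2 - 0)) :=
        Continuous.tendsto (by fun_prop) _
      rw [add_zero] at c1
      rw [sub_zero] at c2
      exact (c1.eventually_lt_const hU'.1).and (c2.eventually_const_lt hU'.2)
    · have c : Tendsto (fun δ : ℝ => 4 * S.card * δ + δ) (𝓝 0) (𝓝 (4 * S.card * 0 + 0)) :=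
        Continuous.tendsto (by fun_prop) _
      rw [mul_zero, add_zero] at c
      exact (c.eventually_lt_const (half_pos hε)).mono fun _ h => h.le
  obtain ⟨δ, ⟨hδ1, hδ2⟩, hδ0⟩ := (hev.and self_mem_nhdsWithin).exists
  have hδ0' : 0 < δ := hδ0
  refine ⟨δ, hδ0, fun x hx hval htop => ?_⟩
  have hex : ∀ U, ∃ V : ℝ × ℝ, U ∈ S → V ∈ x.part.blocks ∧ p U ∈ Ioo V.1 V.2 ∧
      |V.1 - U.1| ≤ δ ∧ |V.2 - U.2| ≤ δ := by
    intro U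
    by_cases hU : U ∈ S
    · obtain ⟨V, h⟩ := IntervalPartition.exists_block_of_dH_lt hx (hS U hU) (hδ1 U hU).1
        (hδ1 U hU).2
      exact ⟨V, fun _ => h⟩
    · exact ⟨0, fun h => absurd h hU⟩
  choose V hV using hex
  have hord : ∀ U ∈ S, ∀ U' ∈ S, U.2 ≤ U'.1 → (V U).2 ≤ (V U').1 := by
    intro U hU U' hU' hle
    obtain ⟨a1, a2, a3, a4⟩ := hV U hU
    obtain ⟨b1, b2, b3, b4⟩ := hV U' hU'
    rw [abs_le] at a3 a4 b3 b4
    have c1 := hδ1 U hU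
    have c2 := hδ1 U' hU'
    have hne : V U ≠ V U' := fun e => by
      rw [← e] at b2
      linarith [b2.2]
    rcases x.part.block_separated a1 b1 hne with h | h
    · exact h
    · linarith [a2.1, b2.2]
  have hs : ∀ F : (ℝ × ℝ) × (ℝ × ℝ) → ℝ,
      ∑ q ∈ S.image (fun U => (V U, U)), F q = ∑ U ∈ S, F (V U, U) :=
    fun F => Finset.sum_image fun i _ j _ hij => (Prod.ext_iff.1 hij).2
  have hlen : x.part.length ≤ y.part.length + δ := by
    obtain ⟨t, ht, hlt⟩ := IntervalPartition.exists_mem_compl_of_dH_lt hx x.part.length_mem_compl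
    rw [abs_lt] at hlt
    linarith [(y.part.compl_subset ht).2]
  have habs : ∑ U ∈ S, |blockMass (V U) - blockMass U| ≤ 2 * S.card * δ := by
    calc ∑ U ∈ S, |blockMass (V U) - blockMass U| ≤ ∑ U ∈ S, 2 * δ := by
          refine Finset.sum_le_sum fun U hU => ?_
          obtain ⟨-, -, a3, a4⟩ := hV U hU
          rw [abs_le] at a3 a4 ⊢
          simp only [blockMass]
          constructor <;> linarith
      _ = 2 * S.card * δ := by rw [Finset.sum_const, nsmul_eq_mul]; ring
  have hVU : ∑ U ∈ S, blockMass U - ∑ U ∈ S, |blockMass (V U) - blockMass U|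
      ≤ ∑ U ∈ S, blockMass (V U) := by
    rw [← Finset.sum_sub_distrib]
    refine Finset.sum_le_sum fun U _ => ?_
    linarith [neg_abs_le (blockMass (V U) - blockMass U)]
  refine ⟨S.image fun U => (V U, U), ⟨?_, ?_, ?_⟩, ?_, ?_, ?_, htop⟩
  · intro q hq
    obtain ⟨U, hU, rfl⟩ := Finset.mem_image.1 hq
    exact (hV U hU).1
  · intro q hq
    obtain ⟨U, hU, rfl⟩ := Finset.mem_image.1 hq
    exact hS U hU
  · intro q hq q' hq' hne
    obtain ⟨U, hU, rfl⟩ := Finset.mem_image.1 hq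
    obtain ⟨U', hU', rfl⟩ := Finset.mem_image.1 hq'
    rcases y.part.block_separated (hS U hU) (hS U' hU') (fun e => hne (e ▸ rfl)) with h | h
    · exact Or.inl ⟨hord U hU U' hU' h, h⟩
    · exact Or.inr ⟨hord U' hU' U hU h, h⟩
  · rw [hs, hs]
    simp only
    nlinarith
  · rw [hs, hs]
    simp only
    have : 0 ≤ 2 * S.card * δ := by positivity
    linarith
  · intro q hq
    obtain ⟨U, hU, rfl⟩ := Finset.mem_image.1 hq
    have := hval U hU
    rwa [x.value_eq (hV U hU).1 (hV U hU).2.1, y.value_eq (hS U hU) (hp U (hS U hU))] at this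

end close

/-! ### Partitions from null compact sets, and completeness of $\mathcal J$ -/

theorem exists_gap_of_notMem {K : Set ℝ} (hK : IsCompact K) {a b t : ℝ} (ha : a ∈ K) (hb : b ∈ K)
    (hat : a ≤ t) (htb : t ≤ b) (htK : t ∉ K) :
    ∃ U : ℝ × ℝ, (U.1 < U.2 ∧ U.1 ∈ K ∧ U.2 ∈ K ∧ ∀ s ∈ Ioo U.1 U.2, s ∉ K) ∧
      t ∈ Ioo U.1 U.2 := by
  have hc1 : IsCompact (K ∩ Iic t) := hK.inter_right isClosed_Iic
  have hc2 : IsCompact (K ∩ Ici t) := hK.inter_right isClosed_Ici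
  have m1 := hc1.sSup_mem ⟨a, ha, hat⟩
  have m2 := hc2.sInf_mem ⟨b, hb, htb⟩
  have l1 : sSup (K ∩ Iic t) < t := lt_of_le_of_ne m1.2 fun e => htK (e ▸ m1.1)
  have l2 : t < sInf (K ∩ Ici t) := lt_of_le_of_ne m2.2 fun e => htK (e ▸ m2.1)
  refine ⟨(sSup (K ∩ Iic t), sInf (K ∩ Ici t)), ⟨l1.trans l2, m1.1, m2.1, ?_⟩, ⟨l1, l2⟩⟩
  intro s hs hsK
  rcases le_total s t with h | h
  · exact absurd (le_csSup hc1.bddAbove ⟨hsK, h⟩) (not_le.2 hs.1)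
  · exact absurd (csInf_le hc2.bddBelow ⟨hsK, h⟩) (not_le.2 hs.2)

/-- The interval partition whose blocks are the gaps of a Lebesgue-null compact set `K ∋ 0` of
nonnegative numbers. -/
noncomputable def IntervalPartition.ofCompact (K : Set ℝ) (hK : IsCompact K) (h0 : (0 : ℝ) ∈ K)
    (hnn : ∀ t ∈ K, 0 ≤ t) (hvol : volume K = 0) : IntervalPartition where
  blocks := {U | U.1 < U.2 ∧ U.1 ∈ K ∧ U.2 ∈ K ∧ ∀ t ∈ Ioo U.1 U.2, t ∉ K}
  length := sSup K
  length_nonneg := le_csSup hK.bddAbove h0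
  block_lt := fun _ hU => hU.1
  block_subset := fun U hU t ht =>
    ⟨(hnn _ hU.2.1).trans ht.1.le, ht.2.le.trans (le_csSup hK.bddAbove hU.2.2.1)⟩
  block_disjoint := by
    intro U hU V hV hne
    rw [Function.onFun, Set.disjoint_left]
    intro t htU htV
    apply hne
    have a1 : U.1 = V.1 := by
      rcases lt_trichotomy U.1 V.1 with h | h | h
      · exact absurd hV.2.1 (hU.2.2.2 _ ⟨h, htV.1.trans htU.2⟩)
      · exact h
      · exact absurd hU.2.1 (hV.2.2.2 _ ⟨h, htU.1.trans htV.2⟩)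
    have a2 : U.2 = V.2 := by
      rcases lt_trichotomy U.2 V.2 with h | h | h
      · exact absurd hU.2.2.1 (hV.2.2.2 _ ⟨htV.1.trans htU.2, h⟩)
      · exact h
      · exact absurd hV.2.2.1 (hU.2.2.2 _ ⟨htU.1.trans htV.2, h⟩)
    exact Prod.ext a1 a2
  block_cover := by
    refine measure_mono_null (fun t ht => ?_) hvol
    by_contra htK
    obtain ⟨U, hU, htU⟩ :=
      exists_gap_of_notMem hK h0 (hK.sSup_mem ⟨0, h0⟩) ht.1.1 ht.1.2 htK
    exact ht.2 (mem_iUnion₂.2 ⟨U, hU, htU⟩)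

theorem IntervalPartition.compl_ofCompact {K : Set ℝ} (hK : IsCompact K) (h0 : (0 : ℝ) ∈ K)
    (hnn : ∀ t ∈ K, 0 ≤ t) (hvol : volume K = 0) :
    (ofCompact K hK h0 hnn hvol).compl = K := by
  apply Subset.antisymm
  · intro t ht
    by_contra htK
    obtain ⟨U, hU, htU⟩ :=
      exists_gap_of_notMem hK h0 (hK.sSup_mem ⟨0, h0⟩) ht.1.1 ht.1.2 htK
    exact ht.2 (mem_iUnion₂.2 ⟨U, hU, htU⟩)
  · intro t ht
    exact (mem_compl_iff _).2 ⟨⟨hnn t ht, le_csSup hK.bddAbove ht⟩, fun U hU h => hU.2.2.2 t h ht⟩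

section complete

variable {u : ℕ → DecoratedPartition} {η : IntervalPartition}

/-- `K` avoids the blocks of `y` once these are shrunk by `δ` at each end. Those matched with blocks
in `S` carry almost all the mass of `y`, and there are at most `S.card` of them, so the shrinking
costs little. One `ε` each is spent on the difference of lengths, the mass outside `S`, the defect
of `T`, and the terms in `δ`. -/
theorem volume_limit_le {K : TopologicalSpace.NonemptyCompacts ℝ} {x y : DecoratedPartition}
    {T : Finset ((ℝ × ℝ) × (ℝ × ℝ))} {ε δ : ℝ} {S : Finset (ℝ × ℝ)}
    (hT : IsMatchingBound x y T ε) (hS : ∀ U ∈ S, U ∈ x.part.blocks)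
    (hsum : x.part.length - ε < ∑ U ∈ S, blockMass U) (hK : dist y.part.complCompacts K < δ)
    (hK0 : ∀ t ∈ K, 0 ≤ t) (hδ : 2 * S.card * δ + δ ≤ ε) :
    volume (K : Set ℝ) ≤ ENNReal.ofReal (4 * ε) := by
  classical
  have hδ0 : 0 ≤ δ := dist_nonneg.trans hK.le
  have hclose : ∀ t ∈ K, ∃ s ∈ y.part.compl, |t - s| < δ := fun t ht =>
    Metric.exists_dist_lt_of_hausdorffDist_lt (s := (K : Set ℝ)) ht
      (by rw [Metric.hausdorffDist_comm]; exact hK)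
      (Metric.hausdorffEDist_ne_top_of_nonempty_of_bounded ⟨t, ht⟩ ⟨0, y.part.zero_mem_compl⟩
        K.isCompact.isBounded y.part.isCompact_compl.isBounded)
  set T' := T.filter fun p => p.1 ∈ S with hT'
  have hTT : T' ⊆ T := Finset.filter_subset _ _
  have hcard : (T'.card : ℝ) ≤ S.card := by
    exact_mod_cast Finset.card_le_card_of_injOn Prod.fst (fun p hp => (Finset.mem_filter.1 hp).2)
      (hT.matching.injOn_fst.mono (Finset.coe_subset.2 hTT))
  have e1 : ∑ U ∈ S, blockMass U + ∑ p ∈ T, blockMass p.1 - ∑ p ∈ T', blockMass p.1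
      ≤ x.part.length := by
    have a1 : ∑ p ∈ T', blockMass p.1 = ∑ U ∈ T'.image Prod.fst, blockMass U :=
      (Finset.sum_image (f := blockMass) fun p hp q hq e =>
        hT.matching.injOn_fst (hTT hp) (hTT hq) e).symm
    have a2 : ∑ p ∈ T, blockMass p.1 = ∑ U ∈ T.image Prod.fst, blockMass U :=
      (Finset.sum_image (f := blockMass) hT.matching.injOn_fst).symm
    have a3 : T'.image Prod.fst = S ∩ T.image Prod.fst := by
      ext U
      simp only [hT', Finset.mem_image, Finset.mem_filter, Finset.mem_inter]
      constructor
      · rintro ⟨p, ⟨hp, hpS⟩, rfl⟩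
        exact ⟨hpS, p, hp, rfl⟩
      · rintro ⟨hU, p, hp, rfl⟩
        exact ⟨p, ⟨hp, hU⟩, rfl⟩
    have a4 := Finset.sum_union_inter (s₁ := S) (s₂ := T.image Prod.fst) (f := blockMass)
    have a5 := x.part.sum_blockMass_le_length (S := S ∪ T.image Prod.fst) (by
      intro V hV
      rcases Finset.mem_union.1 hV with hV | hV
      · exact hS V hV
      · obtain ⟨p, hp, rfl⟩ := Finset.mem_image.1 hV
        exact hT.matching.left_mem p hp)
    rw [a1, a2, a3]
    linarith
  have e2 : ∑ p ∈ T', blockMass p.1 - ∑ p ∈ T, |blockMass p.1 - blockMass p.2|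
      ≤ ∑ p ∈ T', blockMass p.2 := by
    have a1 : ∑ p ∈ T', |blockMass p.1 - blockMass p.2|
        ≤ ∑ p ∈ T, |blockMass p.1 - blockMass p.2| :=
      Finset.sum_le_sum_of_subset_of_nonneg hTT fun _ _ _ => abs_nonneg _
    have a2 : ∑ p ∈ T', (blockMass p.1 - |blockMass p.1 - blockMass p.2|)
        ≤ ∑ p ∈ T', blockMass p.2 :=
      Finset.sum_le_sum fun p _ => by linarith [le_abs_self (blockMass p.1 - blockMass p.2)]
    rw [Finset.sum_sub_distrib] at a2
    linarith
  have e3 : ∑ p ∈ T', (blockMass p.2 - 2 * δ) = ∑ p ∈ T', blockMass p.2 - 2 * T'.card * δ := by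
    rw [Finset.sum_sub_distrib, Finset.sum_const, nsmul_eq_mul]
    ring
  set I : (ℝ × ℝ) × (ℝ × ℝ) → Set ℝ := fun p => Ioo (p.2.1 + δ) (p.2.2 - δ) with hI
  have hIV : ∀ p, I p ⊆ Ioo p.2.1 p.2.2 := fun p t ht =>
    ⟨by linarith [ht.1], by linarith [ht.2]⟩
  have hvI : volume (⋃ p ∈ T', I p) = ∑ p ∈ T', ENNReal.ofReal (blockMass p.2 - 2 * δ) := by
    rw [measure_biUnion_finset]
    · refine Finset.sum_congr rfl fun p _ => ?_
      simp only [hI, Real.volume_Ioo, blockMass]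
      congr 1
      ring
    · intro p hp q hq hne
      refine Disjoint.mono (hIV p) (hIV q) ?_
      refine y.part.block_disjoint (hT.matching.right_mem p (hTT hp))
        (hT.matching.right_mem q (hTT hq)) fun e => hne ?_
      exact hT.matching.injOn_snd (hTT hp) (hTT hq) e
    · exact fun _ _ => measurableSet_Ioo
  have hdis : Disjoint (K : Set ℝ) (⋃ p ∈ T', I p) := by
    rw [Set.disjoint_left]
    intro t ht htI
    obtain ⟨p, hp, htp⟩ := mem_iUnion₂.1 htI
    obtain ⟨s, hs, hts⟩ := hclose t ht
    rw [abs_lt] at hts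
    have h1 := htp.1
    have h2 := htp.2
    rcases y.part.notMem_block_of_mem_compl hs (hT.matching.right_mem p (hTT hp)) with h | h <;>
      linarith
  have hsub : (K : Set ℝ) ∪ (⋃ p ∈ T', I p) ⊆ Icc 0 (y.part.length + δ) := by
    rintro t (ht | ht)
    · obtain ⟨s, hs, hts⟩ := hclose t ht
      rw [abs_lt] at hts
      exact ⟨hK0 t ht, by linarith [(y.part.compl_subset hs).2]⟩
    · obtain ⟨p, hp, htp⟩ := mem_iUnion₂.1 ht
      have := y.part.block_subset _ (hT.matching.right_mem p (hTT hp)) (hIV p htp)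
      exact ⟨this.1, by linarith [this.2]⟩
  have hmeas : MeasurableSet (⋃ p ∈ T', I p) :=
    Finset.measurableSet_biUnion _ fun _ _ => measurableSet_Ioo
  have h1 : volume (K : Set ℝ) + ∑ p ∈ T', ENNReal.ofReal (blockMass p.2 - 2 * δ)
      ≤ ENNReal.ofReal (y.part.length + δ) := by
    rw [← hvI, ← measure_union hdis hmeas]
    refine (measure_mono hsub).trans ?_
    simp
  have h2 : ENNReal.ofReal (∑ p ∈ T', (blockMass p.2 - 2 * δ))
      ≤ ∑ p ∈ T', ENNReal.ofReal (blockMass p.2 - 2 * δ) :=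
    Finset.le_sum_of_subadditive _ ENNReal.ofReal_zero.le (fun _ _ => ENNReal.ofReal_add_le) _ _
  have hlen := hT.symm.length_sub_le
  have h3 : y.part.length + δ ≤ 4 * ε + ∑ p ∈ T', (blockMass p.2 - 2 * δ) := by
    rw [e3]
    have : T'.card * δ ≤ S.card * δ := mul_le_mul_of_nonneg_right hcard hδ0
    linarith [hT.mass_left]
  have h4 := (add_le_add_right h2 (volume (K : Set ℝ))).trans
    (h1.trans ((ENNReal.ofReal_le_ofReal h3).trans ENNReal.ofReal_add_le))
  exact (ENNReal.add_le_add_iff_right ENNReal.ofReal_ne_top).1 h4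

theorem volume_limit_eq_zero {K : TopologicalSpace.NonemptyCompacts ℝ} (hu : CauchySeq u)
    (hK : Tendsto (fun n => (u n).part.complCompacts) atTop (𝓝 K)) (hK0 : ∀ t ∈ K, 0 ≤ t) :
    volume (K : Set ℝ) = 0 := by
  by_contra hne
  have hfin : volume (K : Set ℝ) ≠ ⊤ := K.isCompact.measure_lt_top.ne
  have hpos : 0 < (volume (K : Set ℝ)).toReal := ENNReal.toReal_pos hne hfin
  set v := (volume (K : Set ℝ)).toReal with hv
  -- The resulting bound on the volume is `v / 2`. The set `S` comes from the single term `u N`, so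
  -- `δ` can be chosen in terms of its cardinality before the later index.
  have hε : 0 < v / 8 := by positivity
  obtain ⟨N, hN⟩ := Metric.cauchySeq_iff'.1 hu (v / 8) hε
  obtain ⟨S, hS, hsum⟩ := (u N).part.exists_finset_sum_blockMass hε
  set δ := (v / 8) / (2 * S.card + 1) with hδ
  have hδ0 : 0 < δ := by positivity
  obtain ⟨M, hM⟩ := Metric.tendsto_atTop.1 hK δ hδ0
  have hd : dist (u (max N M)) (u N) < v / 8 := hN _ (le_max_left _ _)
  rw [dist_comm] at hd
  obtain ⟨T, hT⟩ := exists_isMatchingBound hd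
  have := volume_limit_le hT hS hsum (hM _ (le_max_right N M)) hK0 (by
    have : 2 * S.card * δ + δ = (2 * S.card + 1) * δ := by ring
    rw [this, hδ]
    exact (mul_div_cancel₀ _ (by positivity)).le)
  have h2 := ENNReal.toReal_mono ENNReal.ofReal_ne_top this
  rw [ENNReal.toReal_ofReal (by positivity)] at h2
  linarith

/-- The block of a late term around the midpoint of `U` nearly equals `U`, and its partner in
another late term contains the same midpoint; so the matching compares the two functions at this
very point. -/
theorem cauchySeq_block (hu : CauchySeq u)
    (hη : Tendsto (fun n => IntervalPartition.dH (u n).part η) atTop (𝓝 0)) {U : ℝ × ℝ}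
    (hU : U ∈ η.blocks) : CauchySeq fun n => (u n).f (ENNReal.ofReal (blockPoint U)) := by
  rw [Metric.cauchySeq_iff]
  intro ε hε
  have hm := η.blockMass_pos hU
  set ε' := min (ε / 2) (blockMass U / 8) with hε'
  have hε'0 : 0 < ε' := by positivity
  have hl := min_le_left (ε / 2) (blockMass U / 8)
  have hr := min_le_right (ε / 2) (blockMass U / 8)
  rw [← hε'] at hl hr
  obtain ⟨N, hN⟩ := Metric.cauchySeq_iff.1 hu ε' hε'0
  obtain ⟨M, hM⟩ := eventually_atTop.1 (hη.eventually (gt_mem_nhds hε'0))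
  refine ⟨max N M, fun m hm' n hn' => ?_⟩
  obtain ⟨T, hT⟩ := exists_isMatchingBound
    (hN m ((le_max_left _ _).trans hm') n ((le_max_left _ _).trans hn'))
  simp only [blockMass] at hm hr
  obtain ⟨V, hV, hpV, h1, h2⟩ := IntervalPartition.exists_block_of_dH_lt
    (hM m ((le_max_right _ _).trans hm')) hU (p := blockPoint U)
    (by simp only [blockPoint]; linarith) (by simp only [blockPoint]; linarith)
  rw [abs_le] at h1 h2
  obtain ⟨W, hW, g1, g2, g3⟩ := hT.exists_block hV (by simp only [blockMass]; linarith)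
  rw [abs_le] at g1 g2
  have hpW : blockPoint U ∈ Ioo W.1 W.2 := by
    constructor <;> simp only [blockPoint] <;> linarith
  rw [NNReal.dist_eq, (u m).value_eq hV hpV, (u n).value_eq hW hpW]
  linarith

theorem sInf_blockValues {η : IntervalPartition} {φ : ℝ × ℝ → ℝ≥0} {c : ℝ≥0}
    (hφ : ∀ U ∈ η.blocks, ∀ V ∈ η.blocks, U.2 ≤ V.1 → φ U ≤ φ V)
    (hc : ∀ U ∈ η.blocks, φ U ≤ c) {U : ℝ × ℝ} (hU : U ∈ η.blocks) {s : ℝ}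
    (hs : s ∈ Ioo U.1 U.2) :
    sInf (insert c (φ '' {V ∈ η.blocks | ENNReal.ofReal s < ENNReal.ofReal V.2})) = φ U := by
  have h0 := (η.block_bounds hU).1
  apply le_antisymm
  · refine csInf_le (OrderBot.bddBelow _) (mem_insert_of_mem _ ⟨U, ⟨hU, ?_⟩, rfl⟩)
    exact (ENNReal.ofReal_lt_ofReal_iff (by linarith [hs.1, hs.2])).2 hs.2
  · refine le_csInf ⟨c, mem_insert _ _⟩ ?_
    rintro b (rfl | ⟨V, ⟨hV, hsV⟩, rfl⟩)
    · exact hc U hU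
    · have hsV' := (ENNReal.ofReal_lt_ofReal_iff_of_nonneg (by linarith [hs.1])).1 hsV
      rcases eq_or_ne U V with rfl | hne
      · exact le_rfl
      · rcases η.block_separated hU hV hne with h | h
        · exact hφ U hU V hV h
        · linarith [hs.1]

/-- The decoration of `η` with the values `φ` on its blocks and the value `c` at infinity. -/
noncomputable def DecoratedPartition.ofBlockValues (η : IntervalPartition) (φ : ℝ × ℝ → ℝ≥0)
    (c : ℝ≥0) (hφ : ∀ U ∈ η.blocks, ∀ V ∈ η.blocks, U.2 ≤ V.1 → φ U ≤ φ V)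
    (hc : ∀ U ∈ η.blocks, φ U ≤ c) : DecoratedPartition where
  part := η
  -- The infimum runs over blocks ending strictly after `t`; as this condition is open in `t`, the
  -- function is right-continuous. The inserted `c` is the value beyond the last block.
  f := fun t => sInf (insert c (φ '' {U ∈ η.blocks | t < ENNReal.ofReal U.2}))
  f_mono := by
    intro s t hst
    refine csInf_le_csInf (OrderBot.bddBelow _) ⟨c, mem_insert _ _⟩ (insert_subset_insert ?_)
    exact image_mono fun U hU => ⟨hU.1, hst.trans_lt hU.2⟩
  f_rightCont := by
    intro t
    rw [ContinuousWithinAt, tendsto_order]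
    refine ⟨fun a ha => ?_, fun a ha => ?_⟩
    · filter_upwards [self_mem_nhdsWithin] with s hs
      refine ha.trans_le ?_
      refine csInf_le_csInf (OrderBot.bddBelow _) ⟨c, mem_insert _ _⟩ (insert_subset_insert ?_)
      exact image_mono fun U hU => ⟨hU.1, lt_of_le_of_lt hs hU.2⟩
    · obtain ⟨b, hb, hba⟩ := exists_lt_of_csInf_lt (insert_nonempty c _) ha
      rcases hb with rfl | ⟨U, ⟨hU, htU⟩, rfl⟩
      · exact Eventually.of_forall fun s =>
          (csInf_le (OrderBot.bddBelow _) (mem_insert _ _)).trans_lt hba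
      · filter_upwards [mem_nhdsWithin_of_mem_nhds (Iio_mem_nhds htU)] with s hs
        have hmem : φ U ∈ insert c (φ '' {V ∈ η.blocks | s < ENNReal.ofReal V.2}) :=
          mem_insert_of_mem _ ⟨U, ⟨hU, hs⟩, rfl⟩
        exact (csInf_le (OrderBot.bddBelow _) hmem).trans_lt hba
  f_block := by
    intro U hU s hs t ht
    rw [sInf_blockValues hφ hc hU hs, sInf_blockValues hφ hc hU ht]
  f_tail := by
    intro t ht
    have e1 : {U ∈ η.blocks | t < ENNReal.ofReal U.2} = ∅ := by
      refine eq_empty_of_forall_notMem fun U hU => ?_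
      exact absurd (hU.2.trans_le (ENNReal.ofReal_le_ofReal (η.block_bounds hU.1).2))
        (not_lt.2 ht)
    have e2 : {U ∈ η.blocks | ⊤ < ENNReal.ofReal U.2} = ∅ :=
      eq_empty_of_forall_notMem fun U hU => not_top_lt hU.2
    rw [e1, e2]

theorem DecoratedPartition.ofBlockValues_top {η : IntervalPartition} {φ : ℝ × ℝ → ℝ≥0}
    {c : ℝ≥0} (hφ : ∀ U ∈ η.blocks, ∀ V ∈ η.blocks, U.2 ≤ V.1 → φ U ≤ φ V)
    (hc : ∀ U ∈ η.blocks, φ U ≤ c) : (ofBlockValues η φ c hφ hc).f ⊤ = c := by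
  have e2 : {U ∈ η.blocks | ⊤ < ENNReal.ofReal U.2} = ∅ :=
    eq_empty_of_forall_notMem fun U hU => not_top_lt hU.2
  simp only [ofBlockValues]
  rw [e2]
  simp

theorem DecoratedPartition.ofBlockValues_block {η : IntervalPartition} {φ : ℝ × ℝ → ℝ≥0}
    {c : ℝ≥0} (hφ : ∀ U ∈ η.blocks, ∀ V ∈ η.blocks, U.2 ≤ V.1 → φ U ≤ φ V)
    (hc : ∀ U ∈ η.blocks, φ U ≤ c) {U : ℝ × ℝ} (hU : U ∈ η.blocks) :
    (ofBlockValues η φ c hφ hc).f (ENNReal.ofReal (blockPoint U)) = φ U :=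
  sInf_blockValues hφ hc hU (η.blockPoint_mem hU)

/-- Only finitely many blocks of the limit matter at each precision, so pointwise convergence on
blocks is enough. -/
theorem DecoratedPartition.tendsto_of_dH {ι : Type*} {l : Filter ι} {u : ι → DecoratedPartition}
    {y : DecoratedPartition}
    (h1 : Tendsto (fun n => IntervalPartition.dH (u n).part y.part) l (𝓝 0))
    (h2 : ∀ U ∈ y.part.blocks, Tendsto (fun n => (u n).f (ENNReal.ofReal (blockPoint U))) l
      (𝓝 (y.f (ENNReal.ofReal (blockPoint U)))))
    (h3 : Tendsto (fun n => (u n).f ⊤) l (𝓝 (y.f ⊤))) : Tendsto u l (𝓝 y) := by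
  rw [Metric.tendsto_nhds]
  intro ε hε
  obtain ⟨S, hS, δ, hδ, H⟩ := exists_isMatchingBound_of_close y (half_pos hε)
    (fun U hU => y.part.blockPoint_mem hU)
  have e2 : ∀ᶠ n in l, ∀ U ∈ S, dist ((u n).f (ENNReal.ofReal (blockPoint U)))
      (y.f (ENNReal.ofReal (blockPoint U))) < ε / 2 :=
    (Finset.eventually_all S).2 fun U hU => Metric.tendsto_nhds.1 (h2 U (hS U hU)) _ (half_pos hε)
  filter_upwards [h1.eventually (gt_mem_nhds hδ), e2, Metric.tendsto_nhds.1 h3 _ (half_pos hε)]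
    with n hn1 hn2 hn3
  obtain ⟨T, hT⟩ := H (u n) hn1 (fun U hU => (hn2 U hU).le) hn3.le
  exact hT.dJ_le.trans_lt (half_lt_self hε)

/-- The complements converge to a compact set, which is null by `volume_limit_eq_zero` and so is the
complement of a partition. The block values and the value at infinity converge as well, and their
limits keep the order needed to decorate it. -/
instance : CompleteSpace DecoratedPartition := by
  refine Metric.complete_of_cauchySeq_tendsto fun u hu => ?_
  have hC : CauchySeq fun n => (u n).part.complCompacts := by
    rw [Metric.cauchySeq_iff] at hu ⊢
    intro ε hε
    obtain ⟨N, hN⟩ := hu (ε / 3) (by positivity)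
    refine ⟨N, fun m hm n hn => ?_⟩
    have h1 : dJ (u m) (u n) < ε / 3 := hN m hm n hn
    have h2 := dH_le_dJ (u m) (u n)
    rw [IntervalPartition.dist_complCompacts]
    linarith
  obtain ⟨K, hK⟩ := cauchySeq_tendsto_of_complete hC
  have hfin : ∀ n, Metric.hausdorffEDist (K : Set ℝ) (u n).part.compl ≠ ⊤ := fun n =>
    Metric.hausdorffEDist_ne_top_of_nonempty_of_bounded K.nonempty
      ⟨0, (u n).part.zero_mem_compl⟩ K.isCompact.isBounded (u n).part.isCompact_compl.isBounded
  have hK0 : ∀ t ∈ K, 0 ≤ t := by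
    intro t ht
    by_contra! hlt
    obtain ⟨n, hn⟩ := (Metric.tendsto_nhds.1 hK (-t) (by linarith)).exists
    obtain ⟨s, hs, hst⟩ := Metric.exists_dist_lt_of_hausdorffDist_lt (s := (K : Set ℝ)) ht
      (by rw [Metric.hausdorffDist_comm]; exact hn) (hfin n)
    rw [Real.dist_eq, abs_lt] at hst
    linarith [((u n).part.compl_subset hs).1]
  have h0K : (0 : ℝ) ∈ (K : Set ℝ) := by
    rw [← K.isCompact.isClosed.closure_eq, Metric.mem_closure_iff]
    intro ε hε
    obtain ⟨n, hn⟩ := (Metric.tendsto_nhds.1 hK ε hε).exists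
    exact Metric.exists_dist_lt_of_hausdorffDist_lt (s := (u n).part.compl)
      (u n).part.zero_mem_compl hn (by rw [Metric.hausdorffEDist_comm]; exact hfin n)
  have hvol := volume_limit_eq_zero hu hK hK0
  set η := IntervalPartition.ofCompact K K.isCompact h0K hK0 hvol with hη
  have hηK : η.complCompacts = K := by
    apply TopologicalSpace.NonemptyCompacts.ext
    exact IntervalPartition.compl_ofCompact K.isCompact h0K hK0 hvol
  have hdH : Tendsto (fun n => IntervalPartition.dH (u n).part η) atTop (𝓝 0) := by
    have := tendsto_iff_dist_tendsto_zero.1 hK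
    rw [← hηK] at this
    exact this
  have hex : ∀ U : ℝ × ℝ, ∃ v : ℝ≥0, U ∈ η.blocks →
      Tendsto (fun n => (u n).f (ENNReal.ofReal (blockPoint U))) atTop (𝓝 v) := by
    intro U
    by_cases hU : U ∈ η.blocks
    · obtain ⟨v, hv⟩ := cauchySeq_tendsto_of_complete (cauchySeq_block hu hdH hU)
      exact ⟨v, fun _ => hv⟩
    · exact ⟨0, fun h => absurd h hU⟩
  choose φ hφ using hex
  have htop : CauchySeq fun n => (u n).f ⊤ := by
    rw [Metric.cauchySeq_iff] at hu ⊢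
    intro ε hε
    obtain ⟨N, hN⟩ := hu (ε / 2) (by positivity)
    refine ⟨N, fun m hm n hn => ?_⟩
    obtain ⟨T, hT⟩ := exists_isMatchingBound (hN m hm n hn)
    rw [NNReal.dist_eq]
    linarith [hT.top]
  obtain ⟨c, hc⟩ := cauchySeq_tendsto_of_complete htop
  have hφm : ∀ U ∈ η.blocks, ∀ V ∈ η.blocks, U.2 ≤ V.1 → φ U ≤ φ V := by
    intro U hU V hV hUV
    refine le_of_tendsto_of_tendsto' (hφ U hU) (hφ V hV) fun n => (u n).f_mono ?_
    apply ENNReal.ofReal_le_ofReal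
    linarith [(η.blockPoint_mem hU).2, (η.blockPoint_mem hV).1]
  have hφc : ∀ U ∈ η.blocks, φ U ≤ c := fun U hU =>
    le_of_tendsto_of_tendsto' (hφ U hU) hc fun n => (u n).f_mono le_top
  refine ⟨DecoratedPartition.ofBlockValues η φ c hφm hφc,
    DecoratedPartition.tendsto_of_dH hdH (fun U hU => ?_) ?_⟩
  · rw [DecoratedPartition.ofBlockValues_block hφm hφc hU]
    exact hφ U hU
  · rw [DecoratedPartition.ofBlockValues_top]
    exact hc

end complete

/-! ### Separability of $\mathcal J$ -/

instance : TopologicalSpace.SeparableSpace DecoratedPartition := by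
  classical
  rcases isEmpty_or_nonempty DecoratedPartition with hE | hE
  · infer_instance
  let D := TopologicalSpace.denseSeq (TopologicalSpace.NonemptyCompacts ℝ)
  -- A code lists an approximate complement, a precision, finitely many approximate rational values
  -- at rational points, and one at infinity. Choosing one realization of each realizable code gives
  -- a countable dense set.
  let R : DecoratedPartition → ℕ × ℕ × Finset (ℚ × ℚ) × ℚ → Prop := fun x c =>
    dist x.part.complCompacts (D c.1) < 1 / ((c.2.1 : ℝ) + 1) ∧
    (∀ q ∈ c.2.2.1, |(x.f (ENNReal.ofReal q.1) : ℝ) - q.2| < 1 / ((c.2.1 : ℝ) + 1)) ∧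
    |(x.f ⊤ : ℝ) - c.2.2.2| < 1 / ((c.2.1 : ℝ) + 1)
  have hex : ∀ c, ∃ x, (∃ y, R y c) → R x c := fun c => by
    by_cases h : ∃ y, R y c
    · exact ⟨h.choose, fun _ => h.choose_spec⟩
    · exact ⟨Classical.arbitrary _, fun h' => absurd h' h⟩
  choose g hg using hex
  refine ⟨range g, countable_range g, Metric.denseRange_iff.2 fun y ε hε => ?_⟩
  have hrat : ∀ U : ℝ × ℝ, ∃ q : ℚ, U ∈ y.part.blocks → (q : ℝ) ∈ Ioo U.1 U.2 := fun U => by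
    by_cases hU : U ∈ y.part.blocks
    · obtain ⟨q, h1, h2⟩ := exists_rat_btwn (y.part.block_lt U hU)
      exact ⟨q, fun _ => ⟨h1, h2⟩⟩
    · exact ⟨0, fun h => absurd h hU⟩
  choose p hp using hrat
  obtain ⟨S, hS, δ, hδ, H⟩ := exists_isMatchingBound_of_close y (half_pos hε)
    (p := fun U => (p U : ℝ)) hp
  obtain ⟨n, hn⟩ := exists_nat_one_div_lt (lt_min (half_pos hδ) (half_pos (half_pos hε)))
  have hn0 : 0 < 1 / ((n : ℝ) + 1) := by positivity
  have hn1 := hn.trans_le (min_le_left _ _)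
  have hn2 := hn.trans_le (min_le_right _ _)
  have hr : ∀ v : ℝ, ∃ r : ℚ, |v - r| < 1 / ((n : ℝ) + 1) := fun v => by
    obtain ⟨r, h1, h2⟩ := exists_rat_btwn (sub_lt_self v hn0)
    refine ⟨r, ?_⟩
    rw [abs_lt]
    constructor <;> linarith
  choose r hr using hr
  obtain ⟨i, hi⟩ := Metric.denseRange_iff.1
    (TopologicalSpace.denseRange_denseSeq (TopologicalSpace.NonemptyCompacts ℝ))
    y.part.complCompacts _ hn0
  let c : ℕ × ℕ × Finset (ℚ × ℚ) × ℚ :=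
    (i, n, S.image fun U => (p U, r (y.f (ENNReal.ofReal (p U)))), r (y.f ⊤))
  have hyc : R y c := by
    refine ⟨hi, fun q hq => ?_, hr _⟩
    obtain ⟨U, hU, rfl⟩ := Finset.mem_image.1 hq
    exact hr _
  have hgc := hg c ⟨y, hyc⟩
  refine ⟨c, ?_⟩
  have hd1 : IntervalPartition.dH (g c).part y.part < δ := by
    rw [← IntervalPartition.dist_complCompacts]
    have h1 := dist_triangle_right (g c).part.complCompacts y.part.complCompacts (D c.1)
    have h2 : dist (g c).part.complCompacts (D c.1) < 1 / ((n : ℝ) + 1) := hgc.1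
    have h3 : dist y.part.complCompacts (D c.1) < 1 / ((n : ℝ) + 1) := hyc.1
    linarith
  have hclose : ∀ a b s : ℝ, |a - s| < 1 / ((n : ℝ) + 1) → |b - s| < 1 / ((n : ℝ) + 1) →
      |a - b| ≤ ε / 2 := fun a b s h1 h2 => by
    rw [abs_lt] at h1 h2
    rw [abs_le]
    constructor <;> linarith
  obtain ⟨T, hT⟩ := H (g c) hd1 (fun U hU =>
    hclose _ _ _ (hgc.2.1 _ (Finset.mem_image_of_mem _ hU))
      (hyc.2.1 _ (Finset.mem_image_of_mem _ hU))) (hclose _ _ _ hgc.2.2 hyc.2.2)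
  rw [dist_comm]
  exact hT.dJ_le.trans_lt (half_lt_self hε)

/-! ### Diversity, and the embeddings into $\mathcal J$ -/

namespace IntervalPartition

variable {α : ℝ} {β : IntervalPartition}

theorem finite_count (β : IntervalPartition) {h : ℝ} (hh : 0 < h) (t : ℝ) :
    {U ∈ β.blocks | h < blockMass U ∧ U.2 ≤ t}.Finite :=
  (β.finite_large_blocks hh).subset fun _ hU => ⟨hU.1, hU.2.1⟩

theorem count_le_of_imp (β : IntervalPartition) {h s t : ℝ} (hh : 0 < h)
    (hst : ∀ U ∈ β.blocks, U.2 ≤ s → U.2 ≤ t) : β.count h s ≤ β.count h t :=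
  ncard_le_ncard (fun U hU => ⟨hU.1, hU.2.1, hst U hU.1 hU.2.2⟩) (β.finite_count hh t)

theorem count_congr (β : IntervalPartition) {s t : ℝ}
    (hst : ∀ U ∈ β.blocks, U.2 ≤ s ↔ U.2 ≤ t) (h : ℝ) : β.count h s = β.count h t := by
  unfold count
  congr 1
  ext U
  exact ⟨fun hU => ⟨hU.1, hU.2.1, (hst U hU.1).1 hU.2.2⟩,
    fun hU => ⟨hU.1, hU.2.1, (hst U hU.1).2 hU.2.2⟩⟩

theorem count_block (β : IntervalPartition) {U : ℝ × ℝ} (hU : U ∈ β.blocks) {s t : ℝ}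
    (hs : s ∈ Ioo U.1 U.2) (ht : t ∈ Ioo U.1 U.2) (h : ℝ) : β.count h s = β.count h t := by
  refine β.count_congr (fun V hV => ?_) h
  rcases eq_or_ne V U with rfl | hne
  · exact ⟨fun h => by linarith [hs.2], fun h => by linarith [ht.2]⟩
  · rcases β.block_separated hV hU hne with h | h
    · exact ⟨fun _ => by linarith [ht.1], fun _ => by linarith [hs.1]⟩
    · have := β.block_lt V hV
      exact ⟨fun _ => by linarith [hs.2], fun _ => by linarith [ht.2]⟩

theorem count_of_length_le (β : IntervalPartition) {t : ℝ} (ht : β.length ≤ t) (h : ℝ) :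
    β.count h t = β.count h β.length :=
  β.count_congr (fun _ hU => ⟨fun _ => (β.block_bounds hU).2,
    fun _ => (β.block_bounds hU).2.trans ht⟩) h

theorem count_of_nonpos (β : IntervalPartition) {t : ℝ} (ht : t ≤ 0) (h : ℝ) :
    β.count h t = 0 := by
  unfold count
  have : {U ∈ β.blocks | h < blockMass U ∧ U.2 ≤ t} = ∅ :=
    eq_empty_of_forall_notMem fun U hU => by
      linarith [(β.block_bounds hU.1).1, β.block_lt U hU.1, hU.2.2]
  rw [this, ncard_empty]

theorem HasDiversity.exists_tendsto (hβ : β.HasDiversity α) (t : ℝ) :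
    ∃ D : ℝ, Tendsto (fun h : ℝ => h ^ α * (β.count h t : ℝ)) (𝓝[>] 0) (𝓝 D) := by
  rcases le_or_gt t 0 with h0 | h0
  · refine ⟨0, ?_⟩
    simp [β.count_of_nonpos h0]
  · rcases le_or_gt β.length t with hL | hL
    · simp_rw [β.count_of_length_le hL]
      exact hβ _ ⟨β.length_nonneg, le_rfl⟩
    · exact hβ t ⟨h0.le, hL.le⟩

theorem diversity_eq {t D : ℝ}
    (h : Tendsto (fun h : ℝ => h ^ α * (β.count h t : ℝ)) (𝓝[>] 0) (𝓝 D)) :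
    β.diversity α t = Real.Gamma (1 - α) * D := by
  rw [diversity, h.limUnder_eq]

theorem HasDiversity.tendsto (hβ : β.HasDiversity α) (t : ℝ) :
    Tendsto (fun h : ℝ => Real.Gamma (1 - α) * (h ^ α * (β.count h t : ℝ))) (𝓝[>] 0)
      (𝓝 (β.diversity α t)) := by
  obtain ⟨D, hD⟩ := hβ.exists_tendsto t
  rw [diversity_eq hD]
  exact hD.const_mul _

theorem HasDiversity.diversity_mono (hα : α < 1) (hβ : β.HasDiversity α) :
    Monotone (β.diversity α) := by
  intro s t hst
  refine le_of_tendsto_of_tendsto (hβ.tendsto s) (hβ.tendsto t) ?_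
  filter_upwards [self_mem_nhdsWithin] with h hh
  have hh' : 0 < h := hh
  have hG : 0 < Real.Gamma (1 - α) := Real.Gamma_pos_of_pos (by linarith)
  have := β.count_le_of_imp (s := s) (t := t) hh' fun _ _ h => h.trans hst
  have hc : (β.count h s : ℝ) ≤ β.count h t := by exact_mod_cast this
  gcongr

theorem HasDiversity.diversity_nonneg (hα : α < 1) (hβ : β.HasDiversity α) (t : ℝ) :
    0 ≤ β.diversity α t := by
  refine ge_of_tendsto (hβ.tendsto t) ?_
  filter_upwards [self_mem_nhdsWithin] with h hh
  have hh' : 0 < h := hh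
  have hG : 0 < Real.Gamma (1 - α) := Real.Gamma_pos_of_pos (by linarith)
  positivity

theorem diversity_block {U : ℝ × ℝ} (hU : U ∈ β.blocks) {s t : ℝ}
    (hs : s ∈ Ioo U.1 U.2) (ht : t ∈ Ioo U.1 U.2) : β.diversity α s = β.diversity α t := by
  unfold diversity
  simp_rw [β.count_block hU hs ht]

theorem diversity_of_length_le {t : ℝ} (ht : β.length ≤ t) :
    β.diversity α t = β.diversity α β.length := by
  unfold diversity
  simp_rw [β.count_of_length_le ht]

/-- The decoration of an interval partition by the zero function. -/
noncomputable def zeroDecoration (β : IntervalPartition) : DecoratedPartition :=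
  DecoratedPartition.ofBlockValues β 0 0 (fun _ _ _ _ _ => le_rfl) fun _ _ => le_rfl

theorem zeroDecoration_f (β : IntervalPartition) (t : ℝ≥0∞) : β.zeroDecoration.f t = 0 := by
  have h1 : β.zeroDecoration.f ⊤ = 0 :=
    DecoratedPartition.ofBlockValues_top (fun _ _ _ _ _ => le_rfl) fun _ _ => le_rfl
  exact le_antisymm ((β.zeroDecoration.f_mono le_top).trans h1.le) zero_le

theorem zeroDecoration_injective : Function.Injective zeroDecoration := fun _ _ h =>
  congrArg DecoratedPartition.part h

theorem Correspondence.distH_nonneg {β γ : IntervalPartition} (c : Correspondence β γ) :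
    0 ≤ c.distH := by
  obtain ⟨T, hT, -, hsum⟩ := c.exists_matching
  refine le_trans ?_ (le_max_left _ _)
  have e2 : ∑ j, blockMass (c.U j) = ∑ p ∈ T, blockMass p.1 := hsum fun p => blockMass p.1
  rw [e2, ← Finset.sum_image (f := blockMass) hT.injOn_fst]
  have h1 := β.sum_blockMass_le_length (S := T.image Prod.fst) fun V hV => by
    obtain ⟨p, hp, rfl⟩ := Finset.mem_image.1 hV
    exact hT.left_mem p hp
  have h0 : 0 ≤ ∑ j, |blockMass (c.U j) - blockMass (c.V j)| :=
    Finset.sum_nonneg fun _ _ => abs_nonneg _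
  linarith

/-- Zero decorations make (iii) and (iv) vanish, and the remaining maximum with `0` is harmless by
`distH_nonneg`. Thus $d_H'$ inherits its metric axioms. -/
theorem dJ_zeroDecoration (β γ : IntervalPartition) :
    dJ β.zeroDecoration γ.zeroDecoration = dH' β γ := by
  unfold dJ dH'
  refine iInf_congr fun c => ?_
  have hd : ∀ c : Correspondence β γ, c.distortion (fun _ => 0) (fun _ => 0) 0 0 = c.distH := by
    intro c
    simp only [Correspondence.distortion, sub_self, abs_zero, Real.iSup_const_zero, max_self]
    exact max_eq_left c.distH_nonneg
  simp only [zeroDecoration_f, NNReal.coe_zero]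
  exact hd c

end IntervalPartition

namespace DiversityPartition

variable {α : ℝ}

theorem hasDiversity (β : DiversityPartition α) : β.val.HasDiversity α := β.2

/-- The embedding `ι(β) = (β, D_β(· +))` of `I_α` into `J`. -/
noncomputable def toDecorated (hα : α < 1) (β : DiversityPartition α) : DecoratedPartition :=
  DecoratedPartition.ofBlockValues β.val
    (fun U => (β.val.diversity α (blockPoint U)).toNNReal)
    (β.val.diversity α β.val.length).toNNReal
    (fun U hU V hV hUV => Real.toNNReal_le_toNNReal (β.hasDiversity.diversity_mono hα (by
      linarith [(β.val.blockPoint_mem hU).2, (β.val.blockPoint_mem hV).1])))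
    (fun U hU => Real.toNNReal_le_toNNReal (β.hasDiversity.diversity_mono hα (by
      linarith [(β.val.blockPoint_mem hU).2, (β.val.block_bounds hU).2])))

variable (hα : α < 1) (β : DiversityPartition α)

theorem toDecorated_top :
    ((β.toDecorated hα).f ⊤ : ℝ) = β.val.diversity α β.val.length := by
  unfold toDecorated
  rw [DecoratedPartition.ofBlockValues_top,
    Real.coe_toNNReal _ (β.hasDiversity.diversity_nonneg hα _)]

theorem toDecorated_value {U : ℝ × ℝ} (hU : U ∈ β.val.blocks) :
    (β.toDecorated hα).value U = β.val.diversity α (blockPoint U) := by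
  unfold toDecorated DecoratedPartition.value
  rw [DecoratedPartition.ofBlockValues_block _ _ hU,
    Real.coe_toNNReal _ (β.hasDiversity.diversity_nonneg hα _)]

theorem toDecorated_f {U : ℝ × ℝ} (hU : U ∈ β.val.blocks) {s : ℝ} (hs : s ∈ Ioo U.1 U.2) :
    ((β.toDecorated hα).f (ENNReal.ofReal s) : ℝ) = β.val.diversity α s := by
  rw [(β.toDecorated hα).value_eq hU hs, toDecorated_value hα β hU,
    IntervalPartition.diversity_block hU (β.val.blockPoint_mem hU) hs]

/-- Identifies the decoration, built only from block values, with the right-limit function: the two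
increasing functions agree inside blocks, and blocks meet every interval to the right of `t`. -/
theorem tendsto_diversity_right {t : ℝ} (ht : 0 ≤ t) :
    Tendsto (β.val.diversity α) (𝓝[>] t)
      (𝓝 ((β.toDecorated hα).f (ENNReal.ofReal t) : ℝ)) := by
  rcases le_or_gt β.val.length t with hL | hL
  · rw [(β.toDecorated hα).f_tail _ (ENNReal.ofReal_le_ofReal hL), toDecorated_top]
    refine tendsto_const_nhds.congr' ?_
    filter_upwards [self_mem_nhdsWithin] with s hs
    exact (IntervalPartition.diversity_of_length_le (hL.trans (le_of_lt hs))).symm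
  · have hmono := β.hasDiversity.diversity_mono hα
    rw [tendsto_order]
    refine ⟨fun a ha => ?_, fun a ha => ?_⟩
    · filter_upwards [self_mem_nhdsWithin] with s hs
      obtain ⟨U, hU, u, hu, hu1, hu2⟩ :=
        β.val.exists_mem_block_right ht hL (sub_pos.2 (show t < s from hs))
      refine ha.trans_le (le_trans ?_ (hmono (show u ≤ s by linarith)))
      rw [← toDecorated_f hα β hU hu]
      exact (β.toDecorated hα).f_mono (ENNReal.ofReal_le_ofReal hu1.le)
    · obtain ⟨U, hU, u, hu, hu1, -, hu2⟩ :=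
        (β.toDecorated hα).exists_value_lt ht hL ha zero_lt_one
      filter_upwards [Ioo_mem_nhdsGT hu1] with s hs
      refine (hmono hs.2.le).trans_lt ?_
      rwa [← toDecorated_f hα β hU hu, (β.toDecorated hα).value_eq hU hu]

theorem toDecorated_injective : Function.Injective (toDecorated hα) := fun _ _ h =>
  Subtype.ext (congrArg DecoratedPartition.part h)

theorem dJ_toDecorated (γ : DiversityPartition α) :
    dJ (β.toDecorated hα) (γ.toDecorated hα) = dAlpha α β γ := by
  unfold dJ dAlpha
  refine iInf_congr fun c => ?_
  have h1 : ∀ j, ((β.toDecorated hα).f (ENNReal.ofReal (blockPoint (c.U j))) : ℝ)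
      = β.val.diversity α (blockPoint (c.U j)) := fun j => toDecorated_value hα β (c.U_mem j)
  have h2 : ∀ j, ((γ.toDecorated hα).f (ENNReal.ofReal (blockPoint (c.V j))) : ℝ)
      = γ.val.diversity α (blockPoint (c.V j)) := fun j => toDecorated_value hα γ (c.V_mem j)
  simp only [IntervalPartition.Correspondence.distortion, h1, h2, toDecorated_top]
  rfl

end DiversityPartition

/-! ### Measurability of block counts -/

/-- The number of blocks of mass greater than `h` that satisfy `P`. -/
noncomputable def IntervalPartition.countIf (β : IntervalPartition) (P : ℝ × ℝ → Prop) (h : ℝ) :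
    ℕ :=
  {U ∈ β.blocks | h < blockMass U ∧ P U}.ncard

namespace IntervalPartition

variable {α : ℝ} (β : IntervalPartition) {P Q : ℝ × ℝ → Prop}

theorem finite_countIf (P : ℝ × ℝ → Prop) {h : ℝ} (hh : 0 < h) :
    {U ∈ β.blocks | h < blockMass U ∧ P U}.Finite :=
  (β.finite_large_blocks hh).subset fun _ hU => ⟨hU.1, hU.2.1⟩

theorem countIf_le (hPQ : ∀ U ∈ β.blocks, P U → Q U) {h : ℝ} (hh : 0 < h) :
    β.countIf P h ≤ β.countIf Q h :=
  ncard_le_ncard (fun U hU => ⟨hU.1, hU.2.1, hPQ U hU.1 hU.2.2⟩) (β.finite_countIf Q hh)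

theorem countIf_congr (hPQ : ∀ U ∈ β.blocks, P U ↔ Q U) : β.countIf P = β.countIf Q := by
  funext h
  unfold countIf
  congr 1
  ext U
  exact ⟨fun hU => ⟨hU.1, hU.2.1, (hPQ U hU.1).1 hU.2.2⟩,
    fun hU => ⟨hU.1, hU.2.1, (hPQ U hU.1).2 hU.2.2⟩⟩

theorem continuousWithinAt_countIf (P : ℝ × ℝ → Prop) {h : ℝ} (hh : 0 < h) :
    ContinuousWithinAt (fun h : ℝ => h ^ α * (β.countIf P h : ℝ)) (Ioi h) h := by
  have hfin := β.finite_countIf P hh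
  have hev : ∀ᶠ h' in 𝓝[>] h, ∀ U ∈ {U ∈ β.blocks | h < blockMass U ∧ P U},
      h' < blockMass U :=
    (Filter.eventually_all_finite hfin).2 fun U hU =>
      eventually_nhdsWithin_of_eventually_nhds (gt_mem_nhds hU.2.1)
  have heq : ∀ᶠ h' in 𝓝[>] h, β.countIf P h' = β.countIf P h := by
    filter_upwards [hev, self_mem_nhdsWithin] with h' h1 h2
    unfold countIf
    congr 1
    ext U
    exact ⟨fun hU => ⟨hU.1, lt_trans h2 hU.2.1, hU.2.2⟩, fun hU => ⟨hU.1, h1 U hU, hU.2.2⟩⟩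
  have hc : ContinuousWithinAt (fun h' : ℝ => h' ^ α * (β.countIf P h : ℝ)) (Ioi h) h :=
    ((Real.continuousAt_rpow_const h α (Or.inl hh.ne')).mul
      continuousAt_const).continuousWithinAt
  refine hc.congr_of_eventuallyEq ?_ rfl
  filter_upwards [heq] with h' h1
  rw [h1]

/-- The positive rational numbers tending to zero. -/
def ratFilter : Filter {q : ℚ // 0 < q} := comap (fun q => ((q : ℚ) : ℝ)) (𝓝[>] 0)

instance : ratFilter.IsCountablyGenerated := by
  unfold ratFilter
  infer_instance

/-- The function is right-continuous in `h` by `continuousWithinAt_countIf`, so a deviation at a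
real `h` persists at a nearby rational. Countably many `h` then suffice in the measurability
argument. -/
theorem tendsto_ratFilter_iff (P : ℝ × ℝ → Prop) {D : ℝ} :
    Tendsto (fun q : {q : ℚ // 0 < q} => ((q : ℚ) : ℝ) ^ α * (β.countIf P ((q : ℚ) : ℝ) : ℝ))
      ratFilter (𝓝 D) ↔
    Tendsto (fun h : ℝ => h ^ α * (β.countIf P h : ℝ)) (𝓝[>] 0) (𝓝 D) := by
  refine ⟨fun H => ?_, fun H => H.comp tendsto_comap⟩
  rw [Metric.tendsto_nhds] at H ⊢
  intro ε hε
  have h1 := H (ε / 2) (half_pos hε)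
  unfold ratFilter at h1
  rw [eventually_comap] at h1
  obtain ⟨δ, hδ, hsub⟩ := mem_nhdsGT_iff_exists_Ioo_subset.1 h1
  filter_upwards [Ioo_mem_nhdsGT (show (0 : ℝ) < δ from hδ)] with h hh
  by_contra! hcon
  have hcw := β.continuousWithinAt_countIf (α := α) P hh.1
  have hev := (hcw.dist continuousWithinAt_const).eventually
    (lt_mem_nhds ((half_lt_self hε).trans_le hcon))
  obtain ⟨u, hu, husub⟩ := mem_nhdsGT_iff_exists_Ioo_subset.1 hev
  obtain ⟨q, hq1, hq2⟩ := exists_rat_btwn (lt_min (show h < u from hu) hh.2)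
  have hq0 : (0 : ℝ) < q := hh.1.trans hq1
  have a1 := hsub ⟨hq0, hq2.trans_le (min_le_right _ _)⟩ ⟨q, by exact_mod_cast hq0⟩ rfl
  have a2 := husub ⟨hq1, hq2.trans_le (min_le_left _ _)⟩
  exact lt_asymm a1 a2

end IntervalPartition

section measurable

/-- Two disjoint intervals of length above `2 * ε` cannot both have endpoints within `ε` of those of
one interval, which gives injectivity. -/
theorem exists_injOn_blocks {x y : DecoratedPartition} {T : Finset ((ℝ × ℝ) × (ℝ × ℝ))} {ε : ℝ}
    (hT : IsMatchingBound x y T ε) {S : Finset (ℝ × ℝ)} (hS : ∀ U ∈ S, U ∈ x.part.blocks)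
    (hm : ∀ U ∈ S, 2 * ε < blockMass U) :
    ∃ V : ℝ × ℝ → ℝ × ℝ, Set.InjOn V S ∧ ∀ U ∈ S, V U ∈ y.part.blocks ∧
      |U.1 - (V U).1| ≤ ε ∧ |U.2 - (V U).2| ≤ ε ∧ |x.value U - y.value (V U)| ≤ ε := by
  have hε := hT.eps_nonneg
  have hex : ∀ U, ∃ V : ℝ × ℝ, U ∈ S → V ∈ y.part.blocks ∧
      |U.1 - V.1| ≤ ε ∧ |U.2 - V.2| ≤ ε ∧ |x.value U - y.value V| ≤ ε := fun U => by
    by_cases hU : U ∈ S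
    · obtain ⟨V, h⟩ := hT.exists_block (hS U hU) (by linarith [hm U hU])
      exact ⟨V, fun _ => h⟩
    · exact ⟨0, fun h => absurd h hU⟩
  choose V hV using hex
  refine ⟨V, fun U hU U' hU' e => ?_, hV⟩
  by_contra hne
  obtain ⟨-, a1, a2, -⟩ := hV U hU
  obtain ⟨-, b1, b2, -⟩ := hV U' hU'
  have m1 := hm U hU
  have m2 := hm U' hU'
  rw [← e] at b1 b2
  rw [abs_le] at a1 a2 b1 b2
  simp only [blockMass] at m1 m2
  rcases x.part.block_separated (hS U hU) (hS U' hU') hne with h | h <;> linarith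

/-- Finitely many blocks persist, distinct and only slightly displaced, under small perturbations
for $d_{\mathcal J}$. Hence the events that a block count is at least `k` are open. -/
theorem isOpen_exists_blocks {W : Set (ℝ × ℝ × ℝ)} (hW : IsOpen W) (k : ℕ) :
    IsOpen {x : DecoratedPartition | ∃ S : Finset (ℝ × ℝ), S.card = k ∧
      ∀ U ∈ S, U ∈ x.part.blocks ∧ (U.1, U.2, x.value U) ∈ W} := by
  classical
  rw [Metric.isOpen_iff]
  rintro x ⟨S, hk, hS⟩
  have hev : ∀ᶠ ε : ℝ in 𝓝[>] 0, ∀ U ∈ S, 2 * ε < blockMass U ∧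
      Metric.closedBall (U.1, U.2, x.value U) ε ⊆ W := by
    refine (Finset.eventually_all S).2 fun U hU => ?_
    have hpos := x.part.blockMass_pos (hS U hU).1
    obtain ⟨r, hr, hball⟩ := Metric.isOpen_iff.1 hW _ (hS U hU).2
    filter_upwards [Ioo_mem_nhdsGT (show (0 : ℝ) < min (blockMass U / 2) r by positivity)]
      with ε hε
    have h1 := hε.2.trans_le (min_le_left _ _)
    have h2 := hε.2.trans_le (min_le_right _ _)
    exact ⟨by linarith, (Metric.closedBall_subset_ball h2).trans hball⟩
  obtain ⟨ε, hε, hε0⟩ := (hev.and self_mem_nhdsWithin).exists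
  refine ⟨ε, hε0, fun y hy => ?_⟩
  have hy' : dJ x y < ε := by
    rw [← DecoratedPartition.dist_def, dist_comm]
    exact hy
  obtain ⟨T, hT⟩ := exists_isMatchingBound hy'
  obtain ⟨V, hVi, hV⟩ := exists_injOn_blocks hT (fun U hU => (hS U hU).1) fun U hU => (hε U hU).1
  refine ⟨S.image V, by rw [Finset.card_image_of_injOn hVi, hk], fun U' hU' => ?_⟩
  obtain ⟨U, hU, rfl⟩ := Finset.mem_image.1 hU'
  obtain ⟨h1, h2, h3, h4⟩ := hV U hU
  refine ⟨h1, (hε U hU).2 ?_⟩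
  rw [Metric.mem_closedBall, dist_comm]
  exact max_le h2 (max_le h3 h4)

theorem isOpen_exists_block {W : Set (ℝ × ℝ × ℝ)} (hW : IsOpen W) :
    IsOpen {x : DecoratedPartition | ∃ U ∈ x.part.blocks, (U.1, U.2, x.value U) ∈ W} := by
  convert! isOpen_exists_blocks hW 1 using 1
  ext x
  constructor
  · rintro ⟨U, hU⟩
    exact ⟨{U}, rfl, fun V hV => by rwa [Finset.mem_singleton.1 hV]⟩
  · rintro ⟨S, hS, h⟩
    obtain ⟨U, rfl⟩ := Finset.card_eq_one.1 hS
    exact ⟨U, h U (Finset.mem_singleton_self U)⟩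

noncomputable instance : MeasurableSpace DecoratedPartition := borel _

instance : BorelSpace DecoratedPartition := ⟨rfl⟩

theorem measurable_countIf {W : Set (ℝ × ℝ × ℝ)} (hW : IsOpen W) {h : ℝ} (hh : 0 < h) :
    Measurable fun x : DecoratedPartition =>
      x.part.countIf (fun U => (U.1, U.2, x.value U) ∈ W) h := by
  refine measurable_of_Ici fun k => IsOpen.measurableSet ?_
  have hW' : IsOpen (W ∩ {p : ℝ × ℝ × ℝ | h < p.2.1 - p.1}) :=
    hW.inter (isOpen_lt (by fun_prop) (by fun_prop))
  convert! isOpen_exists_blocks hW' k using 1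
  ext x
  have hfin := x.part.finite_countIf (fun U => (U.1, U.2, x.value U) ∈ W) hh
  constructor
  · intro hk
    have hk' : k ≤ hfin.toFinset.card := by
      rw [← ncard_eq_toFinset_card _ hfin]
      exact hk
    obtain ⟨S, hS, hSk⟩ := Finset.exists_subset_card_eq hk'
    refine ⟨S, hSk, fun U hU => ?_⟩
    have := hfin.mem_toFinset.1 (hS hU)
    exact ⟨this.1, this.2.2, this.2.1⟩
  · rintro ⟨S, rfl, hS⟩
    change S.card ≤ _
    rw [← ncard_coe_finset]
    exact ncard_le_ncard (fun U hU => ⟨(hS U hU).1, (hS U hU).2.2, (hS U hU).2.1⟩) hfin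

theorem measurable_top : Measurable fun x : DecoratedPartition => (x.f ⊤ : ℝ) := by
  refine Continuous.measurable (LipschitzWith.continuous (K := 1) ?_)
  refine LipschitzWith.of_dist_le_mul fun x y => ?_
  rw [NNReal.coe_one, one_mul, Real.dist_eq]
  refine le_of_forall_pos_le_add fun ε hε => ?_
  obtain ⟨T, hT⟩ := exists_isMatchingBound (lt_add_of_pos_right (dJ x y) hε)
  exact hT.top

-- Evaluation is used only at points inside blocks. With the default `0` elsewhere, superlevel sets
-- at levels `a ≥ 0` are of the form treated in `isOpen_exists_block`.
open Classical in
theorem measurable_block_value (q : ℝ) : Measurable fun x : DecoratedPartition =>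
    if ∃ U ∈ x.part.blocks, q ∈ Ioo U.1 U.2 then (x.f (ENNReal.ofReal q) : ℝ) else 0 := by
  refine measurable_of_Ioi fun a => ?_
  rcases lt_or_ge a 0 with ha | ha
  · convert! MeasurableSet.univ using 1
    refine eq_univ_of_forall fun x => ?_
    simp only [mem_preimage, mem_Ioi]
    split_ifs
    · exact ha.trans_le (NNReal.coe_nonneg _)
    · exact ha
  · have o1 : IsOpen {p : ℝ × ℝ × ℝ | p.1 < q} := isOpen_lt (by fun_prop) (by fun_prop)
    have o2 : IsOpen {p : ℝ × ℝ × ℝ | q < p.2.1} := isOpen_lt (by fun_prop) (by fun_prop)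
    have o3 : IsOpen {p : ℝ × ℝ × ℝ | a < p.2.2} := isOpen_lt (by fun_prop) (by fun_prop)
    have hW : IsOpen {p : ℝ × ℝ × ℝ | (p.1 < q ∧ q < p.2.1) ∧ a < p.2.2} := (o1.and o2).and o3
    convert! (isOpen_exists_block hW).measurableSet using 1
    ext x
    simp only [mem_preimage, mem_Ioi, mem_ofPred_eq]
    constructor
    · intro h
      split_ifs at h with hU
      · obtain ⟨U, hU, hq⟩ := hU
        rw [x.value_eq hU hq] at h
        exact ⟨U, hU, hq, h⟩
      · linarith
    · rintro ⟨U, hU, hq, h⟩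
      rw [if_pos ⟨U, hU, hq⟩, x.value_eq hU hq]
      exact h

end measurable

/-! ### The image of $\iota$ is Borel -/

section range

variable {α : ℝ}

/-- The conditions that characterize the decorated partitions `(η, D_η(· +))`. -/
structure IsDiversityDecoration (α : ℝ) (x : DecoratedPartition) : Prop where
  block : ∀ q : ℚ, (∃ U ∈ x.part.blocks, (q : ℝ) ∈ Ioo U.1 U.2) →
    Tendsto (fun h : ℝ => h ^ α * (x.part.countIf (fun U => U.2 < q) h : ℝ)) (𝓝[>] 0)
      (𝓝 (x.f (ENNReal.ofReal q) / Real.Gamma (1 - α)))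
  total : Tendsto (fun h : ℝ => h ^ α * (x.part.countIf (fun _ => True) h : ℝ)) (𝓝[>] 0)
    (𝓝 (x.f ⊤ / Real.Gamma (1 - α)))
  level : ∀ r : ℚ, ∃ D : ℝ,
    Tendsto (fun h : ℝ => h ^ α * (x.part.countIf (fun U => x.value U < r) h : ℝ)) (𝓝[>] 0) (𝓝 D)

theorem measurableSet_isDiversityDecoration :
    MeasurableSet {x : DecoratedPartition | IsDiversityDecoration α x} := by
  classical
  have hmeas : ∀ {W : Set (ℝ × ℝ × ℝ)}, IsOpen W → ∀ q : {q : ℚ // 0 < q},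
      Measurable fun x : DecoratedPartition => ((q : ℚ) : ℝ) ^ α *
        (x.part.countIf (fun U => (U.1, U.2, x.value U) ∈ W) ((q : ℚ) : ℝ) : ℝ) := by
    intro W hW q
    have hq : (0 : ℝ) < ((q : ℚ) : ℝ) := by exact_mod_cast q.2
    exact ((measurable_from_nat (f := fun n : ℕ => (n : ℝ))).comp
      (measurable_countIf hW hq)).const_mul _
  have hset : {x : DecoratedPartition | IsDiversityDecoration α x} =
      (⋂ q : ℚ, ({x | ∃ U ∈ x.part.blocks, (U.1, U.2, x.value U) ∈
          {p : ℝ × ℝ × ℝ | p.1 < q ∧ (q : ℝ) < p.2.1}}ᶜ ∪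
        {x | Tendsto (fun h : {q : ℚ // 0 < q} => ((h : ℚ) : ℝ) ^ α *
          (x.part.countIf (fun U => (U.1, U.2, x.value U) ∈ {p : ℝ × ℝ × ℝ | p.2.1 < q})
            ((h : ℚ) : ℝ) : ℝ)) IntervalPartition.ratFilter
          (𝓝 ((if ∃ U ∈ x.part.blocks, (q : ℝ) ∈ Ioo U.1 U.2 then
            (x.f (ENNReal.ofReal q) : ℝ) else 0) / Real.Gamma (1 - α)))})) ∩
      {x | Tendsto (fun h : {q : ℚ // 0 < q} => ((h : ℚ) : ℝ) ^ α *
          (x.part.countIf (fun U => (U.1, U.2, x.value U) ∈ (univ : Set (ℝ × ℝ × ℝ)))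
            ((h : ℚ) : ℝ) : ℝ)) IntervalPartition.ratFilter
          (𝓝 ((x.f ⊤ : ℝ) / Real.Gamma (1 - α)))} ∩
      ⋂ r : ℚ, {x | ∃ D : ℝ, Tendsto (fun h : {q : ℚ // 0 < q} => ((h : ℚ) : ℝ) ^ α *
          (x.part.countIf (fun U => (U.1, U.2, x.value U) ∈ {p : ℝ × ℝ × ℝ | p.2.2 < r})
            ((h : ℚ) : ℝ) : ℝ)) IntervalPartition.ratFilter (𝓝 D)} := by
    ext x
    simp only [mem_inter_iff, mem_iInter, mem_union, mem_compl_iff, mem_ofPred_eq,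
      IntervalPartition.tendsto_ratFilter_iff, mem_univ]
    constructor
    · intro hx
      refine ⟨⟨fun q => ?_, hx.total⟩, hx.level⟩
      by_cases hq : ∃ U ∈ x.part.blocks, (q : ℝ) ∈ Ioo U.1 U.2
      · right
        rw [if_pos hq]
        exact hx.block q hq
      · exact Or.inl hq
    · rintro ⟨⟨h1, h2⟩, h3⟩
      refine ⟨fun q hq => ?_, h2, h3⟩
      rcases h1 q with h | h
      · exact absurd hq h
      · rwa [if_pos hq] at h
  rw [hset]
  refine ((MeasurableSet.iInter fun q => ?_).inter ?_).inter (MeasurableSet.iInter fun r => ?_)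
  · refine (IsOpen.measurableSet (isOpen_exists_block ?_)).compl.union ?_
    · have o1 : IsOpen {p : ℝ × ℝ × ℝ | p.1 < q} := isOpen_lt (by fun_prop) (by fun_prop)
      have o2 : IsOpen {p : ℝ × ℝ × ℝ | (q : ℝ) < p.2.1} := isOpen_lt (by fun_prop) (by fun_prop)
      exact o1.and o2
    · exact measurableSet_tendsto_fun (hmeas (isOpen_lt (by fun_prop) (by fun_prop)))
        ((measurable_block_value q).div_const _)
  · exact measurableSet_tendsto_fun (hmeas isOpen_univ) (measurable_top.div_const _)
  · exact measurableSet_exists_tendsto (hmeas (isOpen_lt (by fun_prop) (by fun_prop)))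

theorem isDiversityDecoration_toDecorated (hα : α < 1) (β : DiversityPartition α) :
    IsDiversityDecoration α (β.toDecorated hα) := by
  have hG : Real.Gamma (1 - α) ≠ 0 := (Real.Gamma_pos_of_pos (by linarith)).ne'
  have hdiv : ∀ t, Tendsto (fun h : ℝ => h ^ α * (β.val.count h t : ℝ)) (𝓝[>] 0)
      (𝓝 (β.val.diversity α t / Real.Gamma (1 - α))) := fun t => by
    have := (β.hasDiversity.tendsto t).div_const (Real.Gamma (1 - α))
    refine this.congr fun h => ?_
    field_simp
  have hcount : ∀ {P : ℝ × ℝ → Prop} (t : ℝ), (∀ U ∈ β.val.blocks, U.2 ≤ t ↔ P U) →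
      Tendsto (fun h : ℝ => h ^ α * (β.val.countIf P h : ℝ)) (𝓝[>] 0)
        (𝓝 (β.val.diversity α t / Real.Gamma (1 - α))) := fun {P} t hP => by
    have := hdiv t
    rwa [← β.val.countIf_congr hP]
  refine ⟨fun q ⟨U, hU, hq⟩ => ?_, ?_, fun r => ?_⟩
  · rw [DiversityPartition.toDecorated_f hα β hU hq]
    refine hcount q fun V hV => ⟨fun h => lt_of_le_of_ne h fun e => ?_, le_of_lt⟩
    rcases β.val.notMem_block_of_mem_compl (β.val.right_mem_compl hV) hU with h | h
    · linarith [hq.1]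
    · linarith [hq.2]
  · rw [DiversityPartition.toDecorated_top hα β]
    exact hcount _ fun V hV => ⟨fun _ => trivial, fun _ => (β.val.block_bounds hV).2⟩
  · set x := β.toDecorated hα with hx
    -- By monotonicity the blocks of value below `r` form an initial segment, so they are the blocks
    -- ending by `sSup E`. The point `0` keeps `E` nonempty.
    set E : Set ℝ := insert 0 (Prod.snd '' {U ∈ β.val.blocks | x.value U < r}) with hE
    have hbdd : BddAbove E := by
      refine ⟨β.val.length, ?_⟩
      rintro b (rfl | ⟨U, hU, rfl⟩)
      · exact β.val.length_nonneg
      · exact (β.val.block_bounds hU.1).2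
    refine ⟨_, hcount (sSup E) fun U hU => ⟨fun h => ?_, fun h => ?_⟩⟩
    · by_contra! hr
      have : sSup E ≤ U.1 := by
        refine csSup_le (insert_nonempty _ _) ?_
        rintro b (rfl | ⟨V, hV, rfl⟩)
        · exact (β.val.block_bounds hU).1
        · rcases eq_or_ne U V with rfl | hne
          · exact absurd hV.2 (not_lt.2 hr)
          · rcases β.val.block_separated hU hV.1 hne with h | h
            · exfalso
              have h1 : x.value U ≤ x.value V := by
                refine NNReal.coe_le_coe.2 (x.f_mono (ENNReal.ofReal_le_ofReal ?_))
                linarith [(β.val.blockPoint_mem hU).2, (β.val.blockPoint_mem hV.1).1]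
              linarith [hV.2]
            · exact h
      linarith [β.val.block_lt U hU]
    · exact le_csSup hbdd (mem_insert_of_mem _ ⟨U, ⟨hU, h⟩, rfl⟩)

/-- Inside a block the count is constant in `t`, so a rational point of the same block decides. At a
point of the complement before the end, either the block values to the left approach $f(t)$, and
counts at rational points of blocks on both sides squeeze the limit, or there is a jump. In the
latter case no rational point inside a block need give the left-hand limit, and the condition
`level` is there to supply it. -/
theorem IsDiversityDecoration.hasDiversity (hα : α < 1) {x : DecoratedPartition}
    (hx : IsDiversityDecoration α x) : x.part.HasDiversity α := by
  have hG : 0 < Real.Gamma (1 - α) := Real.Gamma_pos_of_pos (by linarith)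
  intro t ht
  change ∃ D : ℝ, Tendsto (fun h : ℝ => h ^ α * (x.part.countIf (fun U => U.2 ≤ t) h : ℝ))
    (𝓝[>] 0) (𝓝 D)
  rcases x.part.mem_compl_or_mem_block ht with hC | ⟨U, hU, htU⟩
  · rcases eq_or_lt_of_le ht.2 with hL | hL
    · refine ⟨_, hx.total.congr fun h => ?_⟩
      rw [x.part.countIf_congr (P := fun _ => True) (Q := fun U => U.2 ≤ t) fun U hU =>
        ⟨fun _ => hL ▸ (x.part.block_bounds hU).2, fun _ => trivial⟩]
    by_cases hj : ∀ ε > 0, ∃ U ∈ x.part.blocks, U.2 ≤ t ∧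
        (x.f (ENNReal.ofReal t) : ℝ) - ε < x.value U
    · refine ⟨x.f (ENNReal.ofReal t) / Real.Gamma (1 - α), ?_⟩
      rw [tendsto_order]
      refine ⟨fun a ha => ?_, fun a ha => ?_⟩
      · rw [lt_div_iff₀ hG] at ha
        obtain ⟨U, hU, hUt, hv⟩ := hj _ (sub_pos.2 ha)
        obtain ⟨q, hq1, hq2⟩ := exists_rat_btwn (x.part.block_lt U hU)
        have hlim := hx.block q ⟨U, hU, hq1, hq2⟩
        rw [x.value_eq hU ⟨hq1, hq2⟩] at hlim
        filter_upwards [hlim.eventually (lt_mem_nhds (a := a)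
          (by rw [lt_div_iff₀ hG]; linarith)), self_mem_nhdsWithin] with h h1 h2
        have h2' : 0 < h := h2
        refine h1.trans_le ?_
        have := x.part.countIf_le (P := fun V => V.2 < q) (Q := fun V => V.2 ≤ t)
          (fun V _ hV => by linarith) h2'
        gcongr
      · rw [gt_iff_lt, div_lt_iff₀ hG] at ha
        obtain ⟨U, hU, u, hu, hu1, -, hv⟩ := x.exists_value_lt ht.1 hL ha zero_lt_one
        obtain ⟨q, hq1, hq2⟩ := exists_rat_btwn (x.part.block_lt U hU)
        have htU : t ≤ U.1 := by
          rcases x.part.notMem_block_of_mem_compl hC hU with h | h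
          · exact h
          · linarith [hu.2]
        have hlim := hx.block q ⟨U, hU, hq1, hq2⟩
        rw [x.value_eq hU ⟨hq1, hq2⟩] at hlim
        filter_upwards [hlim.eventually_lt_const ((div_lt_iff₀ hG).2 hv), self_mem_nhdsWithin]
          with h h1 h2
        have h2' : 0 < h := h2
        refine lt_of_le_of_lt ?_ h1
        have := x.part.countIf_le (P := fun V => V.2 ≤ t) (Q := fun V => V.2 < q)
          (fun V _ hV => by linarith) h2'
        gcongr
    · push Not at hj
      obtain ⟨ε, hε, hj⟩ := hj
      -- A rational inside the jump: the blocks of value below `r` are exactly those ending by `t`.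
      obtain ⟨r, hr1, hr2⟩ := exists_rat_btwn (sub_lt_self (x.f (ENNReal.ofReal t) : ℝ) hε)
      obtain ⟨D, hD⟩ := hx.level r
      refine ⟨D, hD.congr fun h => ?_⟩
      rw [x.part.countIf_congr (P := fun V => x.value V < r) (Q := fun V => V.2 ≤ t)
        fun U hU => ⟨fun h => ?_, fun h => (hj U hU h).trans_lt hr1⟩]
      rcases x.part.notMem_block_of_mem_compl hC hU with h' | h'
      · exfalso
        have h1 : (x.f (ENNReal.ofReal t) : ℝ) ≤ x.value U :=
          NNReal.coe_le_coe.2 (x.f_mono (ENNReal.ofReal_le_ofReal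
            (h'.trans (x.part.blockPoint_mem hU).1.le)))
        linarith
      · exact h'
  · obtain ⟨q, hq1, hq2⟩ := exists_rat_btwn htU.2
    have hq : (q : ℝ) ∈ Ioo U.1 U.2 := ⟨htU.1.trans hq1, hq2⟩
    refine ⟨_, (hx.block q ⟨U, hU, hq⟩).congr fun h => ?_⟩
    rw [x.part.countIf_congr (P := fun V => V.2 < q) (Q := fun V => V.2 ≤ t) fun V hV =>
      ⟨fun h => ?_, fun h => by linarith⟩]
    rcases x.part.notMem_block_of_mem_compl (x.part.right_mem_compl hV) hU with h' | h'
    · linarith [htU.1]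
    · linarith

theorem range_toDecorated (hα : α < 1) :
    range (DiversityPartition.toDecorated hα) = {x | IsDiversityDecoration α x} := by
  have hG : Real.Gamma (1 - α) ≠ 0 := (Real.Gamma_pos_of_pos (by linarith)).ne'
  apply Subset.antisymm
  · rintro _ ⟨β, rfl⟩
    exact isDiversityDecoration_toDecorated hα β
  · intro x hx
    let β : DiversityPartition α := ⟨x.part, hx.hasDiversity hα⟩
    have hβ := isDiversityDecoration_toDecorated hα β
    refine ⟨β, DecoratedPartition.ext_of_value rfl (fun U hU => ?_) ?_⟩
    · obtain ⟨q, hq1, hq2⟩ := exists_rat_btwn (x.part.block_lt U hU)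
      have h1 := tendsto_nhds_unique (hβ.block q ⟨U, hU, hq1, hq2⟩)
        (hx.block q ⟨U, hU, hq1, hq2⟩)
      rw [div_left_inj' hG] at h1
      rw [← x.value_eq hU ⟨hq1, hq2⟩, ← h1, (β.toDecorated hα).value_eq hU ⟨hq1, hq2⟩]
    · have h1 := tendsto_nhds_unique hβ.total hx.total
      rw [div_left_inj' hG] at h1
      exact NNReal.coe_injective h1

theorem measurableSet_range_toDecorated (hα : α < 1) :
    MeasurableSet (range (DiversityPartition.toDecorated hα)) := by
  rw [range_toDecorated]
  exact measurableSet_isDiversityDecoration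

end range

/-! ### Partitions with prescribed diversity -/

theorem tendsto_rpow_mul_bounded {α : ℝ} (hα : 0 < α) {c : ℝ → ℕ} {N : ℕ}
    (hc : ∀ h > 0, c h ≤ N) : Tendsto (fun h : ℝ => h ^ α * (c h : ℝ)) (𝓝[>] 0) (𝓝 0) := by
  have h0 : Tendsto (fun h : ℝ => h ^ α) (𝓝[>] 0) (𝓝 0) := by
    have := (Real.continuousAt_rpow_const 0 α (Or.inr hα.le)).tendsto
    rw [Real.zero_rpow hα.ne'] at this
    exact this.mono_left nhdsWithin_le_nhds
  have h1 : Tendsto (fun h : ℝ => h ^ α * (N : ℝ)) (𝓝[>] 0) (𝓝 0) := by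
    simpa using h0.mul_const (N : ℝ)
  refine squeeze_zero' ?_ ?_ h1
  · filter_upwards [self_mem_nhdsWithin] with h hh
    have : (0 : ℝ) < h := hh
    positivity
  · filter_upwards [self_mem_nhdsWithin] with h hh
    have hh' : (0 : ℝ) < h := hh
    have : (c h : ℝ) ≤ N := by exact_mod_cast hc h hh'
    gcongr

namespace IntervalPartition

section sequence

variable {m : ℕ → ℝ}

theorem exists_partialSum_le_lt (hs : Summable m) {t : ℝ} (h0 : 0 ≤ t) (ht : t < ∑' k, m k) :
    ∃ k, ∑ i ∈ Finset.range k, m i ≤ t ∧ t < ∑ i ∈ Finset.range (k + 1), m i := by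
  classical
  have hex : ∃ k, t < ∑ i ∈ Finset.range k, m i :=
    (hs.hasSum.tendsto_sum_nat.eventually (lt_mem_nhds ht)).exists
  have h1 := Nat.find_spec hex
  have h2 : Nat.find hex ≠ 0 := fun h => by
    rw [h] at h1
    simp at h1
    linarith
  obtain ⟨k, hk⟩ := Nat.exists_eq_succ_of_ne_zero h2
  refine ⟨k, not_lt.1 (Nat.find_min hex (m := k) (by omega)), ?_⟩
  rwa [hk] at h1

/-- The interval partition whose blocks have the masses `m 0, m 1, …` from left to right. -/
noncomputable def ofSequence (m : ℕ → ℝ) (hm : ∀ k, 0 < m k) (hs : Summable m) :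
    IntervalPartition where
  blocks := range fun k => (∑ i ∈ Finset.range k, m i, ∑ i ∈ Finset.range (k + 1), m i)
  length := ∑' k, m k
  length_nonneg := tsum_nonneg fun k => (hm k).le
  block_lt := by
    rintro _ ⟨k, rfl⟩
    simp only [Finset.sum_range_succ]
    linarith [hm k]
  block_subset := by
    rintro _ ⟨k, rfl⟩ t ht
    exact ⟨(Finset.sum_nonneg (s := Finset.range k) fun i _ => (hm i).le).trans ht.1.le,
      ht.2.le.trans (hs.sum_le_tsum (Finset.range (k + 1)) fun i _ => (hm i).le)⟩
  block_disjoint := by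
    have hmono : Monotone fun k => ∑ i ∈ Finset.range k, m i :=
      monotone_nat_of_le_succ fun k => by
        rw [Finset.sum_range_succ]
        linarith [hm k]
    rintro _ ⟨k, rfl⟩ _ ⟨l, rfl⟩ hne
    simp only [Function.onFun, Ioo_disjoint_Ioo]
    rcases lt_trichotomy k l with h | rfl | h
    · exact (min_le_left _ _).trans ((hmono (show k + 1 ≤ l from h)).trans (le_max_right _ _))
    · exact absurd rfl hne
    · exact (min_le_right _ _).trans ((hmono (show l + 1 ≤ k from h)).trans (le_max_left _ _))
  block_cover := by
    have hc : (insert (∑' k, m k) (range fun k => ∑ i ∈ Finset.range k, m i)).Countable :=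
      (countable_range _).insert _
    refine measure_mono_null (fun t ht => ?_) (hc.measure_zero volume)
    rcases eq_or_lt_of_le ht.1.2 with h | h
    · exact Or.inl h
    · obtain ⟨k, hk1, hk2⟩ := exists_partialSum_le_lt hs ht.1.1 h
      rcases eq_or_lt_of_le hk1 with h' | h'
      · exact Or.inr ⟨k, h'⟩
      · refine absurd (mem_iUnion₂.2 ?_) ht.2
        exact ⟨_, ⟨k, rfl⟩, ⟨h', hk2⟩⟩

variable (hm : ∀ k, 0 < m k) (hs : Summable m)

theorem compl_ofSequence {t : ℝ} (ht : t ∈ (ofSequence m hm hs).compl) : t = 0 ∨ m 0 ≤ t := by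
  have hb : ((0 : ℝ), m 0) ∈ (ofSequence m hm hs).blocks := ⟨0, by simp⟩
  rcases notMem_block_of_mem_compl _ ht hb with h | h
  · exact Or.inl (le_antisymm h (compl_subset _ ht).1)
  · exact Or.inr h

theorem first_mem_compl_ofSequence : m 0 ∈ (ofSequence m hm hs).compl :=
  right_mem_compl _ (U := (0, m 0)) ⟨0, by simp⟩

theorem count_ofSequence_of_lt {t : ℝ} (ht : t < ∑' k, m k) :
    ∃ N, ∀ h > 0, (ofSequence m hm hs).count h t ≤ N := by
  classical
  obtain ⟨N, hN⟩ := (hs.hasSum.tendsto_sum_nat.eventually (lt_mem_nhds ht)).exists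
  have hmono : Monotone fun k => ∑ i ∈ Finset.range k, m i :=
    monotone_nat_of_le_succ fun k => by
      rw [Finset.sum_range_succ]
      linarith [hm k]
  refine ⟨N, fun h _ => ?_⟩
  have hsub : {U ∈ (ofSequence m hm hs).blocks | h < blockMass U ∧ U.2 ≤ t} ⊆
      ((Finset.range N).image fun k =>
        (∑ i ∈ Finset.range k, m i, ∑ i ∈ Finset.range (k + 1), m i) : Finset (ℝ × ℝ)) := by
    rintro _ ⟨⟨k, rfl⟩, -, hk⟩
    refine Finset.mem_coe.2 (Finset.mem_image_of_mem _ (Finset.mem_range.2 ?_))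
    by_contra! hNk
    have h1 := hmono (show N ≤ k + 1 by omega)
    simp only at h1 hk
    linarith
  refine (ncard_le_ncard hsub (Finset.finite_toSet _)).trans ?_
  rw [ncard_coe_finset]
  exact Finset.card_image_le.trans (by simp)

theorem count_ofSequence_length (h : ℝ) :
    (ofSequence m hm hs).count h (ofSequence m hm hs).length = {k | h < m k}.ncard := by
  have hmono : StrictMono fun k => ∑ i ∈ Finset.range k, m i :=
    strictMono_nat_of_lt_succ fun k => by
      rw [Finset.sum_range_succ]
      linarith [hm k]
  have hinj : Function.Injective fun k =>
      (∑ i ∈ Finset.range k, m i, ∑ i ∈ Finset.range (k + 1), m i) := fun k l e =>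
    hmono.injective (Prod.ext_iff.1 e).1
  have hmass : ∀ k, blockMass (∑ i ∈ Finset.range k, m i, ∑ i ∈ Finset.range (k + 1), m i)
      = m k := fun k => by simp [blockMass, Finset.sum_range_succ]
  unfold count
  rw [← ncard_image_of_injective _ hinj]
  congr 1
  ext U
  constructor
  · rintro ⟨⟨k, rfl⟩, hk, -⟩
    simp only [hmass] at hk
    exact ⟨k, hk, rfl⟩
  · rintro ⟨k, hk, rfl⟩
    exact ⟨⟨k, rfl⟩, (hmass k).symm ▸ hk, ((ofSequence m hm hs).block_bounds ⟨k, rfl⟩).2⟩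

/-- The blocks accumulate only at the right end, so any earlier point sees finitely many of them and
all the diversity sits in the end point. -/
theorem tendsto_count_ofSequence {α c : ℝ} (hα : 0 < α)
    (hc : Tendsto (fun h : ℝ => h ^ α * ({k | h < m k}.ncard : ℝ)) (𝓝[>] 0) (𝓝 c)) (t : ℝ) :
    Tendsto (fun h : ℝ => h ^ α * ((ofSequence m hm hs).count h t : ℝ)) (𝓝[>] 0)
      (𝓝 (if (ofSequence m hm hs).length ≤ t then c else 0)) := by
  split_ifs with ht
  · simp_rw [count_of_length_le _ ht, count_ofSequence_length]
    exact hc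
  · obtain ⟨N, hN⟩ := count_ofSequence_of_lt hm hs (not_le.1 ht)
    exact tendsto_rpow_mul_bounded hα hN

end sequence

section powerLaw

theorem lt_powerLaw_iff {α c h x : ℝ} (hα : 0 < α) (hc : 0 < c) (hh : 0 < h) (hx : 0 < x) :
    h < c * x ^ (-α⁻¹) ↔ x < (c / h) ^ α := by
  rw [Real.rpow_neg hx.le, ← div_eq_mul_inv, lt_div_iff₀ (by positivity), mul_comm,
    ← lt_div_iff₀ hh, Real.rpow_inv_lt_iff_of_pos hx.le (by positivity) hα]

/-- The mass $cj^{-1/\alpha}$ exceeds `h` exactly when $j<(c/h)^\alpha$. The missing first `k₀`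
terms and the arbitrary `m 0` change the count by a bounded amount, which $h^\alpha$ kills. -/
theorem tendsto_ncard_powerLaw {α c : ℝ} (hα : 0 < α) (hc : 0 < c) {m : ℕ → ℝ} (k₀ : ℕ)
    (hm : ∀ k, m (k + 1) = c * ((k + k₀ : ℕ) + 1 : ℝ) ^ (-α⁻¹)) :
    Tendsto (fun h : ℝ => h ^ α * ({k | h < m k}.ncard : ℝ)) (𝓝[>] 0) (𝓝 (c ^ α)) := by
  have h0 : Tendsto (fun h : ℝ => h ^ α) (𝓝[>] 0) (𝓝 0) := by
    have := (Real.continuousAt_rpow_const 0 α (Or.inr hα.le)).tendsto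
    rw [Real.zero_rpow hα.ne'] at this
    exact this.mono_left nhdsWithin_le_nhds
  have hlow : Tendsto (fun h : ℝ => c ^ α - h ^ α * (1 + k₀)) (𝓝[>] 0) (𝓝 (c ^ α)) := by
    simpa using (h0.mul_const (1 + k₀ : ℝ)).const_sub (c ^ α)
  have hupp : Tendsto (fun h : ℝ => c ^ α + h ^ α * 2) (𝓝[>] 0) (𝓝 (c ^ α)) := by
    simpa using (h0.mul_const (2 : ℝ)).const_add (c ^ α)
  have hmem : ∀ h > 0, ∀ k, h < m (k + 1) ↔ k + k₀ + 1 < ⌈(c / h) ^ α⌉₊ := by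
    intro h hh k
    rw [hm, lt_powerLaw_iff hα hc hh (by positivity), Nat.lt_ceil]
    push_cast
    rfl
  have hX : ∀ h : ℝ, 0 < h → h ^ α * (c / h) ^ α = c ^ α := fun h hh => by
    rw [← Real.mul_rpow hh.le (by positivity), mul_div_cancel₀ _ hh.ne']
  have hsub : ∀ h > 0, {k | h < m k} ⊆ (Finset.range (⌈(c / h) ^ α⌉₊ + 1) : Finset ℕ) := by
    intro h hh k hk
    rw [Finset.mem_coe, Finset.mem_range]
    cases k with
    | zero => omega
    | succ k => have := (hmem h hh k).1 hk; omega
  refine tendsto_of_tendsto_of_tendsto_of_le_of_le' hlow hupp ?_ ?_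
  · filter_upwards [self_mem_nhdsWithin] with h hh
    have hh' : (0 : ℝ) < h := hh
    have h1 : ⌈(c / h) ^ α⌉₊ - (1 + k₀) ≤ {k | h < m k}.ncard := by
      have hs : (((Finset.range (⌈(c / h) ^ α⌉₊ - (1 + k₀))).image Nat.succ : Finset ℕ) : Set ℕ)
          ⊆ {k | h < m k} := by
        intro k hk
        obtain ⟨j, hj, rfl⟩ := Finset.mem_image.1 (Finset.mem_coe.1 hk)
        have := Finset.mem_range.1 hj
        exact (hmem h hh' j).2 (by omega)
      have := ncard_le_ncard hs ((Finset.finite_toSet _).subset (hsub h hh'))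
      rwa [ncard_coe_finset, Finset.card_image_of_injective _ Nat.succ_injective,
        Finset.card_range] at this
    have h2 : (c / h) ^ α - (1 + k₀) ≤ {k | h < m k}.ncard := by
      have h3 : ⌈(c / h) ^ α⌉₊ ≤ {k | h < m k}.ncard + (1 + k₀) := by omega
      have h4 : (⌈(c / h) ^ α⌉₊ : ℝ) ≤ {k | h < m k}.ncard + (1 + k₀) := by exact_mod_cast h3
      linarith [Nat.le_ceil ((c / h) ^ α)]
    have h5 : (0 : ℝ) ≤ h ^ α := by positivity
    have := mul_le_mul_of_nonneg_left h2 h5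
    rw [mul_sub, hX h hh'] at this
    exact this
  · filter_upwards [self_mem_nhdsWithin] with h hh
    have hh' : (0 : ℝ) < h := hh
    have h1 : {k | h < m k}.ncard ≤ ⌈(c / h) ^ α⌉₊ + 1 := by
      have := ncard_le_ncard (hsub h hh') (Finset.finite_toSet _)
      rwa [ncard_coe_finset, Finset.card_range] at this
    have h2 : ({k | h < m k}.ncard : ℝ) ≤ (c / h) ^ α + 2 := by
      have h3 : ({k | h < m k}.ncard : ℝ) ≤ ⌈(c / h) ^ α⌉₊ + 1 := by exact_mod_cast h1
      have := Nat.ceil_lt_add_one (show 0 ≤ (c / h) ^ α by positivity)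
      linarith
    have h5 : (0 : ℝ) ≤ h ^ α := by positivity
    have := mul_le_mul_of_nonneg_left h2 h5
    rw [mul_add, hX h hh'] at this
    exact this

/-- One block of length `ℓ` followed by the tail of a power law. The power-law masses are summable
because `α < 1`, so deleting enough terms makes the tail shorter than `κ` without altering its
diversity, while the constant `c` tunes that diversity to `w`. -/
theorem exists_partition_with_diversity {α ℓ w κ : ℝ} (hα0 : 0 < α) (hα1 : α < 1) (hℓ : 0 < ℓ)
    (hw : 0 < w) (hκ : 0 < κ) :
    ∃ γ : IntervalPartition, γ.HasDiversity α ∧ γ.length ≤ ℓ + κ ∧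
      (∀ t ∈ γ.compl, t = 0 ∨ ℓ ≤ t) ∧ ℓ ∈ γ.compl ∧
      ∀ t, γ.diversity α t = if γ.length ≤ t then w else 0 := by
  have hG : 0 < Real.Gamma (1 - α) := Real.Gamma_pos_of_pos (by linarith)
  set c := (w / Real.Gamma (1 - α)) ^ α⁻¹ with hc
  have hc0 : 0 < c := by positivity
  have hcα : c ^ α = w / Real.Gamma (1 - α) := by
    rw [hc, ← Real.rpow_mul (by positivity), inv_mul_cancel₀ hα0.ne', Real.rpow_one]
  set F : ℕ → ℝ := fun j => c * ((j : ℝ) + 1) ^ (-α⁻¹) with hF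
  have hF0 : ∀ j, 0 < F j := fun j => by positivity
  have hFs : Summable F := by
    have h1 : Summable fun n : ℕ => (n : ℝ) ^ (-α⁻¹) :=
      Real.summable_nat_rpow.2 (by
        have := (one_lt_inv₀ hα0).2 hα1
        linarith)
    have h2 := ((summable_nat_add_iff 1).2 h1).mul_left c
    refine h2.congr fun j => ?_
    simp [hF]
  obtain ⟨k₀, hk₀⟩ := ((tendsto_sum_nat_add F).eventually (gt_mem_nhds hκ)).exists
  set m : ℕ → ℝ := fun k => Nat.casesOn k ℓ fun j => F (j + k₀) with hmdef
  have hm0 : m 0 = ℓ := rfl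
  have hmS : ∀ k, m (k + 1) = F (k + k₀) := fun k => rfl
  have hm : ∀ k, 0 < m k := fun k => by
    cases k with
    | zero => exact hℓ
    | succ k => exact hF0 _
  have hs : Summable m := (summable_nat_add_iff 1).1 ((summable_nat_add_iff k₀).2 hFs)
  have hlim : ∀ t, Tendsto (fun h : ℝ => h ^ α * ((ofSequence m hm hs).count h t : ℝ)) (𝓝[>] 0)
      (𝓝 (if (ofSequence m hm hs).length ≤ t then c ^ α else 0)) :=
    tendsto_count_ofSequence hm hs hα0 (tendsto_ncard_powerLaw hα0 hc0 k₀ fun k => rfl)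
  refine ⟨ofSequence m hm hs, fun t _ => ⟨_, hlim t⟩, ?_, fun t ht => compl_ofSequence hm hs ht,
    first_mem_compl_ofSequence hm hs, fun t => ?_⟩
  · change ∑' k, m k ≤ ℓ + κ
    rw [hs.tsum_eq_zero_add]
    simp only [hm0, hmS]
    linarith
  · rw [diversity_eq (hlim t), hcα]
    split_ifs
    · field_simp
    · simp

end powerLaw

section concat

/-- The concatenation of two interval partitions. -/
def concat (β γ : IntervalPartition) : IntervalPartition where
  blocks := β.blocks ∪ (fun U => (U.1 + β.length, U.2 + β.length)) '' γ.blocks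
  length := β.length + γ.length
  length_nonneg := add_nonneg β.length_nonneg γ.length_nonneg
  block_lt := by
    rintro _ (hU | ⟨U, hU, rfl⟩)
    · exact β.block_lt _ hU
    · simpa using γ.block_lt U hU
  block_subset := by
    rintro U' (hU | ⟨U, hU, rfl⟩) t ht
    · have := β.block_subset _ hU ht
      exact ⟨this.1, by linarith [this.2, γ.length_nonneg]⟩
    · have := γ.block_bounds hU
      have h1 := ht.1
      have h2 := ht.2
      simp only at h1 h2
      exact ⟨by linarith [β.length_nonneg], by linarith⟩
  block_disjoint := by
    have hcross : ∀ U ∈ β.blocks, ∀ V ∈ γ.blocks,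
        Disjoint (Ioo U.1 U.2) (Ioo (V.1 + β.length) (V.2 + β.length)) := by
      intro U hU V hV
      rw [Set.disjoint_left]
      intro t h1 h2
      linarith [h1.2, h2.1, (β.block_bounds hU).2, (γ.block_bounds hV).1]
    rintro U' (hU | ⟨U, hU, rfl⟩) V' (hV | ⟨V, hV, rfl⟩) hne
    · exact β.block_disjoint hU hV hne
    · exact hcross _ hU _ hV
    · exact (hcross _ hV _ hU).symm
    · rw [Function.onFun, Set.disjoint_left]
      intro t h1 h2
      have hUV : U ≠ V := fun e => hne (by rw [e])
      have h1' := h1.1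
      have h1'' := h1.2
      have h2' := h2.1
      have h2'' := h2.2
      simp only at h1' h1'' h2' h2''
      rcases γ.block_separated hU hV hUV with h | h <;> linarith
  block_cover := by
    have h1 : volume ((fun t : ℝ => t + -β.length) ⁻¹' γ.compl) = 0 := by
      rw [measure_preimage_add_right]
      exact γ.block_cover
    refine measure_mono_null (fun t ht => ?_) (measure_union_null β.block_cover h1)
    rcases le_or_gt t β.length with h | h
    · refine Or.inl ⟨⟨ht.1.1, h⟩, fun htU => ht.2 ?_⟩
      obtain ⟨U, hU, htU⟩ := mem_iUnion₂.1 htU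
      exact mem_iUnion₂.2 ⟨U, Or.inl hU, htU⟩
    · refine Or.inr ((mem_compl_iff γ).2
        ⟨⟨by linarith, by linarith [ht.1.2]⟩, fun U hU htU => ht.2 ?_⟩)
      exact mem_iUnion₂.2 ⟨_, Or.inr ⟨U, hU, rfl⟩, ⟨by linarith [htU.1], by linarith [htU.2]⟩⟩

variable (β γ : IntervalPartition)

theorem mem_compl_concat {t : ℝ} :
    t ∈ (β.concat γ).compl ↔ t ∈ β.compl ∨ t - β.length ∈ γ.compl := by
  constructor
  · intro ht
    rw [mem_compl_iff] at ht
    rcases le_or_gt t β.length with h | h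
    · exact Or.inl ((mem_compl_iff β).2 ⟨⟨ht.1.1, h⟩, fun U hU => ht.2 U (Or.inl hU)⟩)
    · have hl : t ≤ β.length + γ.length := ht.1.2
      refine Or.inr ((mem_compl_iff γ).2 ⟨⟨by linarith, by linarith⟩, fun U hU htU => ?_⟩)
      exact ht.2 _ (Or.inr ⟨U, hU, rfl⟩) ⟨by linarith [htU.1], by linarith [htU.2]⟩
  · rw [mem_compl_iff (β.concat γ)]
    change _ → t ∈ Icc 0 (β.length + γ.length) ∧ _
    rintro (ht | ht)
    · have hb := β.compl_subset ht
      refine ⟨⟨hb.1, by linarith [hb.2, γ.length_nonneg]⟩, ?_⟩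
      rintro _ (hU | ⟨U, hU, rfl⟩) htU
      · exact ((mem_compl_iff β).1 ht).2 _ hU htU
      · linarith [htU.1, hb.2, (γ.block_bounds hU).1]
    · have hb := γ.compl_subset ht
      refine ⟨⟨by linarith [hb.1, β.length_nonneg], by linarith [hb.2]⟩, ?_⟩
      rintro U' (hU | ⟨U, hU, rfl⟩) htU
      · linarith [htU.2, hb.1, (β.block_bounds hU).2]
      · exact ((mem_compl_iff γ).1 ht).2 _ hU ⟨by linarith [htU.1], by linarith [htU.2]⟩

theorem count_concat {h : ℝ} (hh : 0 < h) (t : ℝ) :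
    (β.concat γ).count h t = β.count h t + γ.count h (t - β.length) := by
  have hinj : Function.Injective fun U : ℝ × ℝ => (U.1 + β.length, U.2 + β.length) := by
    intro U V e
    have := Prod.ext_iff.1 e
    exact Prod.ext (by linarith [this.1]) (by linarith [this.2])
  have hset : {U ∈ (β.concat γ).blocks | h < blockMass U ∧ U.2 ≤ t} =
      {U ∈ β.blocks | h < blockMass U ∧ U.2 ≤ t} ∪
      (fun U => (U.1 + β.length, U.2 + β.length)) ''
        {U ∈ γ.blocks | h < blockMass U ∧ U.2 ≤ t - β.length} := by
    ext U'
    constructor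
    · rintro ⟨hU | ⟨U, hU, rfl⟩, h1, h2⟩
      · exact Or.inl ⟨hU, h1, h2⟩
      · refine Or.inr ⟨U, ⟨hU, ?_, by linarith⟩, rfl⟩
        simpa [blockMass] using h1
    · rintro (⟨hU, h1, h2⟩ | ⟨U, ⟨hU, h1, h2⟩, rfl⟩)
      · exact ⟨Or.inl hU, h1, h2⟩
      · refine ⟨Or.inr ⟨U, hU, rfl⟩, ?_, by simp only; linarith⟩
        simpa [blockMass] using h1
  unfold count
  rw [hset, ncard_union_eq ?_ (β.finite_count hh t) ((γ.finite_count hh _).image _),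
    ncard_image_of_injective _ hinj]
  rw [Set.disjoint_left]
  rintro _ hU ⟨V, hV, rfl⟩
  have h1 := (β.block_bounds hU.1).2
  have h2 := (γ.block_bounds hV.1).1
  have h3 := γ.block_lt V hV.1
  simp only at h1
  linarith

variable {β γ} {α : ℝ}

theorem tendsto_count_concat {D E t : ℝ}
    (h1 : Tendsto (fun h : ℝ => h ^ α * (β.count h t : ℝ)) (𝓝[>] 0) (𝓝 D))
    (h2 : Tendsto (fun h : ℝ => h ^ α * (γ.count h (t - β.length) : ℝ)) (𝓝[>] 0) (𝓝 E)) :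
    Tendsto (fun h : ℝ => h ^ α * ((β.concat γ).count h t : ℝ)) (𝓝[>] 0) (𝓝 (D + E)) := by
  refine (h1.add h2).congr' ?_
  filter_upwards [self_mem_nhdsWithin] with h hh
  rw [count_concat β γ hh]
  push_cast
  ring

theorem HasDiversity.concat (hβ : β.HasDiversity α) (hγ : γ.HasDiversity α) :
    (β.concat γ).HasDiversity α := fun t _ => by
  obtain ⟨D, hD⟩ := hβ.exists_tendsto t
  obtain ⟨E, hE⟩ := hγ.exists_tendsto (t - β.length)
  exact ⟨_, tendsto_count_concat hD hE⟩

theorem diversity_concat (hβ : β.HasDiversity α) (hγ : γ.HasDiversity α) (t : ℝ) :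
    (β.concat γ).diversity α t = β.diversity α t + γ.diversity α (t - β.length) := by
  obtain ⟨D, hD⟩ := hβ.exists_tendsto t
  obtain ⟨E, hE⟩ := hγ.exists_tendsto (t - β.length)
  rw [diversity_eq hD, diversity_eq hE, diversity_eq (tendsto_count_concat hD hE), mul_add]

end concat

/-- The interval partition of length zero. -/
def empty : IntervalPartition where
  blocks := ∅
  length := 0
  length_nonneg := le_rfl
  block_lt := by simp
  block_subset := by simp
  block_disjoint := by simp
  block_cover := by simp

theorem tendsto_count_empty (α t : ℝ) :
    Tendsto (fun h : ℝ => h ^ α * (empty.count h t : ℝ)) (𝓝[>] 0) (𝓝 0) := by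
  have : ∀ h, empty.count h t = 0 := fun h => by simp [count, empty]
  simp [this]

theorem hasDiversity_empty (α : ℝ) : empty.HasDiversity α := fun t _ =>
  ⟨0, tendsto_count_empty α t⟩

theorem diversity_empty (α t : ℝ) : empty.diversity α t = 0 := by
  rw [diversity_eq (tendsto_count_empty α t), mul_zero]

theorem compl_empty {t : ℝ} (ht : t ∈ empty.compl) : t = 0 :=
  le_antisymm (compl_subset _ ht).2 (compl_subset _ ht).1

end IntervalPartition

/-- Clusters of small blocks are placed just to the right of the points of `G`, each raising the
diversity to the next value of `F`. Strict monotonicity and positivity of `F` make all the jumps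
positive, as the construction of a cluster requires. -/
theorem IntervalPartition.exists_partition_of_finset {α : ℝ} (hα0 : 0 < α) (hα1 : α < 1)
    {F : ℝ → ℝ} (hF : StrictMonoOn F (Ici 0)) (hF0 : ∀ t, 0 ≤ t → 0 < F t) (G : Finset ℝ) :
    (∀ g ∈ G, 0 ≤ g) → ∀ κ > 0, ∃ β : IntervalPartition, β.HasDiversity α ∧
      (∀ g ∈ G, ∃ t ∈ β.compl, |t - g| ≤ κ) ∧
      (∀ t ∈ β.compl, t = 0 ∨ ∃ g ∈ G, g ≤ t ∧ t ≤ g + κ) ∧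
      ∀ g ∈ G, ∀ p, g + κ < p → (∀ g' ∈ G, g < g' → p < g') → β.diversity α p = F g := by
  classical
  induction G using Finset.induction_on_max with
  | empty =>
    intro _ κ hκ
    exact ⟨empty, hasDiversity_empty α, by simp, fun t ht => Or.inl (compl_empty ht), by simp⟩
  | insert a G ha ih =>
    intro hG κ hκ
    have hG0 : ∀ g ∈ G, 0 ≤ g := fun g hg => hG g (Finset.mem_insert_of_mem hg)
    have ha0 : 0 ≤ a := hG a (Finset.mem_insert_self a G)
    have hev : ∀ᶠ κ' : ℝ in 𝓝[>] 0, ∀ g ∈ G, κ' < a - g :=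
      eventually_nhdsWithin_of_eventually_nhds ((Finset.eventually_all G).2 fun g hg =>
        gt_mem_nhds (sub_pos.2 (ha g hg)))
    obtain ⟨κ', hκ'1, hκ'2, hκ'3⟩ := (hev.and (Ioo_mem_nhdsGT hκ)).exists
    obtain ⟨β, hβ, hβ1, hβ2, hβ3⟩ := ih hG0 κ' hκ'2
    have hlen : β.length ≤ a := by
      rcases hβ2 _ β.length_mem_compl with h | ⟨g, hg, -, h⟩
      · rw [h]; exact ha0
      · linarith [hκ'1 g hg]
    have hw : ∃ w > 0, ∀ p, β.length ≤ p → β.diversity α p + w = F a := by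
      rcases G.eq_empty_or_nonempty with rfl | hne
      · have hl : β.length = 0 := by
          rcases hβ2 _ β.length_mem_compl with h | ⟨g, hg, -⟩
          · exact h
          · simp at hg
        refine ⟨F a, hF0 a ha0, fun p hp => ?_⟩
        have : β.diversity α p = 0 := by
          rw [diversity_of_length_le hp, hl, diversity]
          simp [β.count_of_nonpos le_rfl, tendsto_const_nhds.limUnder_eq]
        rw [this, zero_add]
      · obtain ⟨g, hg, hmax⟩ : ∃ g ∈ G, ∀ g' ∈ G, g' ≤ g :=
          ⟨G.max' hne, G.max'_mem hne, fun g' hg' => G.le_max' g' hg'⟩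
        refine ⟨F a - F g, sub_pos.2 (hF (hG0 g hg) ha0 (ha g hg)), fun p hp => ?_⟩
        have h1 := hβ3 g hg (max (g + κ' + 1) β.length)
          (lt_of_lt_of_le (by linarith) (le_max_left _ _))
          fun g' hg' h => absurd (hmax g' hg') (not_le.2 h)
        rw [diversity_of_length_le (le_max_right _ _)] at h1
        rw [diversity_of_length_le hp, h1]
        ring
    obtain ⟨w, hw0, hw⟩ := hw
    -- The long block runs from the end of `β` to `a + κ / 2`, and the cluster ends by `a + κ`. The
    -- shift by `κ / 2` keeps this block nonempty even when `β` ends at `a`, as for `a = 0`.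
    obtain ⟨γ, hγ, hγ1, hγ2, hγ3, hγ4⟩ := exists_partition_with_diversity hα0 hα1
      (show 0 < a + κ / 2 - β.length by linarith) hw0 (half_pos hκ)
    have hγl : a + κ / 2 - β.length ≤ γ.length := (γ.compl_subset hγ3).2
    refine ⟨β.concat γ, hβ.concat hγ, ?_, ?_, ?_⟩
    · intro g hg
      rcases Finset.mem_insert.1 hg with rfl | hg
      · refine ⟨g + κ / 2, (mem_compl_concat β γ).2 (Or.inr hγ3), ?_⟩
        rw [abs_le]
        constructor <;> linarith
      · obtain ⟨t, ht, htg⟩ := hβ1 g hg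
        exact ⟨t, (mem_compl_concat β γ).2 (Or.inl ht), htg.trans hκ'3.le⟩
    · have key : ∀ t ∈ β.compl, t = 0 ∨ ∃ g ∈ insert a G, g ≤ t ∧ t ≤ g + κ := by
        intro t ht
        rcases hβ2 t ht with h | ⟨g, hg, h1, h2⟩
        · exact Or.inl h
        · exact Or.inr ⟨g, Finset.mem_insert_of_mem hg, h1, by linarith⟩
      intro t ht
      rcases (mem_compl_concat β γ).1 ht with h | h
      · exact key t h
      · rcases hγ2 _ h with h' | h'
        · have : t = β.length := by linarith
          exact key t (this ▸ β.length_mem_compl)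
        · exact Or.inr ⟨a, Finset.mem_insert_self a G, by linarith,
            by linarith [(γ.compl_subset h).2]⟩
    · intro g hg p hp hnext
      rw [diversity_concat hβ hγ, hγ4]
      rcases Finset.mem_insert.1 hg with rfl | hg
      · rw [if_pos (by linarith)]
        exact hw p (by linarith)
      · have hpa := hnext a (Finset.mem_insert_self a G) (ha g hg)
        rw [if_neg (by linarith), add_zero]
        exact hβ3 g hg p (by linarith) fun g' hg' h =>
          hnext g' (Finset.mem_insert_of_mem hg') h

/-! ### Density of the image of $\iota$ -/

theorem DecoratedPartition.f_left (y : DecoratedPartition) {U : ℝ × ℝ} (hU : U ∈ y.part.blocks) :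
    (y.f (ENNReal.ofReal U.1) : ℝ) = y.value U := by
  have hlt := y.part.block_lt U hU
  have hb := y.part.block_bounds hU
  refine le_antisymm (NNReal.coe_le_coe.2 (y.f_mono (ENNReal.ofReal_le_ofReal
    (y.part.blockPoint_mem hU).1.le))) ?_
  by_contra! hcon
  obtain ⟨V, hV, u, hu, hu1, hu2, hu3⟩ :=
    y.exists_value_lt hb.1 (hlt.trans_le hb.2) hcon (sub_pos.2 hlt)
  have : U = V := y.part.block_eq_of_mem hU hV ⟨hu1, by linarith⟩ hu
  rw [this] at hu3
  exact lt_irrefl _ hu3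

theorem DiversityPartition.toDecorated_f_of_notMem_compl {α : ℝ} (hα : α < 1)
    (β : DiversityPartition α) {p : ℝ} (h0 : 0 ≤ p) (hp : p ∉ β.val.compl) :
    ((β.toDecorated hα).f (ENNReal.ofReal p) : ℝ) = β.val.diversity α p := by
  rcases le_or_gt β.val.length p with h | h
  · rw [(β.toDecorated hα).f_tail _ (ENNReal.ofReal_le_ofReal h), β.toDecorated_top hα,
      IntervalPartition.diversity_of_length_le h]
  · rcases β.val.mem_compl_or_mem_block ⟨h0, h.le⟩ with hC | ⟨U, hU, hpU⟩
    · exact absurd hC hp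
    · exact β.toDecorated_f hα hU hpU

theorem IntervalPartition.exists_finite_net (β : IntervalPartition) {δ : ℝ} (hδ : 0 < δ) :
    ∃ G : Finset ℝ, (∀ g ∈ G, g ∈ β.compl) ∧ ∀ t ∈ β.compl, ∃ g ∈ G, |t - g| < δ := by
  obtain ⟨s, hs, hfin, hcov⟩ := β.isCompact_compl.finite_cover_balls hδ
  refine ⟨hfin.toFinset, fun g hg => hs (hfin.mem_toFinset.1 hg), fun t ht => ?_⟩
  obtain ⟨g, hg, htg⟩ := mem_iUnion₂.1 (hcov ht)
  exact ⟨g, hfin.mem_toFinset.2 hg, htg⟩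

theorem denseRange_toDecorated {α : ℝ} (hα0 : 0 < α) (hα1 : α < 1) :
    DenseRange (DiversityPartition.toDecorated hα1) := by
  classical
  refine Metric.denseRange_iff.2 fun y ε hε => ?_
  obtain ⟨S, hS, δ, hδ, H⟩ := exists_isMatchingBound_of_close y (half_pos hε)
    (fun U hU => y.part.blockPoint_mem hU)
  have hL := y.part.length_nonneg
  -- Adding $e(t+1)$ to the decoration makes it strictly increasing and positive, at a cost of at
  -- most `ε / 2` on $[0,\|y\|]$.
  set e := ε / 2 / (y.part.length + 1) with he
  have he0 : 0 < e := by positivity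
  have heL : e * (y.part.length + 1) = ε / 2 := div_mul_cancel₀ _ (by positivity)
  have hFm : StrictMonoOn (fun t : ℝ => (y.f (ENNReal.ofReal t) : ℝ) + e * (t + 1)) (Ici 0) := by
    intro s _ t _ hst
    have h1 : (y.f (ENNReal.ofReal s) : ℝ) ≤ y.f (ENNReal.ofReal t) :=
      NNReal.coe_le_coe.2 (y.f_mono (ENNReal.ofReal_le_ofReal hst.le))
    have h2 : e * (s + 1) < e * (t + 1) := mul_lt_mul_of_pos_left (by linarith) he0
    exact add_lt_add_of_le_of_lt h1 h2
  have hF0 : ∀ t : ℝ, 0 ≤ t → 0 < (y.f (ENNReal.ofReal t) : ℝ) + e * (t + 1) :=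
    fun t ht => by positivity
  obtain ⟨G₀, hG₀, hnet⟩ := y.part.exists_finite_net (show 0 < δ / 4 by positivity)
  -- The net gives Hausdorff closeness, the left endpoints make the diversity correct on the blocks
  -- in `S`, and the length makes the total diversity correct.
  set G := insert y.part.length (G₀ ∪ S.image Prod.fst) with hG
  have hGC : ∀ g ∈ G, g ∈ y.part.compl := by
    intro g hg
    rcases Finset.mem_insert.1 hg with rfl | hg
    · exact y.part.length_mem_compl
    rcases Finset.mem_union.1 hg with hg | hg
    · exact hG₀ g hg
    · obtain ⟨U, hU, rfl⟩ := Finset.mem_image.1 hg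
      exact y.part.left_mem_compl (hS U hU)
  have hev : ∀ᶠ κ : ℝ in 𝓝[>] 0, ∀ U ∈ S, κ < blockPoint U - U.1 :=
    eventually_nhdsWithin_of_eventually_nhds ((Finset.eventually_all S).2 fun U hU =>
      gt_mem_nhds (sub_pos.2 (y.part.blockPoint_mem (hS U hU)).1))
  obtain ⟨κ, hκ1, hκ2, hκ3⟩ :=
    (hev.and (Ioo_mem_nhdsGT (show 0 < δ / 4 by positivity))).exists
  obtain ⟨β, hβ, hβ1, hβ2, hβ3⟩ := IntervalPartition.exists_partition_of_finset hα0 hα1 hFm hF0 G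
    (fun g hg => (y.part.compl_subset (hGC g hg)).1) κ hκ2
  have hdH : IntervalPartition.dH β y.part < δ := by
    refine lt_of_le_of_lt (b := δ / 2) ?_ (half_lt_self hδ)
    refine Metric.hausdorffDist_le_of_mem_dist (by positivity) (fun t ht => ?_) (fun t ht => ?_)
    · rcases hβ2 t ht with rfl | ⟨g, hg, h1, h2⟩
      · exact ⟨0, y.part.zero_mem_compl, by simp; positivity⟩
      · refine ⟨g, hGC g hg, ?_⟩
        rw [Real.dist_eq, abs_le]
        constructor <;> linarith
    · obtain ⟨g, hg, htg⟩ := hnet t ht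
      obtain ⟨s, hs, hsg⟩ := hβ1 g
        (Finset.mem_insert_of_mem (Finset.mem_union_left _ hg))
      refine ⟨s, hs, ?_⟩
      rw [abs_lt] at htg
      rw [abs_le] at hsg
      rw [Real.dist_eq, abs_le]
      constructor <;> linarith
  let b : DiversityPartition α := ⟨β, hβ⟩
  have herr : ∀ t ∈ Icc 0 y.part.length, |e * (t + 1)| ≤ ε / 2 := fun t ht => by
    rw [abs_of_nonneg (mul_nonneg he0.le (by linarith [ht.1])), ← heL]
    exact mul_le_mul_of_nonneg_left (by linarith [ht.2]) he0.le
  suffices hex : ∃ T, IsMatchingBound (b.toDecorated hα1) y T (ε / 2) by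
    obtain ⟨T, hT⟩ := hex
    refine ⟨b, ?_⟩
    rw [dist_comm]
    exact hT.dJ_le.trans_lt (half_lt_self hε)
  refine H (b.toDecorated hα1) hdH (fun U hU => ?_) ?_
  · have hUy := hS U hU
    have hp := y.part.blockPoint_mem hUy
    have hpκ := hκ1 U hU
    have hUG : U.1 ∈ G :=
      Finset.mem_insert_of_mem (Finset.mem_union_right _ (Finset.mem_image_of_mem _ hU))
    have hb := y.part.block_bounds hUy
    have hnot : blockPoint U ∉ β.compl := by
      intro hC
      rcases hβ2 _ hC with h | ⟨g, hg, h1, h2⟩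
      · linarith [hp.1]
      · rcases y.part.notMem_block_of_mem_compl (hGC g hg) hUy with h | h
        · linarith
        · linarith [hp.2]
    rw [b.toDecorated_f_of_notMem_compl hα1 (by linarith [hp.1]) hnot]
    have hD : β.diversity α (blockPoint U) = (y.f (ENNReal.ofReal U.1) : ℝ) + e * (U.1 + 1) := by
      refine hβ3 U.1 hUG (blockPoint U) (by linarith) fun g' hg' h => ?_
      rcases y.part.notMem_block_of_mem_compl (hGC g' hg') hUy with h' | h'
      · linarith
      · linarith [hp.2]
    change |β.diversity α (blockPoint U) - _| ≤ _
    rw [hD, y.f_left hUy, y.value_eq hUy hp, add_sub_cancel_left]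
    exact herr _ ⟨hb.1, by linarith [hp.1, hp.2]⟩
  · have hD := hβ3 y.part.length (Finset.mem_insert_self _ _)
      (max (y.part.length + κ + 1) β.length)
      (lt_of_lt_of_le (by linarith) (le_max_left _ _))
      fun g' hg' h => absurd (y.part.compl_subset (hGC g' hg')).2 (not_le.2 h)
    rw [IntervalPartition.diversity_of_length_le (le_max_right _ _)] at hD
    rw [b.toDecorated_top hα1]
    change |β.diversity α β.length - _| ≤ _
    rw [hD, y.f_tail _ le_rfl, add_sub_cancel_left]
    exact herr _ ⟨hL, le_rfl⟩

/-! ### Topologies, Borel σ-algebras and the Lusin property -/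

section topologies

open TopologicalSpace

theorem continuous_complCompacts_part :
    Continuous fun x : DecoratedPartition => x.part.complCompacts := by
  refine LipschitzWith.continuous (K := 3) (LipschitzWith.of_dist_le_mul fun x y => ?_)
  exact dH_le_dJ x y

/-- The metric `d_H` on interval partitions. -/
noncomputable abbrev hausdorffMetric : MetricSpace IntervalPartition :=
  MetricSpace.induced IntervalPartition.complCompacts IntervalPartition.complCompacts_injective
    inferInstance

/-- The metric `d_H'` on interval partitions. -/
noncomputable abbrev correspondenceMetric : MetricSpace IntervalPartition :=
  MetricSpace.induced IntervalPartition.zeroDecoration IntervalPartition.zeroDecoration_injective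
    inferInstance

/-- The metric `d_α` on interval partitions with `α`-diversity. -/
noncomputable abbrev diversityMetric {α : ℝ} (hα : α < 1) : MetricSpace (DiversityPartition α) :=
  MetricSpace.induced (DiversityPartition.toDecorated hα)
    (DiversityPartition.toDecorated_injective hα) inferInstance

/-- For zero decorations the criterion `tendsto_of_dH` asks only for Hausdorff convergence; the
other inclusion is the Lipschitz bound `dH_le_dJ`. -/
theorem metricTopology_hausdorffMetric :
    metricTopology hausdorffMetric = metricTopology correspondenceMetric := by
  apply le_antisymm
  · let _ := hausdorffMetric
    refine continuous_iff_le_induced.1 (continuous_iff_continuousAt.2 fun β => ?_)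
    refine DecoratedPartition.tendsto_of_dH ?_ (fun U _ => ?_) ?_
    · have h : Tendsto (fun γ : IntervalPartition => dist γ β) (𝓝 β) (𝓝 (dist β β)) :=
        (continuous_id.dist continuous_const).tendsto β
      rw [dist_self] at h
      exact h
    · simp only [IntervalPartition.zeroDecoration_f]
      exact tendsto_const_nhds
    · simp only [IntervalPartition.zeroDecoration_f]
      exact tendsto_const_nhds
  · have h := induced_mono (g := IntervalPartition.zeroDecoration)
      (continuous_iff_le_induced.1 continuous_complCompacts_part)
    rw [induced_compose] at h
    exact h

variable {α : ℝ}

theorem metricTopology_diversityMetric_le (hα : α < 1) :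
    metricTopology (diversityMetric hα)
      ≤ (metricTopology hausdorffMetric).induced DiversityPartition.val := by
  have h := induced_mono (g := DiversityPartition.toDecorated hα)
    (continuous_iff_le_induced.1 continuous_complCompacts_part)
  rw [induced_compose] at h
  refine h.trans (le_of_eq ?_)
  exact (induced_compose (f := DiversityPartition.val (α := α))
    (g := IntervalPartition.complCompacts)).symm

/-- Partitions of length at most $2/(n+1)$ and total diversity one converge to the empty partition
for $d_H$, whereas quantity (iv) keeps them at $d_\alpha$-distance at least one from it. -/
theorem metricTopology_diversityMetric_lt (hα0 : 0 < α) (hα : α < 1) :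
    metricTopology (diversityMetric hα)
      < (metricTopology hausdorffMetric).induced DiversityPartition.val := by
  refine lt_of_le_not_ge (metricTopology_diversityMetric_le hα) fun hle => ?_
  have hpos : ∀ n : ℕ, (0 : ℝ) < 1 / (n + 1) := fun n => by positivity
  choose γ hγ hγ1 hγ2 hγ3 hγ4 using fun n : ℕ =>
    IntervalPartition.exists_partition_with_diversity hα0 hα (hpos n) one_pos (hpos n)
  let b : ℕ → DiversityPartition α := fun n => ⟨γ n, hγ n⟩
  let z : DiversityPartition α :=
    ⟨IntervalPartition.empty, IntervalPartition.hasDiversity_empty α⟩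
  have hH : Tendsto (fun n => (γ n).complCompacts) atTop
      (𝓝 IntervalPartition.empty.complCompacts) := by
    rw [tendsto_iff_dist_tendsto_zero]
    have hlim : Tendsto (fun n : ℕ => (1 : ℝ) / (n + 1) + 1 / (n + 1)) atTop (𝓝 0) := by
      simpa using tendsto_one_div_add_atTop_nhds_zero_nat.add
        (tendsto_one_div_add_atTop_nhds_zero_nat (𝕜 := ℝ))
    refine squeeze_zero (fun _ => dist_nonneg) (fun n => ?_) hlim
    have h0 : (0 : ℝ) ≤ 1 / (n + 1) + 1 / (n + 1) := (add_pos (hpos n) (hpos n)).le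
    refine Metric.hausdorffDist_le_of_mem_dist h0 (fun t ht => ?_) (fun t ht => ?_)
    · refine ⟨0, IntervalPartition.empty.zero_mem_compl, ?_⟩
      have := (γ n).compl_subset ht
      rw [Real.dist_eq, sub_zero, abs_of_nonneg this.1]
      exact this.2.trans (hγ1 n)
    · refine ⟨0, (γ n).zero_mem_compl, ?_⟩
      rw [IntervalPartition.compl_empty ht, dist_self]
      exact h0
  have hb : Tendsto b atTop
      (@nhds _ ((metricTopology hausdorffMetric).induced DiversityPartition.val) z) := by
    have e : (metricTopology hausdorffMetric).induced (DiversityPartition.val (α := α))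
        = induced (IntervalPartition.complCompacts ∘ DiversityPartition.val) inferInstance :=
      induced_compose
    rw [e, nhds_induced, tendsto_comap_iff]
    exact hH
  have hb' : Tendsto b atTop (@nhds _ (metricTopology (diversityMetric hα)) z) :=
    hb.mono_right (nhds_mono hle)
  have hJ : Tendsto (fun n => (b n).toDecorated hα) atTop (𝓝 (z.toDecorated hα)) := by
    rw [nhds_induced, tendsto_comap_iff] at hb'
    exact hb'
  obtain ⟨n, hn⟩ := (Metric.tendsto_nhds.1 hJ 1 one_pos).exists
  obtain ⟨T, hT⟩ := exists_isMatchingBound (x := (b n).toDecorated hα)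
    (y := z.toDecorated hα)
    (ε := (dist ((b n).toDecorated hα) (z.toDecorated hα) + 1) / 2)
    (by rw [← DecoratedPartition.dist_def]; linarith)
  have htop := hT.top
  have e1 : (b n).val.diversity α (b n).val.length = 1 := by
    change (γ n).diversity α (γ n).length = 1
    rw [hγ4, if_pos le_rfl]
  have e2 : z.val.diversity α z.val.length = 0 := IntervalPartition.diversity_empty α _
  rw [DiversityPartition.toDecorated_top, DiversityPartition.toDecorated_top, e1, e2] at htop
  norm_num at htop
  linarith

/-- The inclusion of $d_\alpha$-Borel sets is Lusin–Souslin applied to the passage to the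
complement, restricted to the image of $\iota$; on all of $\mathcal J$ this map forgets the
decoration and is not injective. -/
theorem borel_diversityMetric (hα : α < 1) :
    @borel (DiversityPartition α) (metricTopology (diversityMetric hα))
      = @borel _ ((metricTopology hausdorffMetric).induced DiversityPartition.val) := by
  apply le_antisymm
  · change @borel _ (induced _ _) ≤ @borel _ (induced _ (induced _ _))
    rw [induced_compose, borel_comap, borel_comap]
    rintro s ⟨B, hB, rfl⟩
    borelize (NonemptyCompacts ℝ)
    have hm : MeasurableSet (B ∩ range (DiversityPartition.toDecorated hα)) :=
      MeasurableSet.inter hB (measurableSet_range_toDecorated hα)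
    have himg := hm.image_of_continuousOn_injOn
      (f := fun x : DecoratedPartition => x.part.complCompacts)
      continuous_complCompacts_part.continuousOn (by
        rintro _ ⟨-, β, rfl⟩ _ ⟨-, γ, rfl⟩ h
        have : β = γ := Subtype.ext (IntervalPartition.complCompacts_injective h)
        rw [this])
    refine ⟨_, himg, ?_⟩
    ext β
    constructor
    · rintro ⟨_, ⟨hx, γ, rfl⟩, h⟩
      have : γ = β := Subtype.ext (IntervalPartition.complCompacts_injective h)
      rwa [this] at hx
    · intro hβ
      exact ⟨β.toDecorated hα, ⟨hβ, β, rfl⟩, rfl⟩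
  · exact borel_anti (metricTopology_diversityMetric_le hα)

/-- The separable metric space $\mathcal J$ embeds in the Hilbert cube, and since $\mathcal J$ is
Polish the embedding carries the Borel image of $\iota$ to a Borel set. -/
theorem isLusinSpace_diversityMetric (hα : α < 1) :
    @IsLusinSpace (DiversityPartition α) (metricTopology (diversityMetric hα)) := by
  let _ := diversityMetric hα
  obtain ⟨F, hF⟩ := Metric.PiNatEmbed.exists_embedding_to_hilbert_cube (X := DecoratedPartition)
  let _ : MetricSpace (ℕ → unitInterval) := metrizableSpaceMetric _
  have hι : IsEmbedding (DiversityPartition.toDecorated hα) :=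
    ⟨⟨rfl⟩, DiversityPartition.toDecorated_injective hα⟩
  refine ⟨ℕ → unitInterval, inferInstance, inferInstance, _, hF.comp hι, ?_⟩
  rw [range_comp]
  borelize (ℕ → unitInterval)
  exact (measurableSet_range_toDecorated hα).image_of_continuousOn_injOn
    hF.continuous.continuousOn hF.injective.injOn

end topologies

theorem theorem2 (α : ℝ) (hα0 : 0 < α) (hα1 : α < 1) :
    ∃ (mα : MetricSpace (DiversityPartition α)) (mH mH' : MetricSpace IntervalPartition)
      (mJ : MetricSpace DecoratedPartition),
      -- `d_α` is a metric on `I_α`; so are `d_H`, `d_H'` on `I_H` and `d_J` on `J`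
      (∀ β γ, mα.dist β γ = dAlpha α β γ) ∧
      (∀ β γ, mH.dist β γ = IntervalPartition.dH β γ) ∧
      (∀ β γ, mH'.dist β γ = IntervalPartition.dH' β γ) ∧
      (∀ x y, mJ.dist x y = dJ x y) ∧
      -- `d_H` and `d_H'` have the same subspace topology, and that of `d_α` is strictly finer
      (metricTopology mH).induced (DiversityPartition.val (α := α))
        = (metricTopology mH').induced DiversityPartition.val ∧
      metricTopology mα < (metricTopology mH).induced DiversityPartition.val ∧
      metricTopology mα < (metricTopology mH').induced DiversityPartition.val ∧
      -- the Borel σ-algebras agree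
      @borel (DiversityPartition α) (metricTopology mα)
        = @borel _ ((metricTopology mH).induced DiversityPartition.val) ∧
      @borel (DiversityPartition α) (metricTopology mα)
        = @borel _ ((metricTopology mH').induced DiversityPartition.val) ∧
      -- `(I_α, d_α)` is Lusin
      @IsLusinSpace (DiversityPartition α) (metricTopology mα) ∧
      -- `(J, d_J)` is Polish and a completion of `(I_α, d_α)` through the isometry
      -- `ι(β) = (β, D_β(· +))`, whose image is Borel
      CompleteSpace DecoratedPartition ∧
      TopologicalSpace.SeparableSpace DecoratedPartition ∧
      ∃ ι : DiversityPartition α → DecoratedPartition,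
        (∀ β, (ι β).part = β.val ∧ ∀ t : ℝ, 0 ≤ t →
          Tendsto (β.val.diversity α) (𝓝[>] t) (𝓝 ((ι β).f (ENNReal.ofReal t) : ℝ))) ∧
        Isometry ι ∧ DenseRange ι ∧ MeasurableSet[borel DecoratedPartition] (range ι) := by
  refine ⟨diversityMetric hα1, hausdorffMetric, correspondenceMetric, inferInstance,
    fun β γ => DiversityPartition.dJ_toDecorated hα1 β γ, fun _ _ => rfl,
    IntervalPartition.dJ_zeroDecoration, fun _ _ => rfl, ?_,
    metricTopology_diversityMetric_lt hα0 hα1, ?_, borel_diversityMetric hα1, ?_,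
    isLusinSpace_diversityMetric hα1, inferInstance, inferInstance,
    DiversityPartition.toDecorated hα1, fun β => ⟨rfl, fun t ht => ?_⟩, ?_,
    denseRange_toDecorated hα0 hα1, measurableSet_range_toDecorated hα1⟩
  · rw [metricTopology_hausdorffMetric]
  · rw [← metricTopology_hausdorffMetric]
    exact metricTopology_diversityMetric_lt hα0 hα1
  · rw [← metricTopology_hausdorffMetric]
    exact borel_diversityMetric hα1
  · exact β.tendsto_diversity_right hα1 ht
  · let _ := diversityMetric hα1
    exact Isometry.of_dist_eq fun _ _ => rfl
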